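/- Let $d\ge 2$ and let $P\subset\mathbb R^d$ be a $d$-dimensional polytope (a compact finite intersection of closed half-spaces with affine span $\mathbb R^d$). For each facet ($(d-1)$-dimensional face) $F$ of $P$ let $\eta_F$ be its interior unit normal, and let $F^\circ,\partial F$ be its relative interior and relative boundary. Assume that $P$ is in general position: the normals of any $d$ facets are linearly independent, and the normals of the facets containing any given vertex are linearly independent. Assume that $P$ is obtuse: for every vertex $x$, the barycentric angle $\phi_x$, defined by $\phi_x\in(0,\pi/2)$ and $\sin\phi_x=$ the distance from $0$ to the affine hyperplane through the normals (regarded as points) of the facets containing $x$, satisfies $\phi_x>\pi/4$. Let $f:[0,\pi/2)\to[0,\pi/2)$ be any contracting reflection law, i.e. $f$ is $C^2$, $f(0)=0$ and $0<\sup|f'|<1$. For a unit vector $\eta$ put $R_\eta(v)=v-2\langle v,\eta\rangle\eta$ and, for unit $v$ with $\langle v,\eta\rangle>0$ and $\theta=\arccos\langle v,\eta\rangle$, $$C_\eta(v)=\frac{\cos f(\theta)}{\cos\theta}\langle v,\eta\rangle\eta+\frac{\sin f(\theta)}{\sin\theta}\bigl(v-\langle v,\eta\rangle\eta\bigr),\qquad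 C_\eta(\eta)=\eta .$$ Let $M=\bigcup_F F^\circ\times\{v:\|v\|=1,\ \langle v,\eta_F\rangle>0\}$, and let $M'$ be the set of $(p,v)\in M$ whose half-line $\{p+tv:t\ge0\}$ does not meet $\bigcup_F\partial F$. The contracting billiard map $\Phi=\Phi_{f,P}:M'\to M$ is $\Phi(p,v)=(p+\tau v,\,C_\eta(R_\eta v))$, where $\tau>0$ is the smallest $t>0$ with $p+tv\in\bigcup_F F^\circ$ and $\eta$ is the normal of the facet containing $p+\tau v$. Let $M^+$ be the set of points of $M$ all of whose iterates $\Phi^n(x)$, $n\ge0$, are defined and lie in $M'$, and let $D=\bigcap_{n\ge0}\Phi^n(M^+)$. Then $\Phi_{f,P}$ is uniformly hyperbolic, in the following sense. One has $\Phi(D)\subseteq D$; every $\Phi^n$ is differentiable at the points of $D$; and there are a splitting $T_xM=E^s(x)\oplus E^u(x)$, $x\in D$, continuous in $x\in D$, and constants $0<\lambda<1<\sigma$, $C>0$ such that for all $x\in D$ and $n\ge1$: 1. $D\Phi(E^s(x))\subseteq E^s(\Phi(x))$, with equality whenever $D\Phi(x)$ is injective on $T_xM$, and $D\Phi(E^u(x))=E^u(\Phi(x))$;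 2. $\|D\Phi^n(x)\xi\|\le C\lambda^n\|\xi\|$ for all $\xi\in E^s(x)$; 3. $\|\xi\|\le C\sigma^{-n}\|D\Phi^n(x)\xi\|$ for all $\xi\in E^u(x)$, i.e. the inverse of the isomorphism $D\Phi^n(x):E^u(x)\to E^u(\Phi^n(x))$ has norm at most $C\sigma^{-n}$. -/

import Mathlib

open scoped InnerProductSpace

noncomputable section

namespace PolytopeBilliard

/-! ### Polytopes, facets, general position, barycentric angles -/

/-- The Euclidean space `ℝ^d`. -/
abbrev Space (d : ℕ) : Type := EuclideanSpace ℝ (Fin d)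

/-- A polyhedron: a finite intersection of half-spaces `{x | ⟪v, x⟫ ≤ c}` with `v ≠ 0`. -/
def IsPolyhedron {d : ℕ} (P : Set (Space d)) : Prop :=
  ∃ H : Finset (Space d × ℝ), (∀ h ∈ H, h.1 ≠ 0) ∧ P = {x | ∀ h ∈ H, ⟪h.1, x⟫_ℝ ≤ h.2}

/-- A `d`-dimensional polytope in `ℝ^d`: a compact polyhedron whose affine span is `ℝ^d`. -/
structure IsPolytope {d : ℕ} (P : Set (Space d)) : Prop where
  isPolyhedron : IsPolyhedron P
  isCompact : IsCompact P
  affineSpan_eq_top : affineSpan ℝ P = ⊤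

/-- The face of `P` exposed by `η`: the points of `P` at which `⟪η, ·⟫` attains its minimum
over `P`. -/
def face {d : ℕ} (P : Set (Space d)) (η : Space d) : Set (Space d) :=
  {x ∈ P | ∀ y ∈ P, ⟪η, x⟫_ℝ ≤ ⟪η, y⟫_ℝ}

/-- `η` is the interior unit normal of a `(d-1)`-dimensional face of `P`, which is then `face P η`.
Facets of a `d`-dimensional polytope correspond bijectively to their interior unit normals, and we
index the facets by these normals. -/
def IsFacetNormal {d : ℕ} (P : Set (Space d)) (η : Space d) : Prop :=
  ‖η‖ = 1 ∧ Module.finrank ℝ (vectorSpan ℝ (face P η)) + 1 = d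

/-- The vertices of `P`. -/
def vertices {d : ℕ} (P : Set (Space d)) : Set (Space d) := P.extremePoints ℝ

/-- The interior unit normals of the facets of `P` that contain the point `x`. -/
def normalsAt {d : ℕ} (P : Set (Space d)) (x : Space d) : Set (Space d) :=
  {η | IsFacetNormal P η ∧ x ∈ face P η}

/-- General position: the normals of any `d` facets are linearly independent, and the
normals of the facets incident with any given vertex are linearly independent. -/
structure InGeneralPosition {d : ℕ} (P : Set (Space d)) : Prop where
  linearIndepOn_facets : ∀ s : Finset (Space d), s.card = d → (∀ η ∈ s, IsFacetNormal P η) →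
    LinearIndepOn ℝ id (s : Set (Space d))
  linearIndepOn_vertex : ∀ x ∈ vertices P, LinearIndepOn ℝ id (normalsAt P x)

/-- The barycentric angle of `P` at a vertex `x`: the angle `φ` with `sin φ = ℓ`, where `ℓ` is the
distance from the origin to the affine hyperplane through the normals (regarded as points) of the
facets incident with `x`. -/
def barycentricAngle {d : ℕ} (P : Set (Space d)) (x : Space d) : ℝ :=
  Real.arcsin (Metric.infDist 0 (affineSpan ℝ (normalsAt P x) : Set (Space d)))

/-- `P` is obtuse: the barycentric angle at every vertex is greater than `π / 4`. -/
def IsObtuse {d : ℕ} (P : Set (Space d)) : Prop :=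
  ∀ x ∈ vertices P, Real.pi / 4 < barycentricAngle P x

/-! ### Contracting reflection laws -/

/-- A contracting reflection law: a `C²` map `f : [0, π/2) → [0, π/2)` with `f 0 = 0` and
`0 < sup |f'| < 1`. Only the values of `f` on `[0, π/2)` matter. -/
structure IsContractingLaw (f : ℝ → ℝ) : Prop where
  contDiffOn : ContDiffOn ℝ 2 f (Set.Ico 0 (Real.pi / 2))
  mapsTo : Set.MapsTo f (Set.Ico 0 (Real.pi / 2)) (Set.Ico 0 (Real.pi / 2))
  map_zero : f 0 = 0
  bddAbove : BddAbove
    ((fun θ => |derivWithin f (Set.Ico 0 (Real.pi / 2)) θ|) '' Set.Ico 0 (Real.pi / 2))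
  sSup_pos :
    0 < sSup ((fun θ => |derivWithin f (Set.Ico 0 (Real.pi / 2)) θ|) '' Set.Ico 0 (Real.pi / 2))
  sSup_lt_one :
    sSup ((fun θ => |derivWithin f (Set.Ico 0 (Real.pi / 2)) θ|) '' Set.Ico 0 (Real.pi / 2)) < 1

/-- The specular reflection `R_η` about the hyperplane orthogonal to the unit vector `η`. -/
def specular {d : ℕ} (η v : Space d) : Space d := v - (2 * ⟪v, η⟫_ℝ) • η

/-- The map `C_η` of the open hemisphere around the unit vector `η` induced by `f`: it moves `v`,
at angle `θ = arccos ⟪v, η⟫` from `η`, to the vector at angle `f θ` in the same half-plane. For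
`v = η` the second summand vanishes. -/
def contract {d : ℕ} (f : ℝ → ℝ) (η v : Space d) : Space d :=
  (Real.cos (f (Real.arccos ⟪v, η⟫_ℝ)) / Real.cos (Real.arccos ⟪v, η⟫_ℝ)) • (⟪v, η⟫_ℝ • η) +
  (Real.sin (f (Real.arccos ⟪v, η⟫_ℝ)) / Real.sin (Real.arccos ⟪v, η⟫_ℝ)) • (v - ⟪v, η⟫_ℝ • η)

/-! ### The billiard map -/

/-- Pairs (position, velocity), with the Euclidean norm of `ℝ^d × ℝ^d`. -/
abbrev Phase (d : ℕ) : Type := WithLp 2 (Space d × Space d)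

/-- The union of the relative interiors of the facets. -/
def facetInteriors {d : ℕ} (P : Set (Space d)) : Set (Space d) :=
  {p | ∃ η, IsFacetNormal P η ∧ p ∈ intrinsicInterior ℝ (face P η)}

/-- The `(d-2)`-skeleton: the union of the relative boundaries of the facets. -/
def skeleton {d : ℕ} (P : Set (Space d)) : Set (Space d) :=
  {p | ∃ η, IsFacetNormal P η ∧ p ∈ intrinsicFrontier ℝ (face P η)}

/-- The set `M` of reflections: the union over the facets of (relative interior of the facet) ×
(open unit hemisphere around its interior normal). -/
def reflections {d : ℕ} (P : Set (Space d)) : Set (Phase d) :=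
  {x | ∃ η, IsFacetNormal P η ∧ x.fst ∈ intrinsicInterior ℝ (face P η) ∧
    ‖x.snd‖ = 1 ∧ 0 < ⟪x.snd, η⟫_ℝ}

/-- The domain `M'` of the billiard map: the reflections `(p, v)` whose half-line
`{p + t v | t ≥ 0}` does not meet the skeleton. -/
def billiardDomain {d : ℕ} (P : Set (Space d)) : Set (Phase d) :=
  {x ∈ reflections P | ∀ t : ℝ, 0 ≤ t → x.fst + t • x.snd ∉ skeleton P}

/-- The flight time: the smallest `t > 0` for which `p + t v` is in the relative interior of a facet.
On `billiardDomain P` this infimum is over a one-point set. -/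
def flightTime {d : ℕ} (P : Set (Space d)) (x : Phase d) : ℝ :=
  sInf {t : ℝ | 0 < t ∧ x.fst + t • x.snd ∈ facetInteriors P}

open Classical in
/-- The interior unit normal at a point in the relative interior of a facet (`0` elsewhere). -/
def normalAt {d : ℕ} (P : Set (Space d)) (p : Space d) : Space d :=
  if h : ∃ η, IsFacetNormal P η ∧ p ∈ intrinsicInterior ℝ (face P η) then h.choose else 0

/-- The point of the boundary at which the next collision takes place. -/
def hitPoint {d : ℕ} (P : Set (Space d)) (x : Phase d) : Space d :=
  x.fst + flightTime P x • x.snd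

/-- The contracting billiard map `Φ_{f,P} (p, v) = (p + τ v, C_η (R_η v))`, where `η` is the normal
at `p + τ v`. It is meaningful on `billiardDomain P` only. -/
def billiardMap {d : ℕ} (f : ℝ → ℝ) (P : Set (Space d)) (x : Phase d) : Phase d :=
  WithLp.toLp 2 (hitPoint P x,
    contract f (normalAt P (hitPoint P x)) (specular (normalAt P (hitPoint P x)) x.snd))

/-- The set `M⁺` of the reflections with an infinite forward orbit. -/
def forwardSet {d : ℕ} (f : ℝ → ℝ) (P : Set (Space d)) : Set (Phase d) :=
  {x ∈ reflections P | ∀ n : ℕ, (billiardMap f P)^[n] x ∈ billiardDomain P}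

/-- The set `D = ⋂_{n ≥ 0} Φⁿ(M⁺)`. -/
def maximalSet {d : ℕ} (f : ℝ → ℝ) (P : Set (Space d)) : Set (Phase d) :=
  ⋂ n : ℕ, (billiardMap f P)^[n] '' forwardSet f P

/-! ### Hyperbolicity -/

/-- The tangent space `T_x M = η^⊥ × v^⊥` at `x = (p, v)`, with `η` the normal at `p`. -/
def tangentSpaceAt {d : ℕ} (P : Set (Space d)) (x : Phase d) : Submodule ℝ (Phase d) :=
  (((ℝ ∙ normalAt P x.fst)ᗮ).prod ((ℝ ∙ x.snd)ᗮ)).comap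
    (WithLp.linearEquiv 2 ℝ (Space d × Space d)).toLinearMap

/-- The derivative `DΦⁿ(x)`: the derivative of `Φⁿ` at `x` along the submanifold `M` of
`ℝ^d × ℝ^d`. Only its restriction to `T_x M` is meaningful. -/
def tangentMap {d : ℕ} (f : ℝ → ℝ) (P : Set (Space d)) (n : ℕ) (x : Phase d) :
    Phase d →L[ℝ] Phase d :=
  fderivWithin ℝ ((billiardMap f P)^[n]) (reflections P) x

/-- Uniform hyperbolicity of `Φ = Φ_{f,P}` on the set `Λ`. A reflection law `f` need not be
injective, so `DΦ` may have a kernel in the stable direction: invariance of `Es` is therefore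
`DΦ (Es x) ⊆ Es (Φ x)`, with equality wherever `DΦ x` is injective, and the backward contraction
`‖DΦ⁻ⁿ|Eu‖ ≤ C σ⁻ⁿ` is stated for the inverse of the bijection `DΦⁿ : Eu x → Eu (Φⁿ x)`. -/
def IsUniformlyHyperbolicOn {d : ℕ} (f : ℝ → ℝ) (P : Set (Space d)) (Λ : Set (Phase d)) : Prop :=
  Set.MapsTo (billiardMap f P) Λ Λ ∧
  (∀ n : ℕ, ∀ x ∈ Λ, DifferentiableWithinAt ℝ ((billiardMap f P)^[n]) (reflections P) x) ∧
  ∃ Es Eu : Phase d → Submodule ℝ (Phase d),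
    -- a splitting of the tangent spaces
    (∀ x ∈ Λ, Es x ⊔ Eu x = tangentSpaceAt P x ∧ Disjoint (Es x) (Eu x)) ∧
    -- which is continuous
    ContinuousOn (fun x => (Es x).starProjection) Λ ∧
    ContinuousOn (fun x => (Eu x).starProjection) Λ ∧
    -- and invariant
    (∀ x ∈ Λ, (Es x).map (tangentMap f P 1 x).toLinearMap ≤ Es (billiardMap f P x)) ∧
    (∀ x ∈ Λ, Set.InjOn (tangentMap f P 1 x) (tangentSpaceAt P x) →
      (Es x).map (tangentMap f P 1 x).toLinearMap = Es (billiardMap f P x)) ∧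
    (∀ x ∈ Λ, (Eu x).map (tangentMap f P 1 x).toLinearMap = Eu (billiardMap f P x)) ∧
    -- with uniform rates
    ∃ lam σ C : ℝ, 0 < lam ∧ lam < 1 ∧ 1 < σ ∧ 0 < C ∧
      (∀ n : ℕ, 1 ≤ n → ∀ x ∈ Λ, ∀ ξ ∈ Es x, ‖tangentMap f P n x ξ‖ ≤ C * lam ^ n * ‖ξ‖) ∧
      (∀ n : ℕ, 1 ≤ n → ∀ x ∈ Λ, ∀ ξ ∈ Eu x, ‖ξ‖ ≤ C * (σ ^ n)⁻¹ * ‖tangentMap f P n x ξ‖)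

/-- `Φ_{f,P}` is uniformly hyperbolic: it is so on the set `D`. -/
def IsUniformlyHyperbolic {d : ℕ} (f : ℝ → ℝ) (P : Set (Space d)) : Prop :=
  IsUniformlyHyperbolicOn f P (maximalSet f P)

end PolytopeBilliard

end

open scoped InnerProductSpace

noncomputable section

namespace PolytopeBilliard

/-! ### Estimates for contracting laws -/

/-! The facets are flat, so the outgoing velocity depends only on the incoming velocity and on the
facet. Hence `DΦ` is block triangular: the velocity component of a tangent vector evolves by itself,
and the vectors with zero velocity component form an invariant bundle. The velocity block has norm
at most some `lam < 1` (`norm_velDeriv_le`). It remains to see that the invariant bundle is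
uniformly expanded and to find an invariant complement.

Expansion. On vectors without velocity component one step is the projection along the velocity onto
the next facet. Measure such a vector by its part `w` orthogonal to the velocity. A collision
replaces `w` by `w'` with `‖w'‖² = ‖w‖² + (1 - r²) s²`, where `s` is the displacement along the
velocity caused by `w` and `|r| ≤ lam` (`norm_step_sq`). So `w` never shrinks, and over a block of
collisions it fails to grow by a definite factor only if it is almost orthogonal to all normals met
there. Uniform expansion (`exists_expansion`) follows once the normals of any `k` consecutive
collisions span the space, with `k` independent of the orbit (`exists_generating`).

Spanning. If the normals of a long block do not span, general position provides a point `x`, perhaps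
outside `P`, on the hyperplanes of all facets hit. The part of `p n - x` orthogonal to the velocity
then obeys the same recursion as `w`, and it is bounded because `P` is. But it must grow. The facets
hit during a window of `l` collisions have no common point in `P`: otherwise they share a vertex,
obtuseness gives a direction `e` at an angle less than `π/4` from all their normals, and each
collision raises `⟪v, e⟫` by a fixed amount (`exists_gain`), which cannot go on. Having no common
point, one of these facets has its hyperplane at a definite distance from the current position, and
this forces a definite displacement `s` in the window. Enough windows contradict boundedness. All
constants are uniform because there are finitely many sets of facets.

Stable bundle. It is a graph over the velocities, and invariance expresses the slope at `x` through
the slope at `Φ x`: the inverse of the transverse evolution, of norm at most 1, on one side, and the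
velocity block, of norm at most `lam`, on the other. This is a contraction of bounded continuous
families of slopes, whose fixed point is the bundle (`exists_slope`). The velocity block is never
inverted, so `f` need not be injective. On `D` the velocities are uniformly transverse to the
facets, so the norms of tangent vectors are comparable with those of `w` and of the velocity
component. -/

/-- The bounds on a contracting law `f` that are used below. -/
structure RateBounds (f : ℝ → ℝ) (lam κ : ℝ) : Prop where
  lam_pos : 0 < lam
  lam_lt_one : lam < 1
  κ_pos : 0 < κ
  abs_deriv_le : ∀ θ ∈ Set.Ico 0 (Real.pi / 2), |derivWithin f (Set.Ico 0 (Real.pi / 2)) θ| ≤ lam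
  sin_le : ∀ θ ∈ Set.Ico 0 (Real.pi / 2), Real.sin (f θ) ≤ lam * Real.sin θ
  le_cos : ∀ θ ∈ Set.Ico 0 (Real.pi / 2), κ ≤ Real.cos (f θ)
  le_self : ∀ θ ∈ Set.Ico 0 (Real.pi / 2), f θ ≤ θ
  mem : ∀ θ ∈ Set.Ico 0 (Real.pi / 2), f θ ∈ Set.Ico 0 (Real.pi / 2)

/-- The mean value inequality gives `f θ ≤ l θ` with `l = sup |f'| < 1`. This keeps `f θ` away from
`π/2`, whence the bound on the cosine, and the margin `(1 - l) θ` survives the passage from angles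
to sines. -/
theorem IsContractingLaw.exists_rateBounds {f : ℝ → ℝ} (hf : IsContractingLaw f) :
    ∃ lam κ : ℝ, RateBounds f lam κ := by
  set I := Set.Ico 0 (Real.pi / 2) with hI
  have hpi := Real.pi_pos
  obtain ⟨l, hl⟩ : ∃ l, l = sSup ((fun θ => |derivWithin f I θ|) '' I) := ⟨_, rfl⟩
  have hl0 : 0 < l := hl ▸ hf.sSup_pos
  have hl1 : l < 1 := hl ▸ hf.sSup_lt_one
  have hd : ∀ θ ∈ I, |derivWithin f I θ| ≤ l := fun θ hθ =>
    hl ▸ le_csSup hf.bddAbove ⟨θ, hθ, rfl⟩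
  have h0 : (0 : ℝ) ∈ I := ⟨le_rfl, by positivity⟩
  have hle : ∀ θ ∈ I, f θ ≤ l * θ := by
    intro θ hθ
    have := (convex_Ico 0 (Real.pi / 2)).norm_image_sub_le_of_norm_derivWithin_le
      (hf.contDiffOn.differentiableOn (by norm_num)) hd h0 hθ
    rw [hf.map_zero, sub_zero, sub_zero, Real.norm_eq_abs, Real.norm_eq_abs,
      abs_of_nonneg hθ.1] at this
    exact (le_abs_self _).trans this
  have hc : 0 < Real.cos ((1 + l) * Real.pi / 4) :=
    Real.cos_pos_of_mem_Ioo ⟨by nlinarith, by nlinarith⟩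
  -- Chosen so that `sin θ - sin (l θ) = 2 sin ((1 - l) θ / 2) cos ((1 + l) θ / 2) ≥ c θ`, by
  -- Jordan's inequality for the sine and monotonicity of the cosine; then `θ ≥ sin θ`.
  obtain ⟨c, hcdef⟩ : ∃ c, c = Real.cos ((1 + l) * Real.pi / 4) * (2 / Real.pi) * (1 - l) :=
    ⟨_, rfl⟩
  have hc0 : 0 < c := by
    rw [hcdef]; have : 0 < 1 - l := by linarith
    positivity
  have hmem : ∀ θ ∈ I, f θ ∈ I := hf.mapsTo
  have hsin : ∀ θ ∈ I, Real.sin (f θ) ≤ (1 - c) * Real.sin θ := by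
    intro θ hθ
    obtain ⟨h1, h2⟩ := hθ
    have hθ : θ ∈ I := ⟨h1, h2⟩
    have hfm := hmem θ hθ
    have h3 : l * θ ≤ θ := by nlinarith
    have h4 : Real.sin (f θ) ≤ Real.sin (l * θ) :=
      Real.sin_le_sin_of_le_of_le_pi_div_two (by linarith [hfm.1]) (by linarith) (hle θ hθ)
    have h5 := Real.sin_sub_sin θ (l * θ)
    have h6 : 2 / Real.pi * ((θ - l * θ) / 2) ≤ Real.sin ((θ - l * θ) / 2) :=
      Real.mul_le_sin (by linarith) (by nlinarith)
    have h7 : Real.cos ((1 + l) * Real.pi / 4) ≤ Real.cos ((θ + l * θ) / 2) :=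
      Real.cos_le_cos_of_nonneg_of_le_pi (by nlinarith) (by nlinarith) (by nlinarith)
    have h8 : Real.sin θ ≤ θ := Real.sin_le h1
    have h9 : c * θ ≤ Real.sin θ - Real.sin (l * θ) := by
      rw [h5, hcdef]
      have h10 : 0 ≤ 2 / Real.pi * ((θ - l * θ) / 2) := by
        have : 0 ≤ θ - l * θ := by linarith
        positivity
      have := mul_le_mul h6 h7 hc.le (h10.trans h6)
      linarith [this]
    nlinarith [mul_le_mul_of_nonneg_left h8 hc0.le]
  refine ⟨max l (1 - c), Real.cos (l * (Real.pi / 2)), ?_, ?_, ?_, ?_, ?_, ?_, ?_, hmem⟩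
  · exact lt_max_of_lt_left hl0
  · exact max_lt hl1 (by linarith)
  · exact Real.cos_pos_of_mem_Ioo ⟨by nlinarith, by nlinarith⟩
  · exact fun θ hθ => (hd θ hθ).trans (le_max_left _ _)
  · intro θ hθ
    refine (hsin θ hθ).trans (mul_le_mul_of_nonneg_right (le_max_right _ _) ?_)
    exact Real.sin_nonneg_of_nonneg_of_le_pi hθ.1 (by linarith [hθ.2])
  · intro θ hθ
    have h1 := hle θ hθ
    have h2 : l * θ ≤ l * (Real.pi / 2) := mul_le_mul_of_nonneg_left hθ.2.le hl0.le
    exact Real.cos_le_cos_of_nonneg_of_le_pi (hmem θ hθ).1 (by nlinarith) (h1.trans h2)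
  · intro θ hθ
    have := hle θ hθ
    nlinarith [hθ.1]

/-- The quotient `sin (f θ) / sin θ`, extended by `f' 0` at `θ = 0`. -/
def ratio (f : ℝ → ℝ) (θ : ℝ) : ℝ :=
  if θ = 0 then derivWithin f (Set.Ico 0 (Real.pi / 2)) 0 else Real.sin (f θ) / Real.sin θ

theorem sin_pos_of_mem {θ : ℝ} (hθ : θ ∈ Set.Ico 0 (Real.pi / 2)) (h : θ ≠ 0) :
    0 < Real.sin θ :=
  Real.sin_pos_of_pos_of_lt_pi (lt_of_le_of_ne hθ.1 h.symm) (by linarith [hθ.2, Real.pi_pos])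

theorem ratio_mul_sin {f : ℝ → ℝ} (hf : IsContractingLaw f) {θ : ℝ}
    (hθ : θ ∈ Set.Ico 0 (Real.pi / 2)) : ratio f θ * Real.sin θ = Real.sin (f θ) := by
  unfold ratio
  split_ifs with h
  · simp [h, hf.map_zero]
  · exact div_mul_cancel₀ _ (sin_pos_of_mem hθ h).ne'

theorem RateBounds.abs_ratio_le {f : ℝ → ℝ} {lam κ : ℝ} (hr : RateBounds f lam κ) {θ : ℝ}
    (hθ : θ ∈ Set.Ico 0 (Real.pi / 2)) : |ratio f θ| ≤ lam := by
  unfold ratio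
  split_ifs with h
  · exact hr.abs_deriv_le 0 (h ▸ hθ)
  · have hs := sin_pos_of_mem hθ h
    have hm := hr.mem θ hθ
    have hs' : 0 ≤ Real.sin (f θ) :=
      Real.sin_nonneg_of_nonneg_of_le_pi hm.1 (by linarith [hm.2, Real.pi_pos])
    rw [abs_of_nonneg (div_nonneg hs' hs.le), div_le_iff₀ hs]
    exact hr.sin_le θ hθ

theorem continuousOn_derivWithin {f : ℝ → ℝ} (hf : IsContractingLaw f) :
    ContinuousOn (derivWithin f (Set.Ico 0 (Real.pi / 2))) (Set.Ico 0 (Real.pi / 2)) :=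
  hf.contDiffOn.continuousOn_derivWithin (uniqueDiffOn_Ico _ _) (by norm_num)

/-- Only `θ = 0` is delicate: there the ratio is a quotient of the slopes of `sin ∘ f` and `sin`,
which tend to `f' 0` and `1`. -/
theorem continuousOn_ratio {f : ℝ → ℝ} (hf : IsContractingLaw f) :
    ContinuousOn (ratio f) (Set.Ico 0 (Real.pi / 2)) := by
  intro θ hθ
  by_cases h : θ = 0
  · subst h
    set I := Set.Ico 0 (Real.pi / 2) with hI
    have hd : HasDerivWithinAt f (derivWithin f I 0) I 0 :=
      (hf.contDiffOn.differentiableOn (by norm_num) 0 hθ).hasDerivWithinAt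
    have hsf : HasDerivWithinAt (fun x => Real.sin (f x)) (derivWithin f I 0) I 0 := by
      simpa [hf.map_zero] using hd.sin
    have hs : HasDerivWithinAt Real.sin 1 I 0 := by
      simpa using (Real.hasDerivAt_sin 0).hasDerivWithinAt (s := I)
    rw [hasDerivWithinAt_iff_tendsto_slope] at hsf hs
    have key := hsf.div hs one_ne_zero
    rw [div_one] at key
    change ContinuousWithinAt (ratio f) I 0
    rw [← continuousWithinAt_sdiff_self, ContinuousWithinAt]
    have h0 : ratio f 0 = derivWithin f I 0 := by simp [ratio, hI]
    rw [h0]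
    refine key.congr' ?_
    filter_upwards [self_mem_nhdsWithin] with x hx
    have hx0 : x ≠ 0 := hx.2
    have := (sin_pos_of_mem hx.1 hx0).ne'
    simp only [Pi.div_apply, slope_def_field, hf.map_zero, Real.sin_zero, sub_zero, ratio, hx0,
      if_false]
    field_simp
  · have hc : ContinuousWithinAt (fun x => Real.sin (f x) / Real.sin x)
        (Set.Ico 0 (Real.pi / 2)) θ :=
      (Real.continuous_sin.continuousAt.comp_continuousWithinAt
        (hf.contDiffOn.continuousOn θ hθ)).div Real.continuous_sin.continuousWithinAt
        (sin_pos_of_mem hθ h).ne'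
    refine hc.congr_of_eventuallyEq ?_ (by simp [ratio, h])
    filter_upwards [nhdsWithin_le_nhds (isOpen_ne.mem_nhds h)] with x hx
    simp only [ratio]
    rw [if_neg hx]

/-! ### A single collision -/

variable {d : ℕ}

/-- The angle between `-v` and `η`. -/
def incidence (η v : Space d) : ℝ := Real.arccos (-⟪v, η⟫_ℝ)

/-- The component of `v` orthogonal to the unit vector `η`. -/
def tang (η v : Space d) : Space d := v - ⟪v, η⟫_ℝ • η

/-- The velocity after a collision with incoming velocity `v` at a facet with normal `η`. -/
def outVel (f : ℝ → ℝ) (η v : Space d) : Space d := contract f η (specular η v)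

/-- An incoming unit vector `v` at a facet with interior unit normal `η`. -/
structure Incoming (η v : Space d) : Prop where
  norm_normal : ‖η‖ = 1
  norm_vel : ‖v‖ = 1
  inner_neg : ⟪v, η⟫_ℝ < 0

namespace Incoming

variable {η v : Space d} (h : Incoming η v)
include h

theorem inner_normal_self : ⟪η, η⟫_ℝ = 1 := by rw [real_inner_self_eq_norm_sq, h.norm_normal]; simp

theorem inner_vel_self : ⟪v, v⟫_ℝ = 1 := by rw [real_inner_self_eq_norm_sq, h.norm_vel]; simp

theorem neg_one_le : -1 ≤ ⟪v, η⟫_ℝ := by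
  have := abs_real_inner_le_norm v η
  rw [h.norm_vel, h.norm_normal] at this
  linarith [neg_le_of_abs_le this]

theorem cos_incidence : Real.cos (incidence η v) = -⟪v, η⟫_ℝ :=
  Real.cos_arccos (by linarith [h.inner_neg]) (by linarith [h.neg_one_le])

theorem incidence_mem : incidence η v ∈ Set.Ico 0 (Real.pi / 2) :=
  ⟨Real.arccos_nonneg _, Real.arccos_lt_pi_div_two.2 (by linarith [h.inner_neg])⟩

theorem inner_tang_normal : ⟪tang η v, η⟫_ℝ = 0 := by
  rw [tang, inner_sub_left, real_inner_smul_left, h.inner_normal_self]; ring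

theorem inner_normal_tang : ⟪η, tang η v⟫_ℝ = 0 := by
  rw [real_inner_comm, h.inner_tang_normal]

theorem sin_nonneg : 0 ≤ Real.sin (incidence η v) :=
  have := h
  Real.sin_nonneg_of_nonneg_of_le_pi (Real.arccos_nonneg _) (Real.arccos_le_pi _)

theorem sin_sq : Real.sin (incidence η v) ^ 2 = 1 - ⟪v, η⟫_ℝ ^ 2 := by
  rw [Real.sin_sq, h.cos_incidence]; ring

theorem norm_tang_sq : ‖tang η v‖ ^ 2 = Real.sin (incidence η v) ^ 2 := by
  rw [h.sin_sq, ← real_inner_self_eq_norm_sq, tang]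
  simp only [inner_sub_left, inner_sub_right, real_inner_smul_left, real_inner_smul_right,
    h.inner_normal_self, h.inner_vel_self, real_inner_comm v η]
  rw [real_inner_comm η v]; ring

theorem norm_tang : ‖tang η v‖ = Real.sin (incidence η v) := by
  have := h.norm_tang_sq
  rwa [sq_eq_sq₀ (norm_nonneg _) h.sin_nonneg] at this

theorem incidence_eq_zero_iff : incidence η v = 0 ↔ tang η v = 0 := by
  rw [← norm_eq_zero (a := tang η v), h.norm_tang]
  constructor
  · intro h0; rw [h0]; simp
  · intro h0
    by_contra hne
    exact (sin_pos_of_mem h.incidence_mem hne).ne' h0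

/-- This form of the law is regular at normal incidence: the undefined quotient of sines becomes
`ratio`, and whatever value it has at angle zero is multiplied by `tang η v = 0`. -/
theorem outVel_eq (f : ℝ → ℝ) : outVel f η v =
    Real.cos (f (incidence η v)) • η + ratio f (incidence η v) • tang η v := by
  have h1 : ⟪specular η v, η⟫_ℝ = -⟪v, η⟫_ℝ := by
    rw [specular, inner_sub_left, real_inner_smul_left, h.inner_normal_self]; ring
  have h2 : specular η v - (-⟪v, η⟫_ℝ) • η = tang η v := by
    rw [specular, tang]; module
  have hc : -⟪v, η⟫_ℝ ≠ 0 := by linarith [h.inner_neg]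
  have h3 := h.cos_incidence
  rw [outVel, contract, h1, h2]
  change (Real.cos (f (incidence η v)) / Real.cos (incidence η v)) • (-⟪v, η⟫_ℝ) • η +
    (Real.sin (f (incidence η v)) / Real.sin (incidence η v)) • tang η v = _
  rw [h3, smul_smul, div_mul_cancel₀ _ hc]
  congr 1
  by_cases h0 : incidence η v = 0
  · rw [h.incidence_eq_zero_iff.1 h0]; simp
  · rw [ratio, if_neg h0]

theorem inner_outVel_normal (f : ℝ → ℝ) :
    ⟪outVel f η v, η⟫_ℝ = Real.cos (f (incidence η v)) := by
  rw [h.outVel_eq, inner_add_left, real_inner_smul_left, real_inner_smul_left,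
    h.inner_normal_self, h.inner_tang_normal]; ring

theorem norm_outVel {f : ℝ → ℝ} (hf : IsContractingLaw f) : ‖outVel f η v‖ = 1 := by
  have : ‖outVel f η v‖ ^ 2 = 1 := by
    rw [h.outVel_eq, ← real_inner_self_eq_norm_sq]
    simp only [inner_add_left, inner_add_right, real_inner_smul_left, real_inner_smul_right,
      h.inner_normal_self, h.inner_tang_normal, h.inner_normal_tang]
    rw [real_inner_self_eq_norm_sq, h.norm_tang_sq]
    have := ratio_mul_sin hf h.incidence_mem
    have h2 := Real.sin_sq_add_cos_sq (f (incidence η v))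
    rw [← this] at h2
    linear_combination h2
  nlinarith [norm_nonneg (outVel f η v)]

end Incoming

/-- The orthogonal projection onto the complement of the unit vector `v`. -/
def perp (v : Space d) : Space d →L[ℝ] Space d :=
  ContinuousLinearMap.id ℝ (Space d) - (innerSL ℝ v).smulRight v

@[simp] theorem perp_apply (v x : Space d) : perp v x = x - ⟪v, x⟫_ℝ • v := by simp [perp]

/-- The projection onto the complement of `η` along `v`. -/
def oblique (η v : Space d) : Space d →L[ℝ] Space d :=
  ContinuousLinearMap.id ℝ (Space d) - (⟪v, η⟫_ℝ)⁻¹ • (innerSL ℝ η).smulRight v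

theorem oblique_apply (η v x : Space d) :
    oblique η v x = x - (⟪x, η⟫_ℝ / ⟪v, η⟫_ℝ) • v := by
  simp [oblique, smul_smul, real_inner_comm, div_eq_inv_mul]

theorem norm_perp_sq {v : Space d} (hv : ‖v‖ = 1) (x : Space d) :
    ‖perp v x‖ ^ 2 = ‖x‖ ^ 2 - ⟪v, x⟫_ℝ ^ 2 := by
  rw [perp_apply, norm_sub_sq_real, norm_smul, hv, real_inner_smul_right, real_inner_comm,
    Real.norm_eq_abs, mul_one, sq_abs]; ring

theorem norm_perp_le {v : Space d} (hv : ‖v‖ = 1) (x : Space d) : ‖perp v x‖ ≤ ‖x‖ := by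
  have := norm_perp_sq hv x
  exact abs_le_of_sq_le_sq' (by nlinarith) (norm_nonneg _) |>.2

theorem inner_perp {v : Space d} (hv : ‖v‖ = 1) (x : Space d) : ⟪v, perp v x⟫_ℝ = 0 := by
  rw [perp_apply, inner_sub_right, real_inner_smul_right, real_inner_self_eq_norm_sq, hv]; ring

theorem perp_of_inner_eq_zero {v x : Space d} (hx : ⟪v, x⟫_ℝ = 0) : perp v x = x := by
  rw [perp_apply, hx]; simp

theorem oblique_self {η v : Space d} (h : ⟪v, η⟫_ℝ ≠ 0) : oblique η v v = 0 := by
  rw [oblique_apply, div_self h]; simp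

theorem oblique_of_inner_eq_zero {η v x : Space d} (h : ⟪x, η⟫_ℝ = 0) : oblique η v x = x := by
  rw [oblique_apply, h]; simp

theorem inner_oblique {η v : Space d} (h : ⟪v, η⟫_ℝ ≠ 0) (x : Space d) :
    ⟪oblique η v x, η⟫_ℝ = 0 := by
  rw [oblique_apply, inner_sub_left, real_inner_smul_left, div_mul_cancel₀ _ h, sub_self]

/-! ### Transverse vectors and velocities under one collision -/

namespace Incoming

variable {η v : Space d} (h : Incoming η v)
include h

/-- The transverse position vector `w ⟂ v` becomes `perp v' (oblique η v w)` after a collision. -/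
theorem norm_step_sq {f : ℝ → ℝ} {w : Space d} (hf : IsContractingLaw f) (hw : ⟪v, w⟫_ℝ = 0) :
    ‖perp (outVel f η v) (oblique η v w)‖ ^ 2 =
      ‖w‖ ^ 2 + (1 - ratio f (incidence η v) ^ 2) * (⟪w, η⟫_ℝ / ⟪v, η⟫_ℝ) ^ 2 ∧
    ‖perp (outVel f η v) (oblique η v w) - w‖ ≤
      (1 + |ratio f (incidence η v)|) * |⟪w, η⟫_ℝ / ⟪v, η⟫_ℝ| := by
  set s := ⟪w, η⟫_ℝ / ⟪v, η⟫_ℝ with hs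
  set r := ratio f (incidence η v) with hr
  have hu : oblique η v w = w - s • v := oblique_apply _ _ _
  have huη : ⟪oblique η v w, η⟫_ℝ = 0 := inner_oblique h.inner_neg.ne _
  have huv : ⟪oblique η v w, v⟫_ℝ = -s := by
    rw [hu, inner_sub_left, real_inner_smul_left, h.inner_vel_self, real_inner_comm, hw]; ring
  -- The projected vector is orthogonal to `η`, so it sees only the tangential part of the outgoing
  -- velocity, which is `r` times that of `v`.
  have huv' : ⟪outVel f η v, oblique η v w⟫_ℝ = -(r * s) := by
    rw [real_inner_comm, h.outVel_eq, tang, inner_add_right, real_inner_smul_right,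
      real_inner_smul_right, inner_sub_right, real_inner_smul_right, huη, huv]; ring
  have hun : ‖oblique η v w‖ ^ 2 = ‖w‖ ^ 2 + s ^ 2 := by
    rw [hu, norm_sub_sq_real, norm_smul, h.norm_vel, real_inner_smul_right, real_inner_comm, hw,
      Real.norm_eq_abs, mul_one, sq_abs]; ring
  have hv' := h.norm_outVel hf
  constructor
  · rw [norm_perp_sq hv', hun, huv']; ring
  · rw [perp_apply, huv', hu]
    have : w - s • v - -(r * s) • outVel f η v - w = (r * s) • outVel f η v - s • v := by module
    rw [this]
    refine (norm_sub_le _ _).trans ?_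
    rw [norm_smul, norm_smul, hv', h.norm_vel, Real.norm_eq_abs, Real.norm_eq_abs, abs_mul]
    linarith

/-- The velocity gains a definite amount in a direction that makes an angle less than `π / 4` with
the normal. -/
theorem inner_outVel_ge {f : ℝ → ℝ} {lam κ a : ℝ} (hf : IsContractingLaw f)
    (hr : RateBounds f lam κ) {e : Space d} (he : ‖e‖ = 1) (hea : ⟪e, η⟫_ℝ = a)
    (ha : √2 / 2 < a) :
    ⟪v, e⟫_ℝ + κ * (a - √(1 - a ^ 2)) ≤ ⟪outVel f η v, e⟫_ℝ := by
  set θ := incidence η v with hθ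
  have hmem := h.incidence_mem
  have hfm := hr.mem θ hmem
  have hκ := hr.le_cos θ hmem
  have hsr := ratio_mul_sin hf hmem
  have hcos := h.cos_incidence
  have hS := h.sin_nonneg
  have hsl := hr.sin_le θ hmem
  rw [← hθ] at hcos hS hsr
  have ha1 : a ≤ 1 := by
    have := real_inner_le_norm e η
    rw [he, h.norm_normal, hea] at this; linarith
  have h2 : (√2) ^ 2 = 2 := Real.sq_sqrt (by norm_num)
  have hs2 : 0 ≤ √2 := Real.sqrt_nonneg 2
  have ha0 : 0 < a := by linarith
  have hb : √(1 - a ^ 2) ≤ a := by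
    rw [Real.sqrt_le_left ha0.le]; nlinarith
  have hb2 : √(1 - a ^ 2) ^ 2 = 1 - a ^ 2 := Real.sq_sqrt (by nlinarith)
  have hb0 := Real.sqrt_nonneg (1 - a ^ 2)
  set b := √(1 - a ^ 2)
  -- The tangential velocity sees only the part of `e` orthogonal to `η`, of length `b = √(1 - a²)`;
  -- the assumption on `a` amounts to `b < a`.
  have hin : |⟪tang η v, e⟫_ℝ| ≤ Real.sin θ * b := by
    have h1 : ⟪tang η v, e⟫_ℝ = ⟪tang η v, e - a • η⟫_ℝ := by
      rw [inner_sub_right, real_inner_smul_right, h.inner_tang_normal]; ring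
    have h3 : ‖e - a • η‖ = b := by
      have : ‖e - a • η‖ ^ 2 = b ^ 2 := by
        rw [norm_sub_sq_real, norm_smul, he, h.norm_normal, real_inner_smul_right, hea,
          Real.norm_eq_abs, mul_one, sq_abs, hb2]; ring
      rwa [sq_eq_sq₀ (norm_nonneg _) hb0] at this
    rw [h1]
    refine (abs_real_inner_le_norm _ _).trans ?_
    rw [h3, h.norm_tang]
  have hve : ⟪v, e⟫_ℝ = ⟪tang η v, e⟫_ℝ + ⟪v, η⟫_ℝ * a := by
    rw [tang, inner_sub_left, real_inner_smul_left, real_inner_comm e η, ← hea,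
      real_inner_comm η e]; ring
  have hoe : ⟪outVel f η v, e⟫_ℝ = Real.cos (f θ) * a + ratio f θ * ⟪tang η v, e⟫_ℝ := by
    rw [h.outVel_eq, inner_add_left, real_inner_smul_left, real_inner_smul_left,
      real_inner_comm e η, hea]
  have hr1 : ratio f θ ≤ 1 :=
    (le_abs_self _).trans ((hr.abs_ratio_le hmem).trans hr.lam_lt_one.le)
  have hsf0 : 0 ≤ Real.sin (f θ) :=
    Real.sin_nonneg_of_nonneg_of_le_pi hfm.1 (by linarith [hfm.2, Real.pi_pos])
  have hcf0 : 0 < Real.cos (f θ) := hr.κ_pos.trans_le hκ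
  have hc0 : 0 ≤ Real.cos θ := by rw [hcos]; linarith [h.inner_neg]
  -- Compares gain and loss: the normal part gains `a (cos (f θ) + cos θ)`, while the tangential
  -- part loses at most `b (sin θ - sin (f θ)) ≤ b (1 - sin (f θ)) ≤ b cos (f θ)`.
  have h1f : 1 ≤ Real.cos (f θ) + Real.sin (f θ) := by
    nlinarith [Real.sin_sq_add_cos_sq (f θ)]
  have h1s : Real.sin θ ≤ 1 := Real.sin_le_one θ
  have htan : (1 - ratio f θ) * ⟪tang η v, e⟫_ℝ ≤ (Real.sin θ - Real.sin (f θ)) * b := by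
    calc (1 - ratio f θ) * ⟪tang η v, e⟫_ℝ ≤ (1 - ratio f θ) * (Real.sin θ * b) :=
          mul_le_mul_of_nonneg_left ((le_abs_self _).trans hin) (by linarith)
      _ = (Real.sin θ - Real.sin (f θ)) * b := by rw [← hsr]; ring
  have h5 : (Real.sin θ - Real.sin (f θ)) * b ≤ (Real.cos (f θ) + Real.cos θ) * b :=
    mul_le_mul_of_nonneg_right (by linarith) hb0
  have h6 : κ * (a - b) ≤ (Real.cos (f θ) + Real.cos θ) * (a - b) :=
    mul_le_mul_of_nonneg_right (by linarith) (by linarith)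
  rw [hve, hoe]
  have : ⟪v, η⟫_ℝ = -Real.cos θ := by rw [hcos]; ring
  rw [this]
  nlinarith

end Incoming

/-! ### Facets of polytopes -/

/-- The minimum of `⟪η, ·⟫` on `P`. -/
def offset (P : Set (Space d)) (η : Space d) : ℝ := sInf ((fun x => ⟪η, x⟫_ℝ) '' P)

theorem exists_ball_of_mem_intrinsicInterior {s : Set (Space d)} {x : Space d}
    (hx : x ∈ intrinsicInterior ℝ s) :
    ∃ ε > 0, ∀ u ∈ vectorSpan ℝ s, ‖u‖ < ε → x + u ∈ s := by
  obtain ⟨y, hy, rfl⟩ := mem_intrinsicInterior.1 hx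
  rw [mem_interior_iff_mem_nhds, Metric.mem_nhds_iff] at hy
  obtain ⟨ε, hε, hb⟩ := hy
  refine ⟨ε, hε, fun u hu hlt => ?_⟩
  have hmem : u +ᵥ (y : Space d) ∈ affineSpan ℝ s :=
    AffineSubspace.vadd_mem_of_mem_direction (by rwa [direction_affineSpan]) y.2
  have hin : (⟨u +ᵥ (y : Space d), hmem⟩ : affineSpan ℝ s) ∈ Metric.ball y ε := by
    rw [Metric.mem_ball, Subtype.dist_eq, dist_eq_norm]
    simpa using hlt
  have := hb hin
  simpa [add_comm] using this

theorem mem_intrinsicInterior_of_ball {s : Set (Space d)} {x : Space d} (hx : x ∈ s)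
    (h : ∀ᶠ y in nhds x, y ∈ affineSpan ℝ s → y ∈ s) : x ∈ intrinsicInterior ℝ s := by
  rw [mem_intrinsicInterior]
  refine ⟨⟨x, subset_affineSpan ℝ s hx⟩, ?_, rfl⟩
  rw [mem_interior_iff_mem_nhds]
  have ht : Filter.Tendsto ((↑) : affineSpan ℝ s → Space d)
      (nhds ⟨x, subset_affineSpan ℝ s hx⟩) (nhds x) := continuous_subtype_val.tendsto _
  filter_upwards [ht.eventually h] with y hy using hy y.2

theorem finrank_orthogonal_singleton {η : Space d} (hη : η ≠ 0) :
    Module.finrank ℝ (ℝ ∙ η)ᗮ + 1 = d := by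
  have := Submodule.finrank_add_finrank_orthogonal (ℝ ∙ η)
  rw [finrank_span_singleton hη, finrank_euclideanSpace_fin] at this
  omega

theorem IsFacetNormal.ne_zero {P : Set (Space d)} {η : Space d} (h : IsFacetNormal P η) : η ≠ 0 :=
  fun h0 => by simpa [h0] using h.1

theorem vectorSpan_face_le {P : Set (Space d)} {η : Space d} :
    vectorSpan ℝ (face P η) ≤ (ℝ ∙ η)ᗮ := by
  rw [vectorSpan_def, Submodule.span_le]
  rintro _ ⟨x, hx, y, hy, rfl⟩
  rw [SetLike.mem_coe, Submodule.mem_orthogonal_singleton_iff_inner_right]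
  change ⟪η, x - y⟫_ℝ = 0
  rw [inner_sub_right]
  linarith [hx.2 y hy.1, hy.2 x hx.1]

theorem IsFacetNormal.vectorSpan_eq {P : Set (Space d)} {η : Space d} (h : IsFacetNormal P η) :
    vectorSpan ℝ (face P η) = (ℝ ∙ η)ᗮ := by
  refine Submodule.eq_of_le_of_finrank_eq vectorSpan_face_le ?_
  have h1 := h.2
  have h2 := finrank_orthogonal_singleton h.ne_zero
  omega

theorem IsFacetNormal.face_nonempty {P : Set (Space d)} {η : Space d} (h : IsFacetNormal P η)
    (hd : 2 ≤ d) : (face P η).Nonempty := by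
  by_contra hne
  rw [Set.not_nonempty_iff_eq_empty] at hne
  have := h.2
  rw [hne, vectorSpan_empty, finrank_bot] at this
  omega

theorem inner_lt_of_mem_interior {P : Set (Space d)} {z ζ x : Space d} (hz : z ∈ interior P) (hζ : ζ ≠ 0)
    (hx : ∀ y ∈ P, ⟪ζ, x⟫_ℝ ≤ ⟪ζ, y⟫_ℝ) : ⟪ζ, x⟫_ℝ < ⟪ζ, z⟫_ℝ := by
  rw [mem_interior_iff_mem_nhds] at hz
  have ht : Filter.Tendsto (fun t : ℝ => z - t • ζ) (nhdsWithin 0 (Set.Ioi 0)) (nhds z) := by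
    have : Continuous fun t : ℝ => z - t • ζ := by fun_prop
    simpa using (this.tendsto 0).mono_left nhdsWithin_le_nhds
  obtain ⟨t, ht1, ht0⟩ := ((ht.eventually hz).and self_mem_nhdsWithin).exists
  have h1 := hx _ ht1
  rw [inner_sub_right, real_inner_smul_right, real_inner_self_eq_norm_sq] at h1
  have h2 : 0 < t * ‖ζ‖ ^ 2 := mul_pos ht0 (by positivity)
  linarith

theorem mem_interior_of_forall_lt {P : Set (Space d)} {H : Finset (Space d × ℝ)}
    (hH : P = {x | ∀ h ∈ H, ⟪h.1, x⟫_ℝ ≤ h.2}) {x : Space d}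
    (hx : ∀ h ∈ H, ⟪h.1, x⟫_ℝ < h.2) : x ∈ interior P := by
  rw [mem_interior_iff_mem_nhds, hH]
  have : ∀ᶠ y in nhds x, ∀ h ∈ H, ⟪h.1, y⟫_ℝ < h.2 := by
    rw [Filter.eventually_all_finset]
    intro h hh
    have hc : Continuous fun y : Space d => ⟪h.1, y⟫_ℝ := by fun_prop
    exact (hc.tendsto x).eventually_lt_const (hx h hh)
  filter_upwards [this] with y hy h hh using (hy h hh).le

namespace IsPolytope

variable {P : Set (Space d)} (hP : IsPolytope P)
include hP

theorem convex : Convex ℝ P := by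
  obtain ⟨H, -, rfl⟩ := hP.isPolyhedron
  have : {x : Space d | ∀ h ∈ H, ⟪h.1, x⟫_ℝ ≤ h.2} =
      ⋂ h ∈ H, {x : Space d | ⟪h.1, x⟫_ℝ ≤ h.2} := by ext; simp
  rw [this]
  exact convex_iInter₂ fun h _ => convex_halfSpace_le (innerSL ℝ h.1).toLinearMap.isLinear _

theorem interior_nonempty : (interior P).Nonempty :=
  hP.convex.interior_nonempty_iff_affineSpan_eq_top.2 hP.affineSpan_eq_top

theorem nonempty : P.Nonempty := hP.interior_nonempty.mono interior_subset

theorem offset_le {η x : Space d} (hx : x ∈ P) : offset P η ≤ ⟪η, x⟫_ℝ :=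
  csInf_le (hP.isCompact.bddBelow_image (by fun_prop)) ⟨x, hx, rfl⟩

theorem mem_face_iff {η x : Space d} : x ∈ face P η ↔ x ∈ P ∧ ⟪η, x⟫_ℝ = offset P η := by
  constructor
  · rintro ⟨hx, h⟩
    refine ⟨hx, le_antisymm (le_csInf (hP.nonempty.image _) ?_) (hP.offset_le hx)⟩
    rintro _ ⟨y, hy, rfl⟩
    exact h y hy
  · rintro ⟨hx, h⟩
    exact ⟨hx, fun y hy => h ▸ hP.offset_le hy⟩

theorem isClosed_face (η : Space d) : IsClosed (face P η) := by
  have : face P η = P ∩ {x | ⟪η, x⟫_ℝ = offset P η} := by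
    ext x; exact hP.mem_face_iff
  rw [this]
  exact hP.isCompact.isClosed.inter (isClosed_eq (by fun_prop) continuous_const)

theorem convex_face (η : Space d) : Convex ℝ (face P η) := by
  have : face P η = P ∩ {x | ⟪η, x⟫_ℝ = offset P η} := by
    ext x; exact hP.mem_face_iff
  rw [this]
  exact hP.convex.inter (convex_hyperplane (innerSL ℝ η).toLinearMap.isLinear _)

/-- At a relatively interior point of a facet only the normal of that facet exposes `P`. -/
theorem eq_normal {η ζ x : Space d} (hη : IsFacetNormal P η)
    (hx : x ∈ intrinsicInterior ℝ (face P η)) (hζ : ‖ζ‖ = 1)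
    (hmin : ∀ y ∈ P, ⟪ζ, x⟫_ℝ ≤ ⟪ζ, y⟫_ℝ) : ζ = η := by
  obtain ⟨ε, hε, hb⟩ := exists_ball_of_mem_intrinsicInterior hx
  have hxf : x ∈ face P η := intrinsicInterior_subset hx
  have hle : ∀ u ∈ vectorSpan ℝ (face P η), 0 ≤ ⟪ζ, u⟫_ℝ := by
    intro u hu
    have hpos : 0 < ε / (2 * (‖u‖ + 1)) := by positivity
    have h1 := hb ((ε / (2 * (‖u‖ + 1))) • u) (Submodule.smul_mem _ _ hu) (by
      rw [norm_smul, Real.norm_eq_abs, abs_of_pos hpos, div_mul_eq_mul_div,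
        div_lt_iff₀ (by positivity)]
      nlinarith [norm_nonneg u])
    have h2 := hmin _ h1.1
    rw [inner_add_right, real_inner_smul_right] at h2
    nlinarith
  have hmem : ζ ∈ (vectorSpan ℝ (face P η))ᗮ := by
    rw [Submodule.mem_orthogonal']
    intro u hu
    have h1 := hle u hu
    have h2 := hle (-u) (Submodule.neg_mem _ hu)
    rw [inner_neg_right] at h2
    linarith
  rw [hη.vectorSpan_eq, Submodule.orthogonal_orthogonal, Submodule.mem_span_singleton] at hmem
  obtain ⟨c, rfl⟩ := hmem
  -- Being minimal at `x`, `ζ` vanishes on the directions of the facet, so it is a multiple of `η`;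
  -- an interior point decides the sign.
  obtain ⟨z, hz⟩ := hP.interior_nonempty
  have h1 := inner_lt_of_mem_interior hz hη.ne_zero hxf.2
  have h2 := hmin z (interior_subset hz)
  rw [real_inner_smul_left, real_inner_smul_left] at h2
  rw [norm_smul, hη.1, mul_one, Real.norm_eq_abs] at hζ
  rcases abs_eq (zero_le_one' ℝ) |>.1 hζ with h | h
  · rw [h, one_smul]
  · rw [h] at h2; linarith

/-- A relatively interior point of a facet makes some defining inequality an equality. By uniqueness
of the exposing normal, `η` is the normalised inward normal of that inequality, and there are
finitely many. -/
theorem finite_facetNormals (hd : 2 ≤ d) : {η | IsFacetNormal P η}.Finite := by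
  obtain ⟨H, hH0, hH⟩ := hP.isPolyhedron
  refine (H.finite_toSet.image fun h => -(‖h.1‖⁻¹ • h.1)).subset ?_
  intro η hη
  obtain ⟨x, hx⟩ := Set.Nonempty.intrinsicInterior (hP.convex_face η) (hη.face_nonempty hd)
  have hxf : x ∈ face P η := intrinsicInterior_subset hx
  by_cases hact : ∀ h ∈ H, ⟪h.1, x⟫_ℝ < h.2
  · have := inner_lt_of_mem_interior (mem_interior_of_forall_lt hH hact) hη.ne_zero hxf.2
    exact absurd this (lt_irrefl _)
  · push Not at hact
    obtain ⟨h, hh, hle⟩ := hact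
    refine ⟨h, hh, ?_⟩
    have hn : 0 < ‖h.1‖ := norm_pos_iff.2 (hH0 h hh)
    refine hP.eq_normal hη hx ?_ ?_
    · rw [norm_neg, norm_smul, norm_inv, norm_norm, inv_mul_cancel₀ hn.ne']
    · intro y hy
      rw [hH] at hy
      simp only [inner_neg_left, real_inner_smul_left, neg_le_neg_iff]
      exact mul_le_mul_of_nonneg_left ((hy h hh).trans hle) (by positivity)

/-- A polytope is the intersection of the half-spaces given by its facets. -/
theorem mem_iff {x : Space d} :
    x ∈ P ↔ ∀ η, IsFacetNormal P η → offset P η ≤ ⟪η, x⟫_ℝ := by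
  refine ⟨fun hx η _ => hP.offset_le hx, fun hx => ?_⟩
  obtain ⟨H', hH'0, hH'⟩ := hP.isPolyhedron
  -- In a minimal family no half-space is redundant. Each then cuts out a facet, so its inequality
  -- is among those assumed for `x`.
  obtain ⟨H, hmin⟩ := exists_minimal_of_wellFoundedLT
    (fun H : Finset (Space d × ℝ) => (∀ h ∈ H, h.1 ≠ 0) ∧ P = {x | ∀ h ∈ H, ⟪h.1, x⟫_ℝ ≤ h.2})
    ⟨H', hH'0, hH'⟩
  obtain ⟨hH0, hH⟩ := hmin.prop
  rw [hH]
  intro h hh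
  classical
  -- a point violating only the constraint `h`
  obtain ⟨y, hy, hyh⟩ : ∃ y : Space d, (∀ k ∈ H.erase h, ⟪k.1, y⟫_ℝ ≤ k.2) ∧ h.2 < ⟪h.1, y⟫_ℝ := by
    by_contra hcon
    push Not at hcon
    have := hmin.le_of_le (y := H.erase h) ⟨fun k hk => hH0 k (Finset.mem_of_mem_erase hk), by
      rw [hH]; ext y
      refine ⟨fun hy k hk => hy k (Finset.mem_of_mem_erase hk), fun hy k hk => ?_⟩
      by_cases hkh : k = h
      · exact hkh ▸ hcon y hy
      · exact hy k (Finset.mem_erase.2 ⟨hkh, hk⟩)⟩ (Finset.erase_subset _ _)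
    exact Finset.notMem_erase h H (this hh)
  obtain ⟨z, hz⟩ := hP.interior_nonempty
  have hzlt : ∀ k ∈ H, ⟪k.1, z⟫_ℝ < k.2 := by
    intro k hk
    by_contra hge
    push Not at hge
    have := inner_lt_of_mem_interior hz (neg_ne_zero.2 (hH0 k hk)) (x := z) (by
      intro w hw
      rw [hH] at hw
      rw [inner_neg_left, inner_neg_left, neg_le_neg_iff]
      exact (hw k hk).trans hge)
    exact lt_irrefl _ this
  have hz1 := hzlt h hh
  -- The parameter at which the segment from the interior point `z` to `y` crosses the hyperplane of
  -- `h`. All other constraints are strict there, so a neighbourhood of the crossing point in that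
  -- hyperplane lies in `P`.
  set t := (h.2 - ⟪h.1, z⟫_ℝ) / (⟪h.1, y⟫_ℝ - ⟪h.1, z⟫_ℝ) with ht
  have hden : 0 < ⟪h.1, y⟫_ℝ - ⟪h.1, z⟫_ℝ := by linarith
  have ht1 : t < 1 := by rw [ht, div_lt_one hden]; linarith
  have ht0 : 0 < t := div_pos (by linarith) hden
  set y₀ := z + t • (y - z) with hy0
  have hy0h : ⟪h.1, y₀⟫_ℝ = h.2 := by
    rw [hy0, inner_add_right, real_inner_smul_right, inner_sub_right, ht, div_mul_cancel₀ _ hden.ne']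
    ring
  have hy0k : ∀ k ∈ H.erase h, ⟪k.1, y₀⟫_ℝ < k.2 := by
    intro k hk
    rw [hy0, inner_add_right, real_inner_smul_right, inner_sub_right]
    nlinarith [hy k hk, hzlt k (Finset.mem_of_mem_erase hk)]
  have hy0P : y₀ ∈ P := by
    rw [hH]; intro k hk
    by_cases hkh : k = h
    · exact hkh ▸ hy0h.le
    · exact (hy0k k (Finset.mem_erase.2 ⟨hkh, hk⟩)).le
  have hn : 0 < ‖h.1‖ := norm_pos_iff.2 (hH0 h hh)
  set η := -(‖h.1‖⁻¹ • h.1) with hη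
  have hin : ∀ w : Space d, ⟪η, w⟫_ℝ = -(‖h.1‖⁻¹ * ⟪h.1, w⟫_ℝ) := by
    intro w; rw [hη, inner_neg_left, real_inner_smul_left]
  have hface : ∀ w, w ∈ P → ⟪h.1, w⟫_ℝ = h.2 → w ∈ face P η := by
    intro w hw hwh
    refine ⟨hw, fun q hq => ?_⟩
    rw [hin, hin, neg_le_neg_iff, hwh]
    rw [hH] at hq
    exact mul_le_mul_of_nonneg_left (hq h hh) (by positivity)
  have hηn : ‖η‖ = 1 := by
    rw [hη, norm_neg, norm_smul, norm_inv, norm_norm, inv_mul_cancel₀ hn.ne']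
  have hη0 : η ≠ 0 := fun h0 => by simp [h0] at hηn
  have hspan : vectorSpan ℝ (face P η) = (ℝ ∙ η)ᗮ := by
    refine le_antisymm vectorSpan_face_le ?_
    intro u hu
    rw [Submodule.mem_orthogonal_singleton_iff_inner_right, hin] at hu
    have hu' : ⟪h.1, u⟫_ℝ = 0 := by
      have : ‖h.1‖⁻¹ ≠ 0 := inv_ne_zero hn.ne'
      simpa [this, neg_eq_zero] using hu
    have hc : Filter.Tendsto (fun s : ℝ => y₀ + s • u) (nhdsWithin 0 (Set.Ioi 0)) (nhds y₀) := by
      have : Continuous fun s : ℝ => y₀ + s • u := by fun_prop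
      simpa using (this.tendsto 0).mono_left nhdsWithin_le_nhds
    have hev : ∀ᶠ w in nhds y₀, ∀ k ∈ H.erase h, ⟪k.1, w⟫_ℝ < k.2 := by
      rw [Filter.eventually_all_finset]
      intro k hk
      have hc : Continuous fun w : Space d => ⟪k.1, w⟫_ℝ := by fun_prop
      exact (hc.tendsto y₀).eventually_lt_const (hy0k k hk)
    obtain ⟨s, hs, hs0⟩ := ((hc.eventually hev).and self_mem_nhdsWithin).exists
    have hsh : ⟪h.1, y₀ + s • u⟫_ℝ = h.2 := by
      rw [inner_add_right, real_inner_smul_right, hu', hy0h]; ring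
    have hsP : y₀ + s • u ∈ P := by
      rw [hH]; intro k hk
      by_cases hkh : k = h
      · exact hkh ▸ hsh.le
      · exact (hs k (Finset.mem_erase.2 ⟨hkh, hk⟩)).le
    have hv := vsub_mem_vectorSpan ℝ (hface _ hsP hsh) (hface _ hy0P hy0h)
    rw [vsub_eq_sub, add_sub_cancel_left] at hv
    have := Submodule.smul_mem _ s⁻¹ hv
    rwa [smul_smul, inv_mul_cancel₀ (ne_of_gt hs0), one_smul] at this
  have hfac : IsFacetNormal P η := ⟨hηn, by rw [hspan]; exact finrank_orthogonal_singleton hη0⟩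
  have h1 := hx η hfac
  rw [← (hP.mem_face_iff.1 (hface _ hy0P hy0h)).2, hin, hin, neg_le_neg_iff, hy0h] at h1
  exact le_of_mul_le_mul_left h1 (by positivity)

/-- Turns relative interiors into one equation and finitely many strict inequalities, so that
membership persists under small perturbations within the hyperplane. -/
theorem mem_intrinsicInterior_face_iff (hd : 2 ≤ d) {η x : Space d} (hη : IsFacetNormal P η) :
    x ∈ intrinsicInterior ℝ (face P η) ↔ ⟪η, x⟫_ℝ = offset P η ∧
      ∀ ζ, IsFacetNormal P ζ → ζ ≠ η → offset P ζ < ⟪ζ, x⟫_ℝ := by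
  constructor
  · intro hx
    have hxf := hP.mem_face_iff.1 (intrinsicInterior_subset hx)
    refine ⟨hxf.2, fun ζ hζ hne => lt_of_le_of_ne (hP.offset_le hxf.1) fun heq => hne ?_⟩
    exact hP.eq_normal hη hx hζ.1 fun y hy => heq ▸ hP.offset_le hy
  · rintro ⟨hx, hlt⟩
    have hxP : x ∈ P := hP.mem_iff.2 fun ζ hζ => by
      by_cases h : ζ = η
      · rw [h, hx]
      · exact (hlt ζ hζ h).le
    refine mem_intrinsicInterior_of_ball (hP.mem_face_iff.2 ⟨hxP, hx⟩) ?_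
    have hfin : ({ζ | IsFacetNormal P ζ} \ {η}).Finite := (hP.finite_facetNormals hd).sdiff
    have hev : ∀ᶠ y in nhds x, ∀ ζ ∈ {ζ | IsFacetNormal P ζ} \ {η}, offset P ζ < ⟪ζ, y⟫_ℝ := by
      rw [Filter.eventually_all_finite hfin]
      intro ζ hζ
      have hc : Continuous fun y : Space d => ⟪ζ, y⟫_ℝ := by fun_prop
      exact (hc.tendsto x).eventually_const_lt (hlt ζ hζ.1 hζ.2)
    filter_upwards [hev] with y hy hmem
    have hxf : x ∈ face P η := hP.mem_face_iff.2 ⟨hxP, hx⟩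
    have hdir := AffineSubspace.vsub_mem_direction hmem (subset_affineSpan ℝ _ hxf)
    rw [direction_affineSpan, hη.vectorSpan_eq, Submodule.mem_orthogonal_singleton_iff_inner_right,
      vsub_eq_sub, inner_sub_right] at hdir
    have hyη : ⟪η, y⟫_ℝ = offset P η := by linarith
    refine hP.mem_face_iff.2 ⟨hP.mem_iff.2 fun ζ hζ => ?_, hyη⟩
    by_cases h : ζ = η
    · rw [h, hyη]
    · exact (hy ζ ⟨hζ, h⟩).le

theorem mem_skeleton_iff {x : Space d} : x ∈ skeleton P ↔
    ∃ η, IsFacetNormal P η ∧ x ∈ face P η ∧ x ∉ intrinsicInterior ℝ (face P η) := by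
  have key : ∀ η, x ∈ intrinsicFrontier ℝ (face P η) ↔
      x ∈ face P η ∧ x ∉ intrinsicInterior ℝ (face P η) := by
    intro η
    have h1 := (hP.isClosed_face η).preimage
      (continuous_subtype_val : Continuous ((↑) : affineSpan ℝ (face P η) → Space d))
    rw [← Set.mem_sdiff, ← intrinsicClosure_sdiff_intrinsicInterior, h1.intrinsicClosure]
  simp only [skeleton, Set.mem_ofPred_eq, key]

theorem normalAt_eq {η x : Space d} (hη : IsFacetNormal P η)
    (hx : x ∈ intrinsicInterior ℝ (face P η)) : normalAt P x = η := by
  have hex : ∃ η, IsFacetNormal P η ∧ x ∈ intrinsicInterior ℝ (face P η) := ⟨η, hη, hx⟩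
  rw [normalAt, dif_pos hex]
  have hs := hex.choose_spec
  exact hP.eq_normal hη hx hs.1.1 (intrinsicInterior_subset hs.2).2

/-- The normals of the facets of a polytope span the whole space. -/
theorem span_facetNormals : Submodule.span ℝ {η | IsFacetNormal P η} = ⊤ := by
  rw [← Submodule.orthogonal_eq_bot_iff, Submodule.eq_bot_iff]
  intro u hu
  by_contra hne
  obtain ⟨x, hx⟩ := hP.nonempty
  obtain ⟨R, hR⟩ := hP.isCompact.isBounded.subset_closedBall x
  have hmem : ∀ t : ℝ, x + t • u ∈ P := by
    intro t
    refine hP.mem_iff.2 fun η hη => ?_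
    have := (Submodule.mem_orthogonal _ _).1 hu η (Submodule.subset_span hη)
    rw [inner_add_right, real_inner_smul_right, this]
    linarith [hP.offset_le hx (η := η)]
  have hu0 : 0 < ‖u‖ := norm_pos_iff.2 hne
  have hR0 : 0 ≤ R := by simpa using hR hx
  have h1 := hR (hmem ((R + 1) / ‖u‖))
  rw [Metric.mem_closedBall, dist_eq_norm, add_sub_cancel_left, norm_smul, Real.norm_eq_abs,
    abs_of_pos (by positivity), div_mul_cancel₀ _ hu0.ne'] at h1
  linarith

end IsPolytope

/-! ### The derivative of the velocity after a collision -/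

/-- The unit vector orthogonal to `v` in the plane of incidence (`0` at normal incidence). -/
def inPlane (η v : Space d) : Space d :=
  (Real.sin (incidence η v))⁻¹ • (η - ⟪v, η⟫_ℝ • v)

/-- The unit vector orthogonal to the outgoing velocity in the plane of incidence. -/
def outPlane (f : ℝ → ℝ) (η v : Space d) : Space d :=
  -Real.sin (f (incidence η v)) • η +
    (Real.cos (f (incidence η v)) / Real.sin (incidence η v)) • tang η v

/-- The derivative of the law at the angle of incidence. -/
def slopeAt (f : ℝ → ℝ) (η v : Space d) : ℝ :=
  derivWithin f (Set.Ico 0 (Real.pi / 2)) (incidence η v)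

/-- The derivative of `outVel f η` along the unit sphere. -/
def velDeriv (f : ℝ → ℝ) (η v : Space d) : Space d →L[ℝ] Space d :=
  ratio f (incidence η v) • perp v + (innerSL ℝ (inPlane η v)).smulRight
    (slopeAt f η v • outPlane f η v - ratio f (incidence η v) • inPlane η v)

theorem velDeriv_apply (f : ℝ → ℝ) (η v ξ : Space d) :
    velDeriv f η v ξ = ratio f (incidence η v) • perp v ξ + ⟪inPlane η v, ξ⟫_ℝ •
      (slopeAt f η v • outPlane f η v - ratio f (incidence η v) • inPlane η v) := by
  simp [velDeriv]

theorem continuous_incidence (η : Space d) : Continuous (incidence η) := by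
  unfold incidence; fun_prop

theorem continuous_tang (η : Space d) : Continuous (tang η) := by
  unfold tang; fun_prop

theorem continuous_perp : Continuous (perp : Space d → Space d →L[ℝ] Space d) := by
  unfold perp
  have : Continuous fun v : Space d => (innerSL ℝ v).smulRight v :=
    ((ContinuousLinearMap.smulRightL ℝ (Space d) (Space d)).continuous₂).comp
      ((innerSL ℝ).continuous.prodMk continuous_id)
  exact continuous_const.sub this

namespace Incoming

variable {η v : Space d} (h : Incoming η v)
include h

theorem sin_pos (h0 : incidence η v ≠ 0) : 0 < Real.sin (incidence η v) :=
  sin_pos_of_mem h.incidence_mem h0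

theorem inner_vel_normal_sub : ⟪v, η - ⟪v, η⟫_ℝ • v⟫_ℝ = 0 := by
  rw [inner_sub_right, real_inner_smul_right, h.inner_vel_self]; ring

theorem inner_vel_inPlane : ⟪v, inPlane η v⟫_ℝ = 0 := by
  rw [inPlane, real_inner_smul_right, h.inner_vel_normal_sub, mul_zero]

theorem norm_normal_sub : ‖η - ⟪v, η⟫_ℝ • v‖ = Real.sin (incidence η v) := by
  have : ‖η - ⟪v, η⟫_ℝ • v‖ ^ 2 = Real.sin (incidence η v) ^ 2 := by
    rw [norm_sub_sq_real, norm_smul, h.norm_vel, h.norm_normal, real_inner_smul_right,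
      real_inner_comm v η, h.sin_sq, Real.norm_eq_abs, mul_one, sq_abs]; ring
  rwa [sq_eq_sq₀ (norm_nonneg _) h.sin_nonneg] at this

theorem norm_inPlane (h0 : incidence η v ≠ 0) : ‖inPlane η v‖ = 1 := by
  have := h.sin_pos h0
  rw [inPlane, norm_smul, h.norm_normal_sub, norm_inv, Real.norm_eq_abs, abs_of_pos this,
    inv_mul_cancel₀ this.ne']

theorem inPlane_of_eq_zero (h0 : incidence η v = 0) : inPlane η v = 0 := by
  have := h
  simp [inPlane, h0]

theorem norm_outPlane (f : ℝ → ℝ) (h0 : incidence η v ≠ 0) : ‖outPlane f η v‖ = 1 := by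
  have hS := h.sin_pos h0
  have : ‖outPlane f η v‖ ^ 2 = 1 := by
    rw [outPlane, ← real_inner_self_eq_norm_sq]
    simp only [inner_add_left, inner_add_right, real_inner_smul_left, real_inner_smul_right,
      h.inner_normal_self, h.inner_tang_normal, h.inner_normal_tang]
    rw [real_inner_self_eq_norm_sq, h.norm_tang_sq]
    field_simp
    linear_combination
      Real.sin (incidence η v) * Real.sin_sq_add_cos_sq (f (incidence η v))
  nlinarith [norm_nonneg (outPlane f η v)]

theorem normal_eq (h0 : incidence η v ≠ 0) :
    η = Real.sin (incidence η v) • inPlane η v + ⟪v, η⟫_ℝ • v := by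
  rw [inPlane, smul_smul, mul_inv_cancel₀ (h.sin_pos h0).ne', one_smul]; module

theorem inner_outPlane (f : ℝ → ℝ) (h0 : incidence η v ≠ 0) {y : Space d} (hv : ⟪v, y⟫_ℝ = 0)
    (he : ⟪inPlane η v, y⟫_ℝ = 0) : ⟪outPlane f η v, y⟫_ℝ = 0 := by
  have h1 : ⟪η, y⟫_ℝ = 0 := by
    rw [h.normal_eq h0, inner_add_left, real_inner_smul_left, real_inner_smul_left, he, hv]; ring
  rw [outPlane, inner_add_left, real_inner_smul_left, real_inner_smul_left, tang, inner_sub_left,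
    real_inner_smul_left, h1, hv]; ring

/-- On `v^⊥` the derivative is diagonal: the direction in the plane of incidence is multiplied by
`f'`, its complement by the ratio of sines. The images stay orthogonal and both factors are at most
`lam` in absolute value. -/
theorem norm_velDeriv_le {f : ℝ → ℝ} {lam κ : ℝ} (hr : RateBounds f lam κ) :
    ‖velDeriv f η v‖ ≤ lam := by
  refine ContinuousLinearMap.opNorm_le_bound _ hr.lam_pos.le fun ξ => ?_
  refine le_trans ?_ (mul_le_mul_of_nonneg_left (norm_perp_le h.norm_vel ξ) hr.lam_pos.le)
  have hrat := hr.abs_ratio_le h.incidence_mem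
  have hsl : |slopeAt f η v| ≤ lam := hr.abs_deriv_le _ h.incidence_mem
  set ζ := perp v ξ with hζ
  set r := ratio f (incidence η v)
  rw [velDeriv_apply]
  by_cases h0 : incidence η v = 0
  · rw [h.inPlane_of_eq_zero h0]
    simp only [inner_zero_left, zero_smul, add_zero, norm_smul, Real.norm_eq_abs]
    exact mul_le_mul_of_nonneg_right hrat (norm_nonneg _)
  · set e := inPlane η v with he
    have hen : ⟪e, e⟫_ℝ = 1 := by rw [real_inner_self_eq_norm_sq, h.norm_inPlane h0]; norm_num
    have hvζ : ⟪v, ζ⟫_ℝ = 0 := inner_perp h.norm_vel ξ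
    have heξ : ⟪e, ξ⟫_ℝ = ⟪e, ζ⟫_ℝ := by
      rw [hζ, perp_apply, inner_sub_right, real_inner_smul_right, real_inner_comm v e,
        h.inner_vel_inPlane]; ring
    set a := ⟪e, ζ⟫_ℝ with ha
    set y := ζ - a • e with hy
    have hey : ⟪e, y⟫_ℝ = 0 := by
      rw [hy, inner_sub_right, real_inner_smul_right, hen, ← ha]; ring
    have hvy : ⟪v, y⟫_ℝ = 0 := by
      rw [hy, inner_sub_right, real_inner_smul_right, hvζ, h.inner_vel_inPlane]; ring
    have hoy := h.inner_outPlane f h0 hvy hey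
    have ho := h.norm_outPlane f h0
    have heq : r • ζ + a • (slopeAt f η v • outPlane f η v - r • e) =
        r • y + (a * slopeAt f η v) • outPlane f η v := by rw [hy]; module
    have hζn : ‖ζ‖ ^ 2 = ‖y‖ ^ 2 + a ^ 2 := by
      have : ζ = y + a • e := by rw [hy]; module
      rw [this, norm_add_sq_real, norm_smul, h.norm_inPlane h0, real_inner_smul_right,
        real_inner_comm, hey, Real.norm_eq_abs, mul_one, sq_abs]; ring
    have hn : ‖r • y + (a * slopeAt f η v) • outPlane f η v‖ ^ 2 =
        r ^ 2 * ‖y‖ ^ 2 + (a * slopeAt f η v) ^ 2 := by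
      rw [norm_add_sq_real, norm_smul, norm_smul, ho, real_inner_smul_right, real_inner_smul_left,
        real_inner_comm, hoy, Real.norm_eq_abs, Real.norm_eq_abs, mul_one, mul_pow, sq_abs, sq_abs]
      ring
    rw [heξ, heq]
    refine abs_le_of_sq_le_sq' ?_ (mul_nonneg hr.lam_pos.le (norm_nonneg _)) |>.2
    rw [hn, mul_pow lam, hζn]
    have h1 : r ^ 2 ≤ lam ^ 2 := sq_le_sq' (by linarith [neg_le_of_abs_le hrat])
      ((le_abs_self _).trans hrat)
    have h2 : slopeAt f η v ^ 2 ≤ lam ^ 2 := sq_le_sq' (by linarith [neg_le_of_abs_le hsl])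
      ((le_abs_self _).trans hsl)
    nlinarith [mul_le_mul_of_nonneg_right h1 (sq_nonneg ‖y‖),
      mul_le_mul_of_nonneg_left h2 (sq_nonneg a)]

/-- Near normal incidence the derivative is almost a homothety. -/
theorem norm_velDeriv_sub_le (f : ℝ → ℝ) :
    ‖velDeriv f η v - ratio f (incidence η v) • perp v‖ ≤
      |slopeAt f η v| * (|Real.sin (f (incidence η v)) + Real.sin (incidence η v)| +
        |Real.cos (f (incidence η v)) - Real.cos (incidence η v)|) +
      |slopeAt f η v - ratio f (incidence η v)| := by
  rw [velDeriv, add_sub_cancel_left]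
  by_cases h0 : incidence η v = 0
  · rw [h.inPlane_of_eq_zero h0]
    simp only [map_zero, smul_zero, sub_zero]
    rw [show (0 : Space d →L[ℝ] ℝ).smulRight (slopeAt f η v • outPlane f η v) = 0 by ext; simp]
    rw [norm_zero]; positivity
  have hS := h.sin_pos h0
  rw [ContinuousLinearMap.norm_smulRight_apply, innerSL_apply_norm, h.norm_inPlane h0, one_mul]
  have h1 : slopeAt f η v • outPlane f η v - ratio f (incidence η v) • inPlane η v =
      slopeAt f η v • (outPlane f η v - inPlane η v) +
        (slopeAt f η v - ratio f (incidence η v)) • inPlane η v := by module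
  -- In the frame `η`, `tang η v` the two in-plane vectors differ by a sum of sines and a difference
  -- of cosines; the factor `1 / sin` is absorbed by the length of `tang η v`.
  have h2 : inPlane η v = Real.sin (incidence η v) • η +
      (Real.cos (incidence η v) / Real.sin (incidence η v)) • tang η v := by
    have h3 : η - ⟪v, η⟫_ℝ • v = (Real.sin (incidence η v) ^ 2) • η - ⟪v, η⟫_ℝ • tang η v := by
      rw [h.sin_sq, tang]; module
    rw [inPlane, h3, smul_sub, smul_smul, smul_smul, h.cos_incidence]
    have : (Real.sin (incidence η v))⁻¹ * Real.sin (incidence η v) ^ 2 =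
      Real.sin (incidence η v) := by field_simp
    rw [this, sub_eq_add_neg, ← neg_smul]
    congr 2; field_simp
  have h4 : outPlane f η v - inPlane η v =
      -(Real.sin (f (incidence η v)) + Real.sin (incidence η v)) • η +
      ((Real.cos (f (incidence η v)) - Real.cos (incidence η v)) / Real.sin (incidence η v)) •
        tang η v := by
    conv_lhs => rw [h2]
    rw [outPlane, sub_div]; module
  rw [h1]
  refine (norm_add_le _ _).trans ?_
  rw [norm_smul, norm_smul, h.norm_inPlane h0, mul_one, Real.norm_eq_abs, Real.norm_eq_abs]
  refine add_le_add (mul_le_mul_of_nonneg_left ?_ (abs_nonneg _)) le_rfl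
  rw [h4]
  refine (norm_add_le _ _).trans ?_
  rw [norm_smul, norm_smul, h.norm_normal, h.norm_tang, Real.norm_eq_abs, Real.norm_eq_abs, abs_neg,
    abs_div, abs_of_pos hS, div_mul_cancel₀ _ hS.ne', mul_one]

end Incoming

/-! ### Regularity of the outgoing velocity -/

theorem continuousWithinAt_comp_incidence {g : ℝ → ℝ}
    (hg : ContinuousOn g (Set.Ico 0 (Real.pi / 2))) {η v : Space d} (h : Incoming η v) :
    ContinuousWithinAt (fun v => g (incidence η v)) {v | Incoming η v} v :=
  ContinuousWithinAt.comp (t := Set.Ico 0 (Real.pi / 2)) (hg _ h.incidence_mem)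
    (continuous_incidence η).continuousWithinAt fun _ hw => hw.incidence_mem

/-- The plane of incidence has no limit at normal incidence, but the rank-one term containing it
tends to zero there, because `f'` and the ratio of sines have the same limit and the cosines agree.
-/
theorem continuousOn_velDeriv {f : ℝ → ℝ} (hf : IsContractingLaw f) (η : Space d) :
    ContinuousOn (velDeriv f η) {v | Incoming η v} := by
  intro v h
  have h : Incoming η v := h
  have hrat := continuousWithinAt_comp_incidence (continuousOn_ratio hf) h
  have hsl : ContinuousWithinAt (slopeAt f η) {v | Incoming η v} v :=
    continuousWithinAt_comp_incidence (continuousOn_derivWithin hf) h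
  have hsf := continuousWithinAt_comp_incidence
    (Real.continuous_sin.comp_continuousOn hf.contDiffOn.continuousOn) h
  have hcf := continuousWithinAt_comp_incidence
    (Real.continuous_cos.comp_continuousOn hf.contDiffOn.continuousOn) h
  have hs := continuousWithinAt_comp_incidence (Real.continuous_sin.continuousOn) h
  have hc := continuousWithinAt_comp_incidence (Real.continuous_cos.continuousOn) h
  have hp : ContinuousWithinAt (perp : Space d → _) {v | Incoming η v} v :=
    continuous_perp.continuousWithinAt
  have htang : ContinuousWithinAt (tang η) {v | Incoming η v} v :=
    (continuous_tang η).continuousWithinAt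
  by_cases h0 : incidence η v = 0
  · have hdiff : Filter.Tendsto
        (fun v => velDeriv f η v - ratio f (incidence η v) • perp v)
        (nhdsWithin v {v | Incoming η v}) (nhds 0) := by
      have hbd : ContinuousWithinAt (fun v =>
          |slopeAt f η v| * (|Real.sin (f (incidence η v)) + Real.sin (incidence η v)| +
            |Real.cos (f (incidence η v)) - Real.cos (incidence η v)|) +
          |slopeAt f η v - ratio f (incidence η v)|) {v | Incoming η v} v :=
        (hsl.abs.mul ((hsf.add hs).abs.add (hcf.sub hc).abs)).add (hsl.sub hrat).abs
      have hval : |slopeAt f η v| * (|Real.sin (f (incidence η v)) + Real.sin (incidence η v)| +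
            |Real.cos (f (incidence η v)) - Real.cos (incidence η v)|) +
          |slopeAt f η v - ratio f (incidence η v)| = 0 := by
        simp [slopeAt, h0, hf.map_zero, ratio]
      rw [ContinuousWithinAt, hval] at hbd
      refine squeeze_zero_norm' ?_ hbd
      filter_upwards [self_mem_nhdsWithin] with w hw using hw.norm_velDeriv_sub_le f
    have hv : velDeriv f η v = 0 + ratio f (incidence η v) • perp v := by
      rw [velDeriv, h.inPlane_of_eq_zero h0, map_zero, zero_add]
      ext; simp
    have := hdiff.add (hrat.smul hp)
    rw [ContinuousWithinAt, hv]
    exact this.congr fun w => sub_add_cancel _ _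
  · have hS := (h.sin_pos h0).ne'
    have hin : ContinuousWithinAt (inPlane η) {v | Incoming η v} v := by
      have : Continuous fun v : Space d => η - ⟪v, η⟫_ℝ • v := by fun_prop
      exact (hs.inv₀ hS).smul this.continuousWithinAt
    have hout : ContinuousWithinAt (outPlane f η) {v | Incoming η v} v :=
      (hsf.neg.smul continuousWithinAt_const).add ((hcf.div hs hS).smul htang)
    refine (hrat.smul hp).add ?_
    have hsm := (ContinuousLinearMap.smulRightL ℝ (Space d) (Space d)).continuous₂
    exact hsm.continuousAt.comp_continuousWithinAt (f := fun v => (innerSL ℝ (inPlane η v),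
      slopeAt f η v • outPlane f η v - ratio f (incidence η v) • inPlane η v))
      (((innerSL ℝ).continuous.continuousAt.comp_continuousWithinAt hin).prodMk
        ((hsl.smul hout).sub (hrat.smul hin)))

/-- Derivatives along the unit sphere are determined by their values on tangent vectors. -/
theorem HasFDerivWithinAt.congr_sphere {F : Space d → Space d} {A B : Space d →L[ℝ] Space d}
    {v : Space d} (hv : ‖v‖ = 1) (hF : HasFDerivWithinAt F A (Metric.sphere 0 1) v)
    (hAB : ∀ ξ, ⟪v, ξ⟫_ℝ = 0 → A ξ = B ξ) : HasFDerivWithinAt F B (Metric.sphere 0 1) v := by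
  have hz : HasFDerivWithinAt (fun _ : Space d => (0 : Space d)) (B - A) (Metric.sphere 0 1) v := by
    rw [hasFDerivWithinAt_iff_isLittleO]
    -- For `w` on the sphere, `w - v` is tangent at `v` up to `-(‖w - v‖² / 2) • v`, so a linear map
    -- killing tangent vectors is quadratically small along the sphere.
    have hO : (fun w => (0 : Space d) - 0 - (B - A) (w - v)) =O[nhdsWithin v (Metric.sphere 0 1)]
        fun w => ‖w - v‖ ^ 2 := by
      refine Asymptotics.IsBigO.of_bound ‖(B - A) v‖ ?_
      filter_upwards [self_mem_nhdsWithin] with w hw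
      have hw1 : ‖w‖ = 1 := by simpa using hw
      have hin : ⟪v, w - v⟫_ℝ = -(‖w - v‖ ^ 2 / 2) := by
        rw [norm_sub_sq_real, inner_sub_right, real_inner_self_eq_norm_sq, hv, hw1,
          real_inner_comm]; ring
      have hker : (B - A) (perp v (w - v)) = 0 := by
        rw [sub_apply, hAB _ (inner_perp hv _), sub_self]
      rw [perp_apply, map_sub, map_smul, sub_eq_zero] at hker
      rw [hker, hin, sub_zero, zero_sub, norm_neg, norm_smul, norm_neg, norm_pow, norm_norm,
        norm_div, norm_pow, norm_norm, Real.norm_ofNat, mul_comm]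
      refine mul_le_mul_of_nonneg_left ?_ (norm_nonneg _)
      nlinarith [sq_nonneg ‖w - v‖]
    refine hO.trans_isLittleO ?_
    have := Asymptotics.isLittleO_norm_pow_id one_lt_two (E' := Space d)
    have ht : Filter.Tendsto (fun w => w - v) (nhdsWithin v (Metric.sphere 0 1)) (nhds 0) := by
      have : Continuous fun w : Space d => w - v := by fun_prop
      simpa using (this.tendsto v).mono_left nhdsWithin_le_nhds
    exact this.comp_tendsto ht
  have := (hF.add hz).congr (f₁ := F) (fun w _ => by simp) (by simp)
  rwa [add_sub_cancel] at this

/-- `tang η` as a continuous linear map. -/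
theorem tang_eq_perp (η : Space d) : tang η = perp η := by
  ext1 v; rw [tang, perp_apply, real_inner_comm]

theorem eventually_incoming {η v : Space d} (h : Incoming η v) :
    ∀ᶠ w in nhdsWithin v (Metric.sphere 0 1), Incoming η w := by
  have hc : Continuous fun w : Space d => ⟪w, η⟫_ℝ := by fun_prop
  filter_upwards [self_mem_nhdsWithin,
    nhdsWithin_le_nhds ((hc.tendsto v).eventually_lt_const h.inner_neg)] with w hw hlt
  exact ⟨h.norm_normal, by simpa using hw, hlt⟩

/-- The normal component is `1 + O(‖w - v‖²)`, since `1 - cos (f θ) ≤ 1 - cos θ = ‖w - v‖² / 2`. In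
the tangential component the ratio may be frozen at its value at zero, which leaves a linear map. -/
theorem hasFDerivWithinAt_outVel_of_eq_zero {f : ℝ → ℝ} {lam κ : ℝ} (hf : IsContractingLaw f)
    (hr : RateBounds f lam κ) {η v : Space d} (h : Incoming η v) (h0 : incidence η v = 0) :
    HasFDerivWithinAt (outVel f η) (velDeriv f η v) (Metric.sphere 0 1) v := by
  set T := nhdsWithin v (Metric.sphere (0 : Space d) 1) with hT
  have htv : tang η v = 0 := h.incidence_eq_zero_iff.1 h0
  have hvη : v = -η := by
    have h1 : ⟪v, η⟫_ℝ = -1 := by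
      have := h.cos_incidence; rw [h0, Real.cos_zero] at this; linarith
    rw [tang, h1] at htv
    have := sub_eq_zero.1 htv
    simpa using this
  have hvd : velDeriv f η v = ratio f 0 • perp η := by
    ext1 ξ
    rw [velDeriv_apply, h.inPlane_of_eq_zero h0, h0, hvη]
    simp
  have hov : outVel f η v = η := by
    rw [h.outVel_eq, h0, hf.map_zero, htv]; simp
  have hsub : Filter.Tendsto (fun w => w - v) T (nhds 0) := by
    have : Continuous fun w : Space d => w - v := by fun_prop
    simpa using (this.tendsto v).mono_left nhdsWithin_le_nhds
  have hev := eventually_incoming h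
  rw [hasFDerivWithinAt_iff_isLittleO]
  have h1 : (fun w => (Real.cos (f (incidence η w)) - 1) • η) =o[T] fun w => w - v := by
    have hO : (fun w => (Real.cos (f (incidence η w)) - 1) • η) =O[T] fun w => ‖w - v‖ ^ 2 := by
      refine Asymptotics.IsBigO.of_bound 1 ?_
      filter_upwards [hev] with w hw
      have hle := hr.le_self _ hw.incidence_mem
      have hm := hr.mem _ hw.incidence_mem
      have hcos : Real.cos (incidence η w) ≤ Real.cos (f (incidence η w)) :=
        Real.cos_le_cos_of_nonneg_of_le_pi hm.1 (Real.arccos_le_pi _) hle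
      have h1 := Real.cos_le_one (f (incidence η w))
      have hwv : ‖w - v‖ ^ 2 = 2 * (1 - Real.cos (incidence η w)) := by
        rw [norm_sub_sq_real, hw.norm_vel, h.norm_vel, hvη, inner_neg_right, hw.cos_incidence]; ring
      rw [norm_smul, h.norm_normal, norm_pow, norm_norm, hwv, Real.norm_eq_abs,
        abs_of_nonpos (by linarith)]
      linarith
    refine hO.trans_isLittleO ?_
    exact (Asymptotics.isLittleO_norm_pow_id one_lt_two (E' := Space d)).comp_tendsto hsub
  have h2 : (fun w => (ratio f (incidence η w) - ratio f 0) • tang η w) =o[T] fun w => w - v := by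
    have ho : (fun w => ratio f (incidence η w) - ratio f 0) =o[T] fun _ => (1 : ℝ) := by
      rw [Asymptotics.isLittleO_one_iff]
      have hc := continuousWithinAt_comp_incidence (continuousOn_ratio hf) h
      rw [ContinuousWithinAt, h0] at hc
      have hle : T ≤ nhdsWithin v {w | Incoming η w} := by
        rw [hT]
        exact nhdsWithin_le_of_mem hev
      simpa using (hc.mono_left hle).sub_const (ratio f 0)
    have hO : (fun w => tang η w) =O[T] fun w => w - v := by
      refine Asymptotics.IsBigO.of_bound 1 (Filter.Eventually.of_forall fun w => ?_)
      have : tang η w = perp η (w - v) := by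
        rw [map_sub, ← tang_eq_perp, htv, sub_zero]
      rw [this, one_mul]
      exact norm_perp_le h.norm_normal _
    simpa using ho.smul_isBigO hO
  refine (h1.add h2).congr' ?_ Filter.EventuallyEq.rfl
  filter_upwards [hev] with w hw
  have : perp η (w - v) = tang η w := by rw [map_sub, ← tang_eq_perp, htv, sub_zero]
  rw [hov, hw.outVel_eq, hvd, smul_apply, this]
  module

theorem hasFDerivWithinAt_outVel_of_ne_zero {f : ℝ → ℝ} (hf : IsContractingLaw f)
    {η v : Space d} (h : Incoming η v) (h0 : incidence η v ≠ 0) :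
    HasFDerivWithinAt (outVel f η) (velDeriv f η v) (Metric.sphere 0 1) v := by
  have hS := h.sin_pos h0
  set θ := incidence η v with hθ
  have hIo : θ ∈ Set.Ioo 0 (Real.pi / 2) :=
    ⟨lt_of_le_of_ne h.incidence_mem.1 (Ne.symm h0), h.incidence_mem.2⟩
  have hnhds : Set.Ico 0 (Real.pi / 2) ∈ nhds θ := Ico_mem_nhds hIo.1 hIo.2
  have hfd : HasDerivAt f (slopeAt f η v) θ :=
    (hf.contDiffOn.differentiableOn (by norm_num) θ h.incidence_mem).hasDerivWithinAt.hasDerivAt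
      hnhds
  have hinc : HasFDerivAt (incidence η) ((Real.sin θ)⁻¹ • innerSL ℝ η) v := by
    have hin : HasFDerivAt (fun w : Space d => -⟪w, η⟫_ℝ) (-innerSL ℝ η) v := by
      have : HasFDerivAt (fun w : Space d => innerSL ℝ η w) (innerSL ℝ η) v :=
        (innerSL ℝ η).hasFDerivAt
      refine this.neg.congr_of_eventuallyEq (Filter.Eventually.of_forall fun w => ?_)
      simp [real_inner_comm]
    have hsq := h.sin_sq
    have hlt : ⟪v, η⟫_ℝ ^ 2 < 1 := by
      have : 0 < Real.sin (incidence η v) ^ 2 := by positivity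
      rw [hsq] at this; linarith
    have hac := Real.hasDerivAt_arccos (x := -⟪v, η⟫_ℝ) (by nlinarith [h.inner_neg])
      (by nlinarith [h.inner_neg])
    have hsqrt : √(1 - (-⟪v, η⟫_ℝ) ^ 2) = Real.sin θ := by
      rw [hθ, incidence, Real.sin_arccos]
    rw [hsqrt] at hac
    refine (hac.comp_hasFDerivAt v hin).congr_fderiv ?_
    ext ξ; simp
  have hfi := hfd.comp_hasFDerivAt v hinc
  have hcos := (Real.hasDerivAt_cos (f θ)).comp_hasFDerivAt v hfi
  have hq : HasDerivAt (fun t => Real.sin (f t) / Real.sin t)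
      ((Real.cos (f θ) * slopeAt f η v * Real.sin θ - Real.sin (f θ) * Real.cos θ) /
        Real.sin θ ^ 2) θ := hfd.sin.div (Real.hasDerivAt_sin θ) hS.ne'
  have hqi := hq.comp_hasFDerivAt v hinc
  have htan : HasFDerivAt (tang η) (perp η) v := by
    rw [tang_eq_perp]; exact (perp η).hasFDerivAt
  have hF := (hcos.smul_const η).add (hqi.smul htan)
  have hF' := hF.hasFDerivWithinAt (s := Metric.sphere (0 : Space d) 1)
  have hne : ∀ᶠ w in nhdsWithin v (Metric.sphere (0 : Space d) 1), incidence η w ≠ 0 :=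
    nhdsWithin_le_nhds ((continuous_incidence η).continuousAt.eventually_ne h0)
  have heq : outVel f η =ᶠ[nhdsWithin v (Metric.sphere (0 : Space d) 1)] fun w =>
      Real.cos (f (incidence η w)) • η +
        (Real.sin (f (incidence η w)) / Real.sin (incidence η w)) • tang η w := by
    filter_upwards [eventually_incoming h, hne] with w hw hw0
    rw [hw.outVel_eq, ratio, if_neg hw0]
  have hout : HasFDerivWithinAt (outVel f η) _ (Metric.sphere (0 : Space d) 1) v :=
    HasFDerivWithinAt.congr_of_eventuallyEq hF' heq
      (by rw [h.outVel_eq, ratio, if_neg h0]; rfl)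
  -- The chain rule gives a derivative in the ambient space, which agrees with `velDeriv` on tangent
  -- vectors of the sphere.
  refine HasFDerivWithinAt.congr_sphere h.norm_vel hout fun ξ hξ => ?_
  have hperp : perp v ξ = ξ := perp_of_inner_eq_zero hξ
  have hrat : ratio f (incidence η v) = Real.sin (f θ) / Real.sin θ := by
    rw [ratio, if_neg h0]
  have hine : ⟪inPlane η v, ξ⟫_ℝ = ⟪η, ξ⟫_ℝ / Real.sin θ := by
    rw [inPlane, real_inner_smul_left, inner_sub_left, real_inner_smul_left, hξ, ← hθ]
    field_simp; ring
  have hinp : inPlane η v = (Real.sin θ)⁻¹ • ((Real.sin θ ^ 2) • η + Real.cos θ • tang η v) := by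
    rw [inPlane]
    congr 1
    rw [h.sin_sq, h.cos_incidence, tang]; module
  rw [velDeriv_apply, hperp, hine, hrat, outPlane, hinp]
  simp only [add_apply, smul_apply, ContinuousLinearMap.smulRight_apply,
    innerSL_apply_apply, perp_apply, Function.comp_apply, smul_eq_mul]
  rw [← hθ]
  have hS' := hS.ne'
  match_scalars <;> field_simp <;> ring

theorem hasFDerivWithinAt_outVel {f : ℝ → ℝ} {lam κ : ℝ} (hf : IsContractingLaw f)
    (hr : RateBounds f lam κ) {η v : Space d} (h : Incoming η v) :
    HasFDerivWithinAt (outVel f η) (velDeriv f η v) (Metric.sphere 0 1) v := by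
  by_cases h0 : incidence η v = 0
  · exact hasFDerivWithinAt_outVel_of_eq_zero hf hr h h0
  · exact hasFDerivWithinAt_outVel_of_ne_zero hf h h0

/-! ### The billiard map near a point of its domain -/

/-- The time at which the half-line of `x` meets the hyperplane of the facet with normal `η`. -/
def hitTime (P : Set (Space d)) (η : Space d) (x : Phase d) : ℝ :=
  (offset P η - ⟪η, x.fst⟫_ℝ) / ⟪x.snd, η⟫_ℝ

/-- The half-line of `x` meets the facet with normal `η` in its relative interior. -/
structure IsHit (P : Set (Space d)) (η : Space d) (x : Phase d) : Prop where
  isFacetNormal : IsFacetNormal P η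
  incoming : Incoming η x.snd
  mem : x.fst + hitTime P η x • x.snd ∈ intrinsicInterior ℝ (face P η)

/-- The normal of the facet of the reflection `x`. -/
def nrm (P : Set (Space d)) (x : Phase d) : Space d := normalAt P x.fst

/-- A reflection at the facet with normal `η`. -/
structure IsReflection (P : Set (Space d)) (η : Space d) (x : Phase d) : Prop where
  isFacetNormal : IsFacetNormal P η
  mem : x.fst ∈ intrinsicInterior ℝ (face P η)
  norm_vel : ‖x.snd‖ = 1
  inner_pos : 0 < ⟪x.snd, η⟫_ℝ

/-- The map of pairs of linear maps into the phase space. -/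
def phaseMk {F : Type*} [NormedAddCommGroup F] [NormedSpace ℝ F] (A B : F →L[ℝ] Space d) :
    F →L[ℝ] Phase d :=
  (WithLp.prodContinuousLinearEquiv 2 ℝ (Space d) (Space d)).symm.toContinuousLinearMap ∘L (A.prod B)

@[simp] theorem phaseMk_apply_fst {F : Type*} [NormedAddCommGroup F] [NormedSpace ℝ F]
    (A B : F →L[ℝ] Space d) (x : F) : (phaseMk A B x).fst = A x := rfl

@[simp] theorem phaseMk_apply_snd {F : Type*} [NormedAddCommGroup F] [NormedSpace ℝ F]
    (A B : F →L[ℝ] Space d) (x : F) : (phaseMk A B x).snd = B x := rfl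

/-- The derivative of the billiard map at a reflection with next collision at normal `η`. -/
def hitDeriv (f : ℝ → ℝ) (P : Set (Space d)) (η : Space d) (x : Phase d) : Phase d →L[ℝ] Phase d :=
  phaseMk
    (oblique η x.snd ∘L (WithLp.fstL 2 ℝ (Space d) (Space d) +
      hitTime P η x • WithLp.sndL 2 ℝ (Space d) (Space d)))
    (velDeriv f η x.snd ∘L WithLp.sndL 2 ℝ (Space d) (Space d))

theorem phase_ext {x y : Phase d} (h1 : x.fst = y.fst) (h2 : x.snd = y.snd) : x = y := by
  have : x.ofLp = y.ofLp := Prod.ext h1 h2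
  exact WithLp.ofLp_injective 2 this

/-! ### Derivatives along a set, tested on curves -/

section Normed

variable {G F : Type*} [NormedAddCommGroup G] [NormedSpace ℝ G] [NormedAddCommGroup F]
  [NormedSpace ℝ F]

theorem continuousWithinAt_of_hasFDerivWithinAt {g : G → F} {A : G →L[ℝ] F} {s : Set G} {x : G}
    (h : HasFDerivWithinAt g A s x) : ContinuousWithinAt g s x := h.continuousWithinAt

/-- `ξ` is the velocity at `x` of a curve in `s`. -/
def IsVelocity (s : Set G) (x ξ : G) : Prop :=
  ∃ γ : ℝ → G, γ 0 = x ∧ HasDerivAt γ ξ 0 ∧ ∀ᶠ t in nhds 0, γ t ∈ s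

/-- Along a set of lower dimension the derivative within the set is not unique, so `fderivWithin` is
an arbitrary choice. Its value on the velocity of a curve in the set is nevertheless forced. -/
theorem IsVelocity.fderivWithin_apply {g : G → F} {A : G →L[ℝ] F} {s : Set G} {x ξ : G}
    (h : IsVelocity s x ξ) (hA : HasFDerivWithinAt g A s x) : fderivWithin ℝ g s x ξ = A ξ := by
  obtain ⟨γ, h0, hγ, hmem⟩ := h
  have hB := hA.differentiableWithinAt.hasFDerivWithinAt
  rw [← h0] at hA hB
  have h3 := hA.comp_hasDerivAt 0 hγ hmem
  have h4 := hB.comp_hasDerivAt 0 hγ hmem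
  rw [h0] at h4
  exact h4.unique h3

theorem isVelocity_toLp {s : Set (WithLp 2 (G × G))} {x ξ : WithLp 2 (G × G)} {p q : ℝ → G}
    (hp : HasDerivAt p ξ.fst 0) (hq : HasDerivAt q ξ.snd 0) (hp0 : p 0 = x.fst) (hq0 : q 0 = x.snd)
    (hmem : ∀ᶠ t in nhds 0, WithLp.toLp 2 (p t, q t) ∈ s) : IsVelocity s x ξ := by
  refine ⟨fun t => WithLp.toLp 2 (p t, q t), ?_, ?_, hmem⟩
  · change WithLp.toLp 2 (p 0, q 0) = x
    rw [hp0, hq0]; rfl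
  · exact (WithLp.prodContinuousLinearEquiv 2 ℝ G
      G).symm.toContinuousLinearMap.hasFDerivAt.comp_hasDerivAt 0 (hp.prodMk hq)

end Normed

namespace IsPolytope

variable {P : Set (Space d)} (hP : IsPolytope P)
include hP

theorem exists_isReflection {x : Phase d} (hx : x ∈ reflections P) :
    IsReflection P (nrm P x) x := by
  obtain ⟨η, hη, hm, hv, hpos⟩ := hx
  have : nrm P x = η := hP.normalAt_eq hη hm
  rw [this]
  exact ⟨hη, hm, hv, hpos⟩

theorem mem_reflections_of_isReflection {η : Space d} {x : Phase d} (hx : IsReflection P η x) :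
    x ∈ reflections P :=
  have := hP
  ⟨η, hx.isFacetNormal, hx.mem, hx.norm_vel, hx.inner_pos⟩

theorem fst_mem {x : Phase d} (hx : x ∈ reflections P) : x.fst ∈ P :=
  (intrinsicInterior_subset (hP.exists_isReflection hx).mem).1

/-- The ray leaves the bounded set `P`, so it approaches some facet hyperplane. The first such
hyperplane is reached at a point of `P`, and avoidance of the skeleton puts this point in the
relative interior. -/
theorem exists_isHit {x : Phase d} (hd : 2 ≤ d) (hx : x ∈ billiardDomain P) :
    ∃ η, IsHit P η x := by
  have hr := hP.exists_isReflection hx.1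
  have hxP := hP.fst_mem hx.1
  set N := (hP.finite_facetNormals hd).toFinset with hN
  have hmemN : ∀ η, η ∈ N ↔ IsFacetNormal P η := fun η => by simp [hN]
  classical
  set N' := N.filter fun η => ⟪x.snd, η⟫_ℝ < 0 with hN'
  have hne : N'.Nonempty := by
    by_contra hcon
    rw [Finset.not_nonempty_iff_eq_empty, Finset.filter_eq_empty_iff] at hcon
    obtain ⟨R, hR⟩ := hP.isCompact.isBounded.subset_closedBall x.fst
    have hR0 : 0 ≤ R := by simpa using hR hxP
    have hmem : x.fst + (R + 1) • x.snd ∈ P := by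
      refine hP.mem_iff.2 fun η hη => ?_
      have h1 := hcon ((hmemN η).2 hη)
      rw [inner_add_right, real_inner_smul_right, real_inner_comm x.snd η]
      have := hP.offset_le hxP (η := η)
      nlinarith
    have h1 := hR hmem
    rw [Metric.mem_closedBall, dist_eq_norm, add_sub_cancel_left, norm_smul, hr.norm_vel,
      Real.norm_eq_abs, abs_of_pos (by linarith)] at h1
    linarith
  obtain ⟨η, hη, hmin⟩ := N'.exists_min_image (fun η => hitTime P η x) hne
  rw [hN', Finset.mem_filter, hmemN] at hη
  have hη1 := hη.2
  have hτ0 : 0 ≤ hitTime P η x :=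
    div_nonneg_of_nonpos (by linarith [hP.offset_le hxP (η := η)]) hη1.le
  have hon : ⟪η, x.fst + hitTime P η x • x.snd⟫_ℝ = offset P η := by
    rw [inner_add_right, real_inner_smul_right, hitTime, real_inner_comm x.snd η,
      div_mul_cancel₀ _ hη1.ne]; ring
  have hqP : x.fst + hitTime P η x • x.snd ∈ P := by
    refine hP.mem_iff.2 fun ζ hζ => ?_
    have hoff := hP.offset_le hxP (η := ζ)
    rw [inner_add_right, real_inner_smul_right, real_inner_comm x.snd ζ]
    by_cases hneg : ⟪x.snd, ζ⟫_ℝ < 0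
    · have h1 := hmin ζ (by rw [hN', Finset.mem_filter, hmemN]; exact ⟨hζ, hneg⟩)
      have h2 := mul_le_mul_of_nonpos_right h1 hneg.le
      rw [hitTime, div_mul_cancel₀ _ hneg.ne] at h2
      linarith
    · push Not at hneg
      have := mul_nonneg hτ0 hneg
      linarith
  refine ⟨η, hη.1, ⟨hη.1.1, hr.norm_vel, hη1⟩, ?_⟩
  by_contra hnot
  exact hx.2 _ hτ0 (hP.mem_skeleton_iff.2 ⟨η, hη.1, hP.mem_face_iff.2 ⟨hqP, hon⟩, hnot⟩)

theorem hitTime_pos (hd : 2 ≤ d) {η : Space d} {x : Phase d} (hx : x ∈ reflections P)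
    (h : IsHit P η x) : 0 < hitTime P η x := by
  have hr := hP.exists_isReflection hx
  have hne : η ≠ nrm P x := by
    intro h0
    have h1 := h.incoming.inner_neg
    have h2 := hr.inner_pos
    rw [← h0] at h2; linarith
  have h1 := ((hP.mem_intrinsicInterior_face_iff hd hr.isFacetNormal).1 hr.mem).2 η
    h.isFacetNormal hne
  exact div_pos_of_neg_of_neg (by linarith) h.incoming.inner_neg

/-- After the hit the ray has left a half-space containing `P`. A facet touched strictly between
gives an affine function, nonnegative at both ends and zero inside, hence zero at the start; that
facet is the starting one, which the velocity leaves. -/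
theorem flightTime_eq (hd : 2 ≤ d) {η : Space d} {x : Phase d} (hx : x ∈ reflections P)
    (h : IsHit P η x) : flightTime P x = hitTime P η x := by
  have hr := hP.exists_isReflection hx
  have hτ := hP.hitTime_pos hd hx h
  have hset : {t : ℝ | 0 < t ∧ x.fst + t • x.snd ∈ facetInteriors P} = {hitTime P η x} := by
    ext t
    simp only [Set.mem_ofPred_eq, Set.mem_singleton_iff]
    constructor
    · rintro ⟨ht, ζ, hζ, hm⟩
      have hmP := (intrinsicInterior_subset hm).1
      have hζt := (hP.mem_face_iff.1 (intrinsicInterior_subset hm)).2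
      have h1 := hP.offset_le hmP (η := η)
      have hneg := h.incoming.inner_neg
      have hτe : hitTime P η x * ⟪x.snd, η⟫_ℝ = offset P η - ⟪η, x.fst⟫_ℝ :=
        div_mul_cancel₀ _ hneg.ne
      rw [inner_add_right, real_inner_smul_right, real_inner_comm x.snd η] at h1
      have hle : t ≤ hitTime P η x := by
        by_contra hlt
        push Not at hlt
        nlinarith
      refine le_antisymm hle ?_
      by_contra hlt
      push Not at hlt
      have hq := hP.offset_le (intrinsicInterior_subset h.mem).1 (η := ζ)
      have hp := hP.offset_le (hP.fst_mem hx) (η := ζ)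
      rw [inner_add_right, real_inner_smul_right] at hq hζt
      have hv0 : 0 ≤ ⟪ζ, x.snd⟫_ℝ := by
        by_contra hvn
        push Not at hvn
        nlinarith
      have hpe : ⟪ζ, x.fst⟫_ℝ = offset P ζ := by nlinarith
      have hζη : ζ = nrm P x := by
        by_contra hne
        have := ((hP.mem_intrinsicInterior_face_iff hd hr.isFacetNormal).1 hr.mem).2 ζ hζ hne
        linarith
      have h3 := hr.inner_pos
      rw [← hζη, real_inner_comm] at h3
      nlinarith
    · rintro rfl
      exact ⟨hτ, η, h.isFacetNormal, h.mem⟩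
  rw [flightTime, hset, csInf_singleton]

theorem billiardMap_eq (hd : 2 ≤ d) (f : ℝ → ℝ) {η : Space d} {x : Phase d}
    (hx : x ∈ reflections P) (h : IsHit P η x) : billiardMap f P x =
      WithLp.toLp 2 (x.fst + hitTime P η x • x.snd, outVel f η x.snd) := by
  have h1 : hitPoint P x = x.fst + hitTime P η x • x.snd := by
    rw [hitPoint, hP.flightTime_eq hd hx h]
  have h2 : normalAt P (hitPoint P x) = η := by
    rw [h1]; exact hP.normalAt_eq h.isFacetNormal h.mem
  rw [billiardMap, h2, h1, outVel]

theorem isReflection_billiardMap (hd : 2 ≤ d) {f : ℝ → ℝ} {lam κ : ℝ} (hf : IsContractingLaw f)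
    (hr : RateBounds f lam κ) {η : Space d} {x : Phase d}
    (hx : x ∈ reflections P) (h : IsHit P η x) : IsReflection P η (billiardMap f P x) := by
  rw [hP.billiardMap_eq hd f hx h]
  refine ⟨h.isFacetNormal, h.mem, h.incoming.norm_outVel hf, ?_⟩
  change 0 < ⟪outVel f η x.snd, η⟫_ℝ
  rw [h.incoming.inner_outVel_normal]
  exact hr.κ_pos.trans_le (hr.le_cos _ h.incoming.incidence_mem)

theorem nrm_billiardMap (hd : 2 ≤ d) (f : ℝ → ℝ) {η : Space d} {x : Phase d}
    (hx : x ∈ reflections P) (h : IsHit P η x) : nrm P (billiardMap f P x) = η := by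
  rw [nrm, hP.billiardMap_eq hd f hx h]
  exact hP.normalAt_eq h.isFacetNormal h.mem

omit hP in
theorem continuousAt_hitTime {η : Space d} {x : Phase d} (h : Incoming η x.snd) :
    ContinuousAt (hitTime P η) x := by
  have h1 : Continuous fun x : Phase d => offset P η - ⟪η, x.fst⟫_ℝ := by fun_prop
  have h2 : Continuous fun x : Phase d => ⟪x.snd, η⟫_ℝ := by fun_prop
  exact h1.continuousAt.div h2.continuousAt h.inner_neg.ne

/-- The next facet is locally constant, so near `x` the billiard map is given by one explicit
formula. -/
theorem eventually_isHit (hd : 2 ≤ d) {η : Space d} {x : Phase d} (h : IsHit P η x) :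
    ∀ᶠ y in nhdsWithin x (reflections P), IsHit P η y := by
  have hfac := h.isFacetNormal
  have hc2 : Continuous fun y : Phase d => ⟪y.snd, η⟫_ℝ := by fun_prop
  have hneg : ∀ᶠ y in nhds x, ⟪y.snd, η⟫_ℝ < 0 :=
    (hc2.tendsto x).eventually_lt_const h.incoming.inner_neg
  have hpt : ContinuousAt (fun y : Phase d => y.fst + hitTime P η y • y.snd) x := by
    have h1 : Continuous fun y : Phase d => y.fst := by fun_prop
    have h2 : Continuous fun y : Phase d => y.snd := by fun_prop
    exact h1.continuousAt.add ((continuousAt_hitTime h.incoming).smul h2.continuousAt)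
  have hfin : ({ζ | IsFacetNormal P ζ} \ {η}).Finite := (hP.finite_facetNormals hd).sdiff
  have hlt := ((hP.mem_intrinsicInterior_face_iff hd hfac).1 h.mem).2
  have hev : ∀ᶠ y in nhds x, ∀ ζ ∈ {ζ | IsFacetNormal P ζ} \ {η},
      offset P ζ < ⟪ζ, y.fst + hitTime P η y • y.snd⟫_ℝ := by
    rw [Filter.eventually_all_finite hfin]
    intro ζ hζ
    have hc : Continuous fun y : Space d => ⟪ζ, y⟫_ℝ := by fun_prop
    exact (hc.continuousAt.comp hpt).eventually_const_lt (hlt ζ hζ.1 hζ.2)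
  filter_upwards [self_mem_nhdsWithin, nhdsWithin_le_nhds hneg, nhdsWithin_le_nhds hev]
    with y hy hyneg hyev
  have hyr := hP.exists_isReflection hy
  refine ⟨hfac, ⟨hfac.1, hyr.norm_vel, hyneg⟩,
    (hP.mem_intrinsicInterior_face_iff hd hfac).2 ⟨?_, fun ζ hζ hne => hyev ζ ⟨hζ, hne⟩⟩⟩
  rw [inner_add_right, real_inner_smul_right, hitTime, real_inner_comm y.snd η,
    div_mul_cancel₀ _ hyneg.ne]
  ring

omit hP in
theorem hasFDerivAt_hitPosition {η : Space d} {x : Phase d} (h : Incoming η x.snd) :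
    HasFDerivAt (fun y : Phase d => y.fst + hitTime P η y • y.snd)
      (oblique η x.snd ∘L (WithLp.fstL 2 ℝ (Space d) (Space d) +
        hitTime P η x • WithLp.sndL 2 ℝ (Space d) (Space d))) x := by
  have hfst : HasFDerivAt (fun y : Phase d => y.fst) (WithLp.fstL 2 ℝ (Space d) (Space d)) x :=
    (WithLp.fstL 2 ℝ (Space d) (Space d)).hasFDerivAt
  have hsnd : HasFDerivAt (fun y : Phase d => y.snd) (WithLp.sndL 2 ℝ (Space d) (Space d)) x :=
    (WithLp.sndL 2 ℝ (Space d) (Space d)).hasFDerivAt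
  have hnum : HasFDerivAt (fun y : Phase d => offset P η - ⟪η, y.fst⟫_ℝ)
      (-(innerSL ℝ η ∘L WithLp.fstL 2 ℝ (Space d) (Space d))) x :=
    ((innerSL ℝ η).hasFDerivAt.comp x hfst).const_sub _
  have hden : HasFDerivAt (fun y : Phase d => ⟪y.snd, η⟫_ℝ)
      (innerSL ℝ η ∘L WithLp.sndL 2 ℝ (Space d) (Space d)) x := by
    refine ((innerSL ℝ η).hasFDerivAt.comp x hsnd).congr_of_eventuallyEq
      (Filter.Eventually.of_forall fun y => ?_)
    simp [real_inner_comm]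
  have hne := h.inner_neg.ne
  have hinv := (hasDerivAt_inv hne).comp_hasFDerivAt x hden
  have htime : HasFDerivAt (hitTime P η) _ x := hnum.mul hinv
  refine (hfst.add (htime.smul hsnd)).congr_fderiv ?_
  ext1 ξ
  have e1 : WithLp.fstL 2 ℝ (Space d) (Space d) ξ = ξ.fst := rfl
  have e2 : WithLp.sndL 2 ℝ (Space d) (Space d) ξ = ξ.snd := rfl
  simp only [add_apply, smul_apply, neg_apply, ContinuousLinearMap.comp_apply,
    ContinuousLinearMap.smulRight_apply, innerSL_apply_apply, smul_eq_mul,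
    oblique_apply, inner_add_left, real_inner_smul_left, e1, e2, hitTime,
    real_inner_comm ξ.fst η, real_inner_comm ξ.snd η]
  match_scalars
  · ring
  · ring
  · field_simp; ring

/-- The billiard map is differentiable along `reflections P`. -/
theorem hasFDerivWithinAt_billiardMap (hd : 2 ≤ d) {f : ℝ → ℝ} {lam κ : ℝ}
    (hf : IsContractingLaw f) (hr : RateBounds f lam κ) {η : Space d} {x : Phase d}
    (hx : x ∈ reflections P) (h : IsHit P η x) :
    HasFDerivWithinAt (billiardMap f P) (hitDeriv f P η x) (reflections P) x := by
  have hsnd : HasFDerivWithinAt (fun y : Phase d => y.snd) (WithLp.sndL 2 ℝ (Space d) (Space d))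
      (reflections P) x := (WithLp.sndL 2 ℝ (Space d) (Space d)).hasFDerivWithinAt
  have hvel : HasFDerivWithinAt (fun y : Phase d => outVel f η y.snd)
      (velDeriv f η x.snd ∘L WithLp.sndL 2 ℝ (Space d) (Space d)) (reflections P) x := by
    refine (hasFDerivWithinAt_outVel hf hr h.incoming).comp x hsnd fun y hy => ?_
    simpa using (hP.exists_isReflection hy).norm_vel
  have hpos := (hasFDerivAt_hitPosition (P := P) h.incoming).hasFDerivWithinAt (s := reflections P)
  have hpair := hpos.prodMk hvel
  have htot := (WithLp.prodContinuousLinearEquiv 2 ℝ (Space d)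
    (Space d)).symm.toContinuousLinearMap.hasFDerivAt.comp_hasFDerivWithinAt x hpair
  refine HasFDerivWithinAt.congr_of_eventuallyEq htot ?_ (hP.billiardMap_eq hd f hx h)
  filter_upwards [self_mem_nhdsWithin, hP.eventually_isHit hd h] with y hy hyh
    using hP.billiardMap_eq hd f hy hyh

theorem tendsto_billiardMap (hd : 2 ≤ d) {f : ℝ → ℝ} {lam κ : ℝ}
    (hf : IsContractingLaw f) (hr : RateBounds f lam κ) {x : Phase d}
    (hx : x ∈ billiardDomain P) :
    Filter.Tendsto (billiardMap f P) (nhdsWithin x (reflections P))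
      (nhdsWithin (billiardMap f P x) (reflections P)) := by
  obtain ⟨η, h⟩ := hP.exists_isHit hd hx
  have hc := continuousWithinAt_of_hasFDerivWithinAt
    (hP.hasFDerivWithinAt_billiardMap hd hf hr hx.1 h)
  rw [tendsto_nhdsWithin_iff]
  refine And.intro hc ?_
  filter_upwards [self_mem_nhdsWithin, hP.eventually_isHit hd h] with y hy hyh
    using hP.mem_reflections_of_isReflection (hP.isReflection_billiardMap hd hf hr hy hyh)

theorem billiardMap_mem_reflections (hd : 2 ≤ d) {f : ℝ → ℝ} {lam κ : ℝ}
    (hf : IsContractingLaw f) (hr : RateBounds f lam κ) {x : Phase d}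
    (hx : x ∈ billiardDomain P) : billiardMap f P x ∈ reflections P := by
  obtain ⟨η, h⟩ := hP.exists_isHit hd hx
  exact hP.mem_reflections_of_isReflection (hP.isReflection_billiardMap hd hf hr hx.1 h)

theorem isHit_nrm (hd : 2 ≤ d) (f : ℝ → ℝ) {x : Phase d}
    (hx : x ∈ billiardDomain P) : IsHit P (nrm P (billiardMap f P x)) x := by
  obtain ⟨η, h⟩ := hP.exists_isHit hd hx
  rwa [hP.nrm_billiardMap hd f hx.1 h]

end IsPolytope

/-! ### Derivatives of the iterates -/

/-- The derivative of the billiard map. -/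
def stepDeriv (f : ℝ → ℝ) (P : Set (Space d)) (x : Phase d) : Phase d →L[ℝ] Phase d :=
  hitDeriv f P (nrm P (billiardMap f P x)) x

/-- The derivative of the `n`-th iterate of the billiard map. -/
def iterDeriv (f : ℝ → ℝ) (P : Set (Space d)) : ℕ → Phase d → (Phase d →L[ℝ] Phase d)
  | 0, _ => ContinuousLinearMap.id ℝ _
  | n + 1, x => stepDeriv f P ((billiardMap f P)^[n] x) ∘L iterDeriv f P n x

theorem mem_tangentSpaceAt {P : Set (Space d)} {x ξ : Phase d} :
    ξ ∈ tangentSpaceAt P x ↔ ⟪nrm P x, ξ.fst⟫_ℝ = 0 ∧ ⟪x.snd, ξ.snd⟫_ℝ = 0 := by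
  rw [tangentSpaceAt, Submodule.mem_comap, Submodule.mem_prod,
    Submodule.mem_orthogonal_singleton_iff_inner_right,
    Submodule.mem_orthogonal_singleton_iff_inner_right]
  rfl

theorem Incoming.inner_outVel_velDeriv {η v : Space d} (h : Incoming η v) {f : ℝ → ℝ}
    (hf : IsContractingLaw f) {ξ : Space d} (hξ : ⟪v, ξ⟫_ℝ = 0) :
    ⟪outVel f η v, velDeriv f η v ξ⟫_ℝ = 0 := by
  rw [velDeriv_apply, perp_of_inner_eq_zero hξ]
  set r := ratio f (incidence η v) with hr
  by_cases h0 : incidence η v = 0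
  · have htv : tang η v = 0 := h.incidence_eq_zero_iff.1 h0
    rw [h.inPlane_of_eq_zero h0, inner_zero_left, zero_smul, add_zero, h.outVel_eq, htv, smul_zero,
      add_zero, real_inner_smul_left, real_inner_smul_right]
    have hc := h.cos_incidence
    rw [h0, Real.cos_zero] at hc
    have h1 : ⟪v, η⟫_ℝ = -1 := by linarith
    rw [tang, h1, sub_eq_zero, neg_one_smul] at htv
    rw [htv, inner_neg_left, neg_eq_zero] at hξ
    rw [hξ]; ring
  · set e := inPlane η v with he
    set a := ⟪e, ξ⟫_ℝ with ha
    have hS := h.sin_pos h0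
    have hen : ⟪e, e⟫_ℝ = 1 := by rw [real_inner_self_eq_norm_sq, h.norm_inPlane h0]; norm_num
    have heq : r • ξ + a • (slopeAt f η v • outPlane f η v - r • e) =
        r • (ξ - a • e) + (a * slopeAt f η v) • outPlane f η v := by module
    have hey : ⟪e, ξ - a • e⟫_ℝ = 0 := by
      rw [inner_sub_right, real_inner_smul_right, hen, ← ha]; ring
    have hvy : ⟪v, ξ - a • e⟫_ℝ = 0 := by
      rw [inner_sub_right, real_inner_smul_right, hξ, h.inner_vel_inPlane]; ring
    have hηy : ⟪η, ξ - a • e⟫_ℝ = 0 := by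
      rw [h.normal_eq h0, inner_add_left, real_inner_smul_left, real_inner_smul_left, ← he, hey,
        hvy]; ring
    have hoy : ⟪outVel f η v, ξ - a • e⟫_ℝ = 0 := by
      rw [h.outVel_eq, tang, inner_add_left, real_inner_smul_left, real_inner_smul_left,
        inner_sub_left, real_inner_smul_left, hηy, hvy]; ring
    have hoo : ⟪outVel f η v, outPlane f η v⟫_ℝ = 0 := by
      rw [h.outVel_eq, outPlane]
      simp only [inner_add_left, inner_add_right, real_inner_smul_left, real_inner_smul_right,
        h.inner_normal_self, h.inner_tang_normal, h.inner_normal_tang]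
      rw [real_inner_self_eq_norm_sq, h.norm_tang_sq]
      have := ratio_mul_sin hf h.incidence_mem
      field_simp
      linear_combination
        Real.cos (f (incidence η v)) * Real.sin (incidence η v) * this
    rw [heq, inner_add_right, real_inner_smul_right, real_inner_smul_right, hoy, hoo]; ring

namespace IsPolytope

variable {P : Set (Space d)} (hP : IsPolytope P)
include hP

theorem billiardMap_fst (hd : 2 ≤ d) (f : ℝ → ℝ) {x : Phase d} (hx : x ∈ billiardDomain P) :
    (billiardMap f P x).fst = x.fst + hitTime P (nrm P (billiardMap f P x)) x • x.snd := by
  have := hP.billiardMap_eq hd f hx.1 (hP.isHit_nrm hd f hx)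
  exact congrArg WithLp.fst this

theorem billiardMap_snd (hd : 2 ≤ d) (f : ℝ → ℝ) {x : Phase d} (hx : x ∈ billiardDomain P) :
    (billiardMap f P x).snd = outVel f (nrm P (billiardMap f P x)) x.snd := by
  have := hP.billiardMap_eq hd f hx.1 (hP.isHit_nrm hd f hx)
  exact congrArg WithLp.snd this

theorem stepDeriv_mem (hd : 2 ≤ d) {f : ℝ → ℝ} (hf : IsContractingLaw f) {x ξ : Phase d}
    (hx : x ∈ billiardDomain P) (hξ : ξ ∈ tangentSpaceAt P x) :
    stepDeriv f P x ξ ∈ tangentSpaceAt P (billiardMap f P x) := by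
  have h := (hP.isHit_nrm hd f hx).incoming
  rw [mem_tangentSpaceAt] at hξ ⊢
  constructor
  · rw [real_inner_comm]
    exact inner_oblique h.inner_neg.ne _
  · rw [hP.billiardMap_snd hd f hx]
    exact h.inner_outVel_velDeriv hf hξ.2

/-- The second half is carried along because the chain rule within `reflections P` needs nearby
reflections to be sent into `reflections P`. -/
theorem hasFDerivWithinAt_iterate (hd : 2 ≤ d) {f : ℝ → ℝ} {lam κ : ℝ}
    (hf : IsContractingLaw f) (hr : RateBounds f lam κ) {x : Phase d}
    (hx : x ∈ forwardSet f P) (n : ℕ) :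
    HasFDerivWithinAt ((billiardMap f P)^[n]) (iterDeriv f P n x) (reflections P) x ∧
    Filter.Tendsto ((billiardMap f P)^[n]) (nhdsWithin x (reflections P))
      (nhdsWithin ((billiardMap f P)^[n] x) (reflections P)) := by
  induction n with
  | zero => exact ⟨hasFDerivWithinAt_id _ _, Filter.tendsto_id⟩
  | succ n ih =>
    have hn := hx.2 n
    rw [Function.iterate_succ']
    exact ⟨(hP.hasFDerivWithinAt_billiardMap hd hf hr hn.1
      (hP.isHit_nrm hd f hn)).comp_of_tendsto x ih.1 ih.2,
      (hP.tendsto_billiardMap hd hf hr hn).comp ih.2⟩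

/-- Every tangent vector is the velocity of a curve in `reflections P`. -/
theorem isVelocity (hd : 2 ≤ d) {x ξ : Phase d} (hx : x ∈ reflections P)
    (hξ : ξ ∈ tangentSpaceAt P x) : IsVelocity (reflections P) x ξ := by
  have hr := hP.exists_isReflection hx
  rw [mem_tangentSpaceAt] at hξ
  -- Normalises `x.snd + t • ξ.snd` to the unit sphere; as `ξ.snd ⟂ x.snd` it has zero derivative at
  -- `0` and does not alter the velocity of the curve.
  set c : ℝ → ℝ := fun t => (√(1 + t ^ 2 * ‖ξ.snd‖ ^ 2))⁻¹ with hc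
  have hc0 : c 0 = 1 := by simp [hc]
  have hcd : HasDerivAt c 0 0 := by
    have h1 : HasDerivAt (fun t : ℝ => 1 + t ^ 2 * ‖ξ.snd‖ ^ 2) 0 0 := by
      simpa using ((hasDerivAt_pow 2 (0 : ℝ)).mul_const (‖ξ.snd‖ ^ 2)).const_add 1
    have h2 := (h1.sqrt (by norm_num)).fun_inv (by norm_num)
    simpa using h2
  have hp : HasDerivAt (fun t : ℝ => x.fst + t • ξ.fst) ξ.fst 0 := by
    simpa using ((hasDerivAt_id (0 : ℝ)).smul_const ξ.fst).const_add x.fst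
  have hq : HasDerivAt (fun t : ℝ => x.snd + t • ξ.snd) ξ.snd 0 := by
    simpa using ((hasDerivAt_id (0 : ℝ)).smul_const ξ.snd).const_add x.snd
  have hv : HasDerivAt (fun t : ℝ => c t • (x.snd + t • ξ.snd)) ξ.snd 0 := by
    have := hcd.smul hq
    rw [hc0, one_smul, zero_smul, add_zero] at this
    exact this
  refine isVelocity_toLp hp hv (by simp) (by simp [hc0]) ?_
  have hint := (hP.mem_intrinsicInterior_face_iff hd hr.isFacetNormal).1 hr.mem
  have hfin : ({ζ | IsFacetNormal P ζ} \ {nrm P x}).Finite := (hP.finite_facetNormals hd).sdiff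
  have hev : ∀ᶠ t : ℝ in nhds 0, ∀ ζ ∈ {ζ | IsFacetNormal P ζ} \ {nrm P x},
      offset P ζ < ⟪ζ, x.fst + t • ξ.fst⟫_ℝ := by
    rw [Filter.eventually_all_finite hfin]
    intro ζ hζ
    have hcont : Continuous fun t : ℝ => ⟪ζ, x.fst + t • ξ.fst⟫_ℝ := by fun_prop
    exact (hcont.tendsto 0).eventually_const_lt (by simpa using hint.2 ζ hζ.1 hζ.2)
  have hcont : ContinuousAt (fun t : ℝ => ⟪c t • (x.snd + t • ξ.snd), nrm P x⟫_ℝ) 0 :=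
    hv.continuousAt.inner continuousAt_const
  have hpos := hcont.eventually_const_lt (show (0 : ℝ) < _ by simpa [hc0] using hr.inner_pos)
  filter_upwards [hev, hpos] with t h1 h2
  refine ⟨nrm P x, hr.isFacetNormal,
    (hP.mem_intrinsicInterior_face_iff hd hr.isFacetNormal).2
      ⟨?_, fun ζ hζ hne => h1 ζ ⟨hζ, hne⟩⟩, ?_, h2⟩
  · change ⟪nrm P x, x.fst + t • ξ.fst⟫_ℝ = _
    rw [inner_add_right, real_inner_smul_right, hξ.1, hint.1]; ring
  · change ‖c t • (x.snd + t • ξ.snd)‖ = 1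
    have hn : ‖x.snd + t • ξ.snd‖ ^ 2 = 1 + t ^ 2 * ‖ξ.snd‖ ^ 2 := by
      rw [norm_add_sq_real, norm_smul, hr.norm_vel, real_inner_smul_right, hξ.2,
        Real.norm_eq_abs, mul_pow, sq_abs]; ring
    have hs : √(1 + t ^ 2 * ‖ξ.snd‖ ^ 2) = ‖x.snd + t • ξ.snd‖ := by
      rw [← hn, Real.sqrt_sq (norm_nonneg _)]
    have hpos : 0 < ‖x.snd + t • ξ.snd‖ := by
      rw [← hs]; positivity
    rw [norm_smul, hc]
    simp only
    rw [hs, norm_inv, norm_norm, inv_mul_cancel₀ hpos.ne']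

theorem tangentMap_apply (hd : 2 ≤ d) {f : ℝ → ℝ} {lam κ : ℝ}
    (hf : IsContractingLaw f) (hr : RateBounds f lam κ) {x ξ : Phase d}
    (hx : x ∈ forwardSet f P) (hξ : ξ ∈ tangentSpaceAt P x) (n : ℕ) :
    tangentMap f P n x ξ = iterDeriv f P n x ξ := by
  exact (hP.isVelocity hd hx.1 hξ).fderivWithin_apply (hP.hasFDerivWithinAt_iterate hd hf hr hx n).1

end IsPolytope

/-! ### Families of facets -/

/-- Used to make constants that depend on a set of facets uniform over the finitely many such sets.
-/
theorem exists_uniform_pos {α : Type*} (s : Finset α) (Q : α → ℝ → Prop)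
    (mono : ∀ a δ δ', Q a δ → 0 < δ' → δ' ≤ δ → Q a δ') (h : ∀ a ∈ s, ∃ δ > 0, Q a δ) :
    ∃ δ > 0, ∀ a ∈ s, Q a δ := by
  classical
  induction s using Finset.induction_on with
  | empty => exact ⟨1, one_pos, by simp⟩
  | insert a s _ ih =>
    obtain ⟨δ₁, h₁, hQ₁⟩ := h a (Finset.mem_insert_self _ _)
    obtain ⟨δ₂, h₂, hQ₂⟩ := ih fun b hb => h b (Finset.mem_insert_of_mem hb)
    have hpos := lt_min h₁ h₂
    refine ⟨min δ₁ δ₂, hpos, fun b hb => ?_⟩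
    rcases Finset.mem_insert.1 hb with rfl | hb
    · exact mono _ _ _ hQ₁ hpos (min_le_left _ _)
    · exact mono _ _ _ (hQ₂ b hb) hpos (min_le_right _ _)

/-- The facets with normals in `S` have a common point. -/
def HasCommonPoint (P : Set (Space d)) (S : Finset (Space d)) : Prop :=
  ∃ x ∈ P, ∀ η ∈ S, ⟪η, x⟫_ℝ = offset P η

/-- The sum of the `|⟪w, η⟫|` vanishes only at `w = 0` because `S` spans, so it is bounded below on
the unit sphere, and one summand carries its share. -/
theorem exists_coercive {S : Finset (Space d)} (hS : Submodule.span ℝ (S : Set (Space d)) = ⊤) :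
    ∃ ε > 0, ∀ w : Space d, w ≠ 0 → ∃ η ∈ S, ε * ‖w‖ ≤ |⟪w, η⟫_ℝ| := by
  set g : Space d → ℝ := fun w => ∑ η ∈ S, |⟪w, η⟫_ℝ| with hg
  have hgc : Continuous g := by fun_prop
  have hpos : ∀ w, w ≠ 0 → 0 < g w := by
    intro w hw
    refine lt_of_le_of_ne (Finset.sum_nonneg fun _ _ => abs_nonneg _) fun h0 => hw ?_
    have h1 := (Finset.sum_eq_zero_iff_of_nonneg fun _ _ => abs_nonneg _).1 h0.symm
    have h2 : (w : Space d) ∈ (Submodule.span ℝ (S : Set (Space d)))ᗮ := by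
      rw [Submodule.mem_orthogonal']
      intro u hu
      induction hu using Submodule.span_induction with
      | mem u hu => exact abs_eq_zero.1 (h1 u hu)
      | zero => simp
      | add u v _ _ hu hv => rw [inner_add_right, hu, hv, add_zero]
      | smul c u _ hu => rw [real_inner_smul_right, hu, mul_zero]
    rwa [hS, Submodule.top_orthogonal_eq_bot, Submodule.mem_bot] at h2
  obtain ⟨m, hm, hmle⟩ : ∃ m > 0, ∀ w ∈ Metric.sphere (0 : Space d) 1, m ≤ g w := by
    rcases (Metric.sphere (0 : Space d) 1).eq_empty_or_nonempty with he | hne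
    · exact ⟨1, one_pos, by simp [he]⟩
    · obtain ⟨w, hw, hmin⟩ := (isCompact_sphere (0 : Space d) 1).exists_isMinOn hne hgc.continuousOn
      refine ⟨g w, hpos w fun h0 => ?_, hmin⟩
      simp [h0] at hw
  -- Dividing by `S.card + 1` makes the sum of all shares strictly smaller than the minimum and
  -- covers the empty set.
  refine ⟨m / (S.card + 1), by positivity, fun w hw => ?_⟩
  by_contra hcon
  push Not at hcon
  have hwn : 0 < ‖w‖ := norm_pos_iff.2 hw
  have h1 := hmle (‖w‖⁻¹ • w) (by simp [norm_smul, hwn.ne'])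
  have h2 : g (‖w‖⁻¹ • w) = ‖w‖⁻¹ * g w := by
    simp only [hg, real_inner_smul_left, abs_mul, Finset.mul_sum, abs_inv, abs_norm]
  have h3 : g w ≤ S.card • (m / (S.card + 1) * ‖w‖) :=
    Finset.sum_le_card_nsmul _ _ _ fun η hη => (hcon η hη).le
  rw [h2, le_inv_mul_iff₀ hwn] at h1
  rw [nsmul_eq_mul] at h3
  have h4 : (S.card : ℝ) * (m / (S.card + 1) * ‖w‖) < ‖w‖ * m := by
    have : (0 : ℝ) < S.card + 1 := by positivity
    rw [div_mul_eq_mul_div, mul_div_assoc', div_lt_iff₀ this]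
    nlinarith [mul_pos hm hwn]
  linarith

namespace IsPolytope

variable {P : Set (Space d)} (hP : IsPolytope P)
include hP

/-- Compactness again: the sum of the slacks is positive everywhere on `P`, so it has a positive
minimum. -/
theorem exists_gap (S : Finset (Space d)) (hS : ¬HasCommonPoint P S) :
    ∃ δ > 0, ∀ x ∈ P, ∃ η ∈ S, δ ≤ ⟪η, x⟫_ℝ - offset P η := by
  set g : Space d → ℝ := fun x => ∑ η ∈ S, (⟪η, x⟫_ℝ - offset P η) with hg
  have hgc : Continuous g := by fun_prop
  obtain ⟨x₀, hx₀, hmin⟩ := hP.isCompact.exists_isMinOn hP.nonempty hgc.continuousOn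
  have hnn : ∀ x ∈ P, ∀ η ∈ S, 0 ≤ ⟪η, x⟫_ℝ - offset P η := fun x hx η _ =>
    sub_nonneg.2 (hP.offset_le hx)
  have hpos : 0 < g x₀ := by
    refine lt_of_le_of_ne (Finset.sum_nonneg (hnn x₀ hx₀)) fun h0 => hS ⟨x₀, hx₀, fun η hη => ?_⟩
    have := (Finset.sum_eq_zero_iff_of_nonneg (hnn x₀ hx₀)).1 h0.symm η hη
    linarith
  refine ⟨g x₀ / (S.card + 1), by positivity, fun x hx => ?_⟩
  by_contra hcon
  push Not at hcon
  have h1 : g x₀ ≤ g x := hmin hx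
  have h3 : g x ≤ S.card • (g x₀ / (S.card + 1)) :=
    Finset.sum_le_card_nsmul _ _ _ fun η hη => (hcon η hη).le
  rw [nsmul_eq_mul] at h3
  have h4 : (S.card : ℝ) * (g x₀ / (S.card + 1)) < g x₀ := by
    have : (0 : ℝ) < S.card + 1 := by positivity
    rw [mul_div_assoc', div_lt_iff₀ this]
    nlinarith
  linarith

/-- Facets with a common point share a vertex. -/
theorem exists_vertex {S : Finset (Space d)} (hS : HasCommonPoint P S) :
    ∃ x ∈ vertices P, ∀ η ∈ S, x ∈ face P η := by
  set F := {x | x ∈ P ∧ ∀ η ∈ S, ⟪η, x⟫_ℝ = offset P η} with hF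
  have hFc : IsCompact F := by
    have : F = P ∩ ⋂ η ∈ S, {x | ⟪η, x⟫_ℝ = offset P η} := by ext; simp [hF]
    rw [this]
    refine hP.isCompact.inter_right (isClosed_biInter fun η _ => ?_)
    exact isClosed_eq (by fun_prop) continuous_const
  obtain ⟨x, hx, hxS⟩ := hS
  obtain ⟨z, hz⟩ := hFc.extremePoints_nonempty ⟨x, hx, hxS⟩
  have hext : IsExtreme ℝ P F := by
    refine ⟨fun x hx => hx.1, ?_⟩
    rintro x hx y hy z hz ⟨a, b, ha, hb, hab, rfl⟩
    refine ⟨hx, fun η hη => ?_⟩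
    have h1 := hz.2 η hη
    rw [inner_add_right, real_inner_smul_right, real_inner_smul_right] at h1
    have h2 := hP.offset_le hx (η := η)
    have h3 := hP.offset_le hy (η := η)
    have h4 : a * (⟪η, x⟫_ℝ - offset P η) + b * (⟪η, y⟫_ℝ - offset P η) = 0 := by
      linear_combination h1 - offset P η * hab
    nlinarith [mul_nonneg ha.le (sub_nonneg.2 h2), mul_nonneg hb.le (sub_nonneg.2 h3)]
  refine ⟨z, hext.extremePoints_subset_extremePoints hz, fun η hη => ?_⟩
  have hzF := extremePoints_subset hz
  exact hP.mem_face_iff.2 ⟨hzF.1, hzF.2 η hη⟩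

omit hP in
/-- The normals at a vertex make equal angles, less than `π / 4`, with the barycentric direction. -/
theorem exists_direction (hobt : IsObtuse P) {x : Space d} (hx : x ∈ vertices P) :
    ∃ (e : Space d) (a : ℝ), ‖e‖ = 1 ∧ √2 / 2 < a ∧ ∀ η ∈ normalsAt P x, ⟪e, η⟫_ℝ = a := by
  have hang := hobt x hx
  rw [barycentricAngle] at hang
  set A := affineSpan ℝ (normalsAt P x) with hA
  have hlt : √2 / 2 < Metric.infDist 0 (A : Set (Space d)) := by
    by_contra hle
    push Not at hle
    have h1 := Real.monotone_arcsin hle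
    rw [← Real.sin_pi_div_four, Real.arcsin_sin (by linarith [Real.pi_pos])
      (by linarith [Real.pi_pos])] at h1
    linarith
  have hs2 : 0 < √2 / 2 := by positivity
  have hne : (A : Set (Space d)).Nonempty := by
    rw [Set.nonempty_iff_ne_empty]
    intro h0
    rw [h0, Metric.infDist_empty] at hlt
    linarith
  obtain ⟨z, hz, hdist⟩ := (AffineSubspace.closed_of_finiteDimensional A).exists_infDist_eq_dist
    hne 0
  rw [dist_zero_left] at hdist
  -- The point `z` nearest to the origin is orthogonal to the affine span, so all normals have the
  -- same product with it; `z / ‖z‖` is the barycentric direction and `‖z‖` the sine of the angle.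
  have hort : ∀ y ∈ A, ⟪z, y⟫_ℝ = ‖z‖ ^ 2 := by
    intro y hy
    set u := y - z with hu
    have hmin : ∀ t : ℝ, ‖z‖ ^ 2 ≤ ‖z + t • u‖ ^ 2 := by
      intro t
      have hmem : z + t • u ∈ A := by
        have := AffineMap.lineMap_mem t hz hy
        rwa [AffineMap.lineMap_apply, vsub_eq_sub, vadd_eq_add, add_comm] at this
      have h1 := Metric.infDist_le_dist_of_mem (x := (0 : Space d)) hmem
      rw [hdist, dist_zero_left] at h1
      exact pow_le_pow_left₀ (norm_nonneg _) h1 2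
    have hu0 : ⟪z, u⟫_ℝ = 0 := by
      by_cases hu' : u = 0
      · rw [hu', inner_zero_right]
      · have hun : 0 < ‖u‖ ^ 2 := by positivity
        have h1 := hmin (-⟪z, u⟫_ℝ / ‖u‖ ^ 2)
        rw [norm_add_sq_real, real_inner_smul_right, norm_smul, mul_pow, Real.norm_eq_abs,
          sq_abs] at h1
        have h2 : 2 * (-⟪z, u⟫_ℝ / ‖u‖ ^ 2 * ⟪z, u⟫_ℝ) + (-⟪z, u⟫_ℝ / ‖u‖ ^ 2) ^ 2 * ‖u‖ ^ 2 =
            -(⟪z, u⟫_ℝ ^ 2 / ‖u‖ ^ 2) := by field_simp; ring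
        have h3 : ⟪z, u⟫_ℝ ^ 2 / ‖u‖ ^ 2 ≤ 0 := by linarith
        rw [div_le_iff₀ hun, zero_mul] at h3
        nlinarith
    have : y = z + u := by rw [hu]; abel
    rw [this, inner_add_right, hu0, real_inner_self_eq_norm_sq, add_zero]
  have hzn : 0 < ‖z‖ := by rw [← hdist]; linarith
  refine ⟨‖z‖⁻¹ • z, ‖z‖, ?_, by rw [← hdist]; exact hlt, fun η hη => ?_⟩
  · rw [norm_smul, norm_inv, norm_norm, inv_mul_cancel₀ hzn.ne']
  · rw [real_inner_smul_left, hort η (subset_affineSpan ℝ _ hη)]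
    field_simp

/-- Facets with a common point share a vertex, and the barycentric direction of that vertex serves
them all. -/
theorem exists_gain (hobt : IsObtuse P) {f : ℝ → ℝ} {lam κ : ℝ} (hf : IsContractingLaw f)
    (hr : RateBounds f lam κ) {S : Finset (Space d)} (hS : HasCommonPoint P S)
    (hSf : ∀ η ∈ S, IsFacetNormal P η) :
    ∃ γ > 0, ∃ e : Space d, ‖e‖ = 1 ∧ ∀ η ∈ S, ∀ v, Incoming η v →
      ⟪v, e⟫_ℝ + γ ≤ ⟪outVel f η v, e⟫_ℝ := by
  obtain ⟨x, hx, hxS⟩ := hP.exists_vertex hS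
  obtain ⟨e, a, he, ha, hea⟩ := exists_direction hobt hx
  have h2 : (√2) ^ 2 = 2 := Real.sq_sqrt (by norm_num)
  have hs2 : 0 ≤ √2 := Real.sqrt_nonneg 2
  have hb : √(1 - a ^ 2) < a := by
    rw [Real.sqrt_lt' (by linarith)]; nlinarith
  exact ⟨κ * (a - √(1 - a ^ 2)), mul_pos hr.κ_pos (by linarith), e, he, fun η hη v hv =>
    hv.inner_outVel_ge hf hr he (hea η ⟨hSf η hη, hxS η hη⟩) ha⟩

/-- Facets whose normals do not generate the space have hyperplanes with a common point. -/
theorem exists_common_point (hd : 2 ≤ d) (hgen : InGeneralPosition P) {S : Finset (Space d)}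
    (hSf : ∀ η ∈ S, IsFacetNormal P η) (hS : Submodule.span ℝ (S : Set (Space d)) ≠ ⊤) :
    ∃ x : Space d, ∀ η ∈ S, ⟪η, x⟫_ℝ = offset P η := by
  have hcard : S.card ≤ d := by
    by_contra hlt
    push Not at hlt
    obtain ⟨T, hTS, hT⟩ := Finset.exists_subset_card_eq hlt.le
    have hli : LinearIndependent ℝ (fun x : (T : Set (Space d)) => id (x : Space d)) :=
      hgen.linearIndepOn_facets T hT fun η hη => hSf η (hTS hη)
    have htop := hli.span_eq_top_of_card_eq_finrank' (by simp [hT])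
    apply hS
    rw [eq_top_iff, ← htop]
    refine Submodule.span_mono ?_
    rintro _ ⟨x, rfl⟩
    exact hTS x.2
  set N := (hP.finite_facetNormals hd).toFinset with hN
  have hmemN : ∀ η, η ∈ N ↔ IsFacetNormal P η := fun η => by simp [hN]
  have hNd : d ≤ N.card := by
    have h1 := finrank_span_le_card (R := ℝ) (N : Set (Space d))
    have h2 : (N : Set (Space d)) = {η | IsFacetNormal P η} := by ext η; exact hmemN η
    have h3 : Module.finrank ℝ (Submodule.span ℝ (N : Set (Space d))) = d := by
      rw [h2, hP.span_facetNormals, finrank_top, finrank_euclideanSpace_fin]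
    rw [h3] at h1
    simpa using h1
  -- `S` is completed to `d` facets. Their normals form a basis, so a linear functional with the
  -- offsets as values exists, and it is the product with the wanted point.
  obtain ⟨T, hST, hTN, hT⟩ := Finset.exists_subsuperset_card_eq
    (fun η hη => (hmemN η).2 (hSf η hη) : S ⊆ N) hcard hNd
  have hli : LinearIndependent ℝ (fun x : (T : Set (Space d)) => id (x : Space d)) :=
    hgen.linearIndepOn_facets T hT fun η hη => (hmemN η).1 (hTN hη)
  have hTne : T.Nonempty := by rw [← Finset.card_pos]; omega
  have : Nonempty (T : Set (Space d)) := hTne.to_subtype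
  set b := basisOfLinearIndependentOfCardEqFinrank hli (by simp [hT]) with hb
  set φ : Space d →ₗ[ℝ] ℝ := b.constr ℝ (fun x => offset P (x : Space d)) with hφ
  refine ⟨(InnerProductSpace.toDual ℝ (Space d)).symm φ.toContinuousLinearMap, fun η hη => ?_⟩
  rw [real_inner_comm, InnerProductSpace.toDual_symm_apply]
  have h1 : b ⟨η, hST hη⟩ = η := by
    rw [hb, coe_basisOfLinearIndependentOfCardEqFinrank]; rfl
  have h2 : φ (b ⟨η, hST hη⟩) = offset P η := by
    rw [hφ, Module.Basis.constr_basis]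
  rw [h1] at h2
  exact h2

end IsPolytope

/-! ### Orbits -/

/-- Positions, velocities and normals along a forward orbit. -/
structure IsOrbit (f : ℝ → ℝ) (P : Set (Space d)) (p v η : ℕ → Space d) : Prop where
  isFacetNormal : ∀ n, IsFacetNormal P (η n)
  mem : ∀ n, p n ∈ P
  inner_eq : ∀ n, ⟪η n, p n⟫_ℝ = offset P (η n)
  incoming : ∀ n, Incoming (η (n + 1)) (v n)
  vel : ∀ n, v (n + 1) = outVel f (η (n + 1)) (v n)
  pos : ∀ n, ∃ t : ℝ, p (n + 1) = p n + t • v n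

/-- The evolution of transverse position vectors between the collisions `0` and `k`. -/
structure IsTransverse (v η w : ℕ → Space d) (k : ℕ) : Prop where
  inner_eq : ∀ n ≤ k, ⟪v n, w n⟫_ℝ = 0
  step : ∀ n < k, w (n + 1) = perp (v (n + 1)) (oblique (η (n + 1)) (v n) (w n))

/-- The displacement along `v n` produced by `w n` at the next collision. -/
def shift (v η w : ℕ → Space d) (n : ℕ) : ℝ := ⟪w n, η (n + 1)⟫_ℝ / ⟪v n, η (n + 1)⟫_ℝ

section Orbit

variable {f : ℝ → ℝ} {P : Set (Space d)} {p v η : ℕ → Space d} {lam κ : ℝ}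

theorem IsOrbit.add (ho : IsOrbit f P p v η) (m : ℕ) :
    IsOrbit f P (fun n => p (m + n)) (fun n => v (m + n)) (fun n => η (m + n)) :=
  ⟨fun _ => ho.isFacetNormal _, fun _ => ho.mem _, fun _ => ho.inner_eq _, fun _ => ho.incoming _,
    fun _ => ho.vel _, fun _ => ho.pos _⟩

theorem IsTransverse.add {w : ℕ → Space d} {k : ℕ} (m : ℕ) (hw : IsTransverse v η w (m + k)) :
    IsTransverse (fun n => v (m + n)) (fun n => η (m + n)) (fun n => w (m + n)) k :=
  ⟨fun n hn => hw.inner_eq _ (by omega), fun n hn => hw.step (m + n) (by omega)⟩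

theorem IsTransverse.mono {w : ℕ → Space d} {k l : ℕ} (hw : IsTransverse v η w k) (h : l ≤ k) :
    IsTransverse v η w l :=
  ⟨fun n hn => hw.inner_eq n (hn.trans h), fun n hn => hw.step n (hn.trans_le h)⟩

variable {w : ℕ → Space d} {k : ℕ}

theorem IsTransverse.norm_sq_succ (hf : IsContractingLaw f) (hr : RateBounds f lam κ)
    (ho : IsOrbit f P p v η) (hw : IsTransverse v η w k) {n : ℕ} (hn : n < k) :
    ‖w n‖ ^ 2 + (1 - lam ^ 2) * shift v η w n ^ 2 ≤ ‖w (n + 1)‖ ^ 2 ∧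
      ‖w (n + 1) - w n‖ ≤ 2 * |shift v η w n| := by
  have hi := ho.incoming n
  have h := hi.norm_step_sq hf (hw.inner_eq n hn.le)
  rw [← ho.vel n, ← hw.step n hn] at h
  have hrat := hr.abs_ratio_le hi.incidence_mem
  have hsq : ratio f (incidence (η (n + 1)) (v n)) ^ 2 ≤ lam ^ 2 :=
    sq_le_sq' (by linarith [neg_le_of_abs_le hrat]) ((le_abs_self _).trans hrat)
  constructor
  · rw [h.1, shift]
    nlinarith [sq_nonneg (⟪w n, η (n + 1)⟫_ℝ / ⟪v n, η (n + 1)⟫_ℝ)]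
  · refine h.2.trans (mul_le_mul_of_nonneg_right ?_ (abs_nonneg _))
    linarith [hr.lam_lt_one]

theorem RateBounds.one_sub_sq_pos (hr : RateBounds f lam κ) : 0 < 1 - lam ^ 2 := by
  nlinarith [hr.lam_pos, hr.lam_lt_one]

theorem IsTransverse.norm_sq_mono (hf : IsContractingLaw f) (hr : RateBounds f lam κ)
    (ho : IsOrbit f P p v η) (hw : IsTransverse v η w k) {m n : ℕ} (hmn : m ≤ n) (hn : n ≤ k) :
    ‖w m‖ ^ 2 ≤ ‖w n‖ ^ 2 := by
  induction n, hmn using Nat.le_induction with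
  | base => exact le_rfl
  | succ n hmn ih =>
    have h1 := (hw.norm_sq_succ hf hr ho (n := n) (by omega)).1
    have h2 := mul_nonneg hr.one_sub_sq_pos.le (sq_nonneg (shift v η w n))
    linarith [ih (by omega)]

theorem IsTransverse.norm_mono (hf : IsContractingLaw f) (hr : RateBounds f lam κ)
    (ho : IsOrbit f P p v η) (hw : IsTransverse v η w k) {m n : ℕ} (hmn : m ≤ n) (hn : n ≤ k) :
    ‖w m‖ ≤ ‖w n‖ :=
  (sq_le_sq₀ (norm_nonneg _) (norm_nonneg _)).1 (hw.norm_sq_mono hf hr ho hmn hn)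

theorem IsTransverse.norm_sq_add_le (hf : IsContractingLaw f) (hr : RateBounds f lam κ)
    (ho : IsOrbit f P p v η) (hw : IsTransverse v η w k) {ε : ℝ} (hε : 0 ≤ ε) {j : ℕ} (hj : j < k)
    (hs : ε < |shift v η w j|) : ‖w 0‖ ^ 2 + (1 - lam ^ 2) * ε ^ 2 ≤ ‖w k‖ ^ 2 := by
  have h1 := hw.norm_sq_mono hf hr ho (Nat.zero_le j) hj.le
  have h2 := (hw.norm_sq_succ hf hr ho hj).1
  have h3 := hw.norm_sq_mono hf hr ho (show j + 1 ≤ k from hj) le_rfl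
  have h4 : ε ^ 2 ≤ shift v η w j ^ 2 := by
    rw [← sq_abs (shift v η w j)]; exact pow_le_pow_left₀ hε hs.le 2
  have h5 := mul_le_mul_of_nonneg_left h4 hr.one_sub_sq_pos.le
  linarith

/-- If all displacements are small, `w` is almost orthogonal to all the normals. -/
theorem IsTransverse.abs_inner_le (hf : IsContractingLaw f) (hr : RateBounds f lam κ)
    (ho : IsOrbit f P p v η) (hw : IsTransverse v η w k) {ε : ℝ}
    (hs : ∀ j < k, |shift v η w j| ≤ ε) {j : ℕ} (hj : j < k) :
    |⟪w 0, η (j + 1)⟫_ℝ| ≤ (2 * k + 1) * ε := by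
  have hε : 0 ≤ ε := (abs_nonneg _).trans (hs j hj)
  -- Each step moves `w` by at most `2 ε`, and `⟪w j, η (j + 1)⟫` is the shift times a number in
  -- `[-1, 0)`; together this gives `2 k ε + ε`.
  have hdist : ∀ n ≤ k, ‖w 0 - w n‖ ≤ n * (2 * ε) := by
    intro n hn
    induction n with
    | zero => simp
    | succ n ih =>
      have h1 := (hw.norm_sq_succ hf hr ho (n := n) (by omega)).2
      have h2 := hs n (by omega)
      have h3 : ‖w 0 - w (n + 1)‖ ≤ ‖w 0 - w n‖ + ‖w (n + 1) - w n‖ := by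
        rw [← norm_neg (w (n + 1) - w n), neg_sub]
        exact norm_sub_le_norm_sub_add_norm_sub _ _ _
      push_cast
      linarith [ih (by omega)]
  have hi := ho.incoming j
  have h1 : |⟪w j, η (j + 1)⟫_ℝ| ≤ ε := by
    have : ⟪w j, η (j + 1)⟫_ℝ = shift v η w j * ⟪v j, η (j + 1)⟫_ℝ := by
      rw [shift, div_mul_cancel₀ _ hi.inner_neg.ne]
    rw [this, abs_mul]
    have h2 : |⟪v j, η (j + 1)⟫_ℝ| ≤ 1 := by
      rw [abs_le]; exact ⟨hi.neg_one_le, by linarith [hi.inner_neg]⟩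
    calc _ ≤ |shift v η w j| * 1 := mul_le_mul_of_nonneg_left h2 (abs_nonneg _)
      _ ≤ ε := by rw [mul_one]; exact hs j hj
  have h2 : |⟪w 0 - w j, η (j + 1)⟫_ℝ| ≤ k * (2 * ε) := by
    refine (abs_real_inner_le_norm _ _).trans ?_
    rw [hi.norm_normal, mul_one]
    refine (hdist j hj.le).trans (mul_le_mul_of_nonneg_right ?_ (by linarith))
    exact_mod_cast hj.le
  have h3 : ⟪w 0, η (j + 1)⟫_ℝ = ⟪w 0 - w j, η (j + 1)⟫_ℝ + ⟪w j, η (j + 1)⟫_ℝ := by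
    rw [inner_sub_left]; ring
  rw [h3]
  refine (abs_add_le _ _).trans ?_
  linarith

/-- Orbits reflected at facets with a common point leave after a bounded number of collisions. -/
theorem IsOrbit.not_gain (ho : IsOrbit f P p v η) {S : Finset (Space d)} {γ : ℝ} {e : Space d}
    (he : ‖e‖ = 1) (hgain : ∀ ζ ∈ S, ∀ v, Incoming ζ v → ⟪v, e⟫_ℝ + γ ≤ ⟪outVel f ζ v, e⟫_ℝ)
    {l : ℕ} (hl : 2 < l * γ) : ¬∀ j < l, η (j + 1) ∈ S := by
  intro hS
  have h : ∀ n ≤ l, ⟪v 0, e⟫_ℝ + n * γ ≤ ⟪v n, e⟫_ℝ := by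
    intro n hn
    induction n with
    | zero => simp
    | succ n ih =>
      have h1 := hgain _ (hS n (by omega)) _ (ho.incoming n)
      rw [← ho.vel n] at h1
      push_cast
      linarith [ih (by omega)]
  have hb : ∀ n, |⟪v n, e⟫_ℝ| ≤ 1 := fun n => by
    have := abs_real_inner_le_norm (v n) e
    rwa [he, (ho.incoming n).norm_vel, one_mul] at this
  have h1 := h l le_rfl
  have h2 := neg_le_of_abs_le (hb 0)
  have h3 := (le_abs_self _).trans (hb l)
  linarith

/-- The transverse part of the position relative to a point on the hyperplanes of all facets that
are hit. -/
theorem IsOrbit.isTransverse_sub (ho : IsOrbit f P p v η) {x : Space d}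
    (hx : ∀ j < k, ⟪η (j + 1), x⟫_ℝ = offset P (η (j + 1))) :
    IsTransverse v η (fun n => perp (v n) (p n - x)) k ∧
    ∀ n < k, p (n + 1) - x =
      perp (v n) (p n - x) - shift v η (fun n => perp (v n) (p n - x)) n • v n := by
  -- Both `p (n + 1)` and `x` lie on the hyperplane that is hit, so moving along `v n` amounts to
  -- projecting the relative position along `v n`.
  have key : ∀ n < k, p (n + 1) - x =
      oblique (η (n + 1)) (v n) (perp (v n) (p n - x)) := by
    intro n hn
    obtain ⟨t, ht⟩ := ho.pos n
    have hne := (ho.incoming n).inner_neg.ne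
    have h0 : ⟪p (n + 1) - x, η (n + 1)⟫_ℝ = 0 := by
      rw [real_inner_comm, inner_sub_right, ho.inner_eq, hx n hn, sub_self]
    have h1 : oblique (η (n + 1)) (v n) (perp (v n) (p n - x)) =
        oblique (η (n + 1)) (v n) (p n - x) := by
      rw [perp_apply, map_sub _ (p n - x), map_smul, oblique_self hne, smul_zero, sub_zero]
    have h2 : p (n + 1) - x = (p n - x) + t • v n := by rw [ht]; abel
    rw [h1, ← oblique_of_inner_eq_zero (v := v n) h0, h2, map_add, map_smul, oblique_self hne,
      smul_zero, add_zero]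
  refine ⟨⟨fun n _ => inner_perp (ho.incoming n).norm_vel _, fun n hn => ?_⟩, fun n hn => ?_⟩
  · rw [← key n hn]
  · rw [key n hn, oblique_apply]; rfl

end Orbit

/-! ### Spanning normals and uniform expansion -/

namespace IsPolytope

variable {P : Set (Space d)} (hP : IsPolytope P)
include hP

/-- The normals of sufficiently many consecutive collisions generate the space. -/
theorem exists_generating (hd : 2 ≤ d) (hgen : InGeneralPosition P) (hobt : IsObtuse P)
    {f : ℝ → ℝ} {lam κ : ℝ} (hf : IsContractingLaw f) (hr : RateBounds f lam κ) :
    ∃ k > 0, ∀ p v η : ℕ → Space d, IsOrbit f P p v η →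
      Submodule.span ℝ ((fun j => η (j + 1)) '' Set.Iio k) = ⊤ := by
  classical
  set N := (hP.finite_facetNormals hd).toFinset with hN
  have hmemN : ∀ η, η ∈ N ↔ IsFacetNormal P η := fun η => by simp [hN]
  have hsub : ∀ S ∈ N.powerset, ∀ η ∈ S, IsFacetNormal P η := fun S hS η hη =>
    (hmemN η).1 (Finset.mem_powerset.1 hS hη)
  obtain ⟨γ, hγ, hQγ⟩ := exists_uniform_pos N.powerset
    (fun S γ => HasCommonPoint P S → ∃ e : Space d, ‖e‖ = 1 ∧ ∀ η ∈ S, ∀ v, Incoming η v →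
      ⟪v, e⟫_ℝ + γ ≤ ⟪outVel f η v, e⟫_ℝ)
    (fun S δ δ' h _ hle hS => by
      obtain ⟨e, he, hg⟩ := h hS
      exact ⟨e, he, fun η hη v hv => by linarith [hg η hη v hv]⟩)
    (fun S hS => by
      by_cases hc : HasCommonPoint P S
      · obtain ⟨γ, hγ, h⟩ := hP.exists_gain hobt hf hr hc (hsub S hS)
        exact ⟨γ, hγ, fun _ => h⟩
      · exact ⟨1, one_pos, fun h => absurd h hc⟩)
  obtain ⟨δ, hδ, hQδ⟩ := exists_uniform_pos N.powerset
    (fun S δ => ¬HasCommonPoint P S → ∀ x ∈ P, ∃ η ∈ S, δ ≤ ⟪η, x⟫_ℝ - offset P η)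
    (fun S δ δ' h _ hle hS x hx => by
      obtain ⟨η, hη, hg⟩ := h hS x hx
      exact ⟨η, hη, hle.trans hg⟩)
    (fun S _ => by
      by_cases hc : HasCommonPoint P S
      · exact ⟨1, one_pos, fun h => absurd hc h⟩
      · obtain ⟨δ, hδ, h⟩ := hP.exists_gap S hc
        exact ⟨δ, hδ, fun _ => h⟩)
  -- Here `ρ⁻¹` bounds the distance from the points of `P` to the common point `x` of the
  -- hyperplanes.
  obtain ⟨ρ, hρ, hQρ⟩ := exists_uniform_pos N.powerset
    (fun S ρ => Submodule.span ℝ (S : Set (Space d)) ≠ ⊤ →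
      ∃ x : Space d, (∀ η ∈ S, ⟪η, x⟫_ℝ = offset P η) ∧ ∀ y ∈ P, ρ * ‖y - x‖ ≤ 1)
    (fun S δ δ' h _ hle hS => by
      obtain ⟨x, hx, hy⟩ := h hS
      refine ⟨x, hx, fun y hyP => le_trans ?_ (hy y hyP)⟩
      exact mul_le_mul_of_nonneg_right hle (norm_nonneg _))
    (fun S hS => by
      by_cases hc : Submodule.span ℝ (S : Set (Space d)) = ⊤
      · exact ⟨1, one_pos, fun h => absurd hc h⟩
      · obtain ⟨x, hx⟩ := hP.exists_common_point hd hgen (hsub S hS) hc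
        obtain ⟨R, hR⟩ := hP.isCompact.isBounded.subset_closedBall x
        have hm : (0 : ℝ) < max R 1 := lt_max_of_lt_right one_pos
        refine ⟨(max R 1)⁻¹, by positivity, fun _ => ⟨x, hx, fun y hy => ?_⟩⟩
        have := hR hy
        rw [Metric.mem_closedBall, dist_eq_norm] at this
        rw [inv_mul_le_iff₀ hm, mul_one]
        exact this.trans (le_max_left _ _))
  -- The window length: `⟪v, e⟫` varies by at most 2, so `l` successive gains `γ` are impossible.
  obtain ⟨l, hl⟩ : ∃ l : ℕ, 2 < l * γ := by
    obtain ⟨l, hl⟩ := exists_nat_gt (2 / γ)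
    exact ⟨l, by rwa [div_lt_iff₀ hγ] at hl⟩
  have hl0 : 0 < l := by
    rcases Nat.eq_zero_or_pos l with rfl | h
    · norm_num at hl
    · exact h
  -- If all shifts in the window are at most `ε`, the slack of each of its facets at `p (m + 1)` is
  -- at most `(2 l + 1) ε + ε < δ`, against the gap.
  set ε := δ / (2 * l + 3) with hε
  have hε0 : 0 < ε := by positivity
  set c := (1 - lam ^ 2) * ε ^ 2 with hc
  have hc0 : 0 < c := mul_pos hr.one_sub_sq_pos (by positivity)
  -- Each window adds `c` to the squared norm, so `q` windows exceed the bound `ρ⁻²`.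
  obtain ⟨q, hq⟩ : ∃ q : ℕ, (ρ⁻¹) ^ 2 < q * c := by
    obtain ⟨q, hq⟩ := exists_nat_gt ((ρ⁻¹) ^ 2 / c)
    exact ⟨q, by rwa [div_lt_iff₀ hc0] at hq⟩
  have hq0 : 0 < q := by
    rcases Nat.eq_zero_or_pos q with rfl | h
    · have : 0 < (ρ⁻¹) ^ 2 := by positivity
      rw [Nat.cast_zero, zero_mul] at hq
      linarith
    · exact h
  refine ⟨q * l, Nat.mul_pos hq0 hl0, fun p v η ho => ?_⟩
  by_contra hspan
  set S := (Finset.range (q * l)).image (fun j => η (j + 1)) with hS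
  have hSN : S ∈ N.powerset := by
    rw [Finset.mem_powerset]
    intro ζ hζ
    obtain ⟨j, -, rfl⟩ := Finset.mem_image.1 hζ
    exact (hmemN _).2 (ho.isFacetNormal _)
  obtain ⟨x, hx, hxR⟩ := hQρ S hSN (by
    rwa [hS, Finset.coe_image, Finset.coe_range])
  obtain ⟨hw, hpos⟩ := ho.isTransverse_sub (k := q * l) (x := x) fun j hj =>
    hx _ (Finset.mem_image.2 ⟨j, Finset.mem_range.2 hj, rfl⟩)
  set w := fun n => perp (v n) (p n - x) with hwdef
  have hwin : ∀ m, m + l ≤ q * l → ‖w m‖ ^ 2 + c ≤ ‖w (m + l)‖ ^ 2 := by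
    intro m hm
    have hw' := (hw.mono hm).add m
    have ho' := ho.add m
    obtain ⟨j, hj, hjs⟩ : ∃ j < l, ε < |shift (fun n => v (m + n)) (fun n => η (m + n))
        (fun n => w (m + n)) j| := by
      by_contra hcon
      push Not at hcon
      set S' := (Finset.range l).image (fun j => η (m + (j + 1))) with hS'
      have hS'N : S' ∈ N.powerset := by
        rw [Finset.mem_powerset]
        intro ζ hζ
        obtain ⟨j, -, rfl⟩ := Finset.mem_image.1 hζ
        exact (hmemN _).2 (ho.isFacetNormal _)
      have hncp : ¬HasCommonPoint P S' := by
        intro hcp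
        obtain ⟨e, he, hg⟩ := hQγ S' hS'N hcp
        exact ho'.not_gain he hg hl fun j hj =>
          Finset.mem_image.2 ⟨j, Finset.mem_range.2 hj, rfl⟩
      obtain ⟨ζ, hζ, hge⟩ := hQδ S' hS'N hncp (p (m + 1)) (ho.mem _)
      obtain ⟨j, hj, rfl⟩ := Finset.mem_image.1 hζ
      rw [Finset.mem_range] at hj
      have h1 := hw'.abs_inner_le hf hr ho' hcon hj
      simp only [add_zero] at h1
      have h2 := hcon 0 hl0
      have h3 : ⟪η (m + (j + 1)), x⟫_ℝ = offset P (η (m + (j + 1))) :=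
        hx _ (Finset.mem_image.2 ⟨m + j, Finset.mem_range.2 (by omega), rfl⟩)
      have h4 := hpos m (by omega)
      rw [← h3, ← inner_sub_right, h4, inner_sub_right, real_inner_smul_right] at hge
      have h5 : |⟪η (m + (j + 1)), v m⟫_ℝ| ≤ 1 := by
        have := abs_real_inner_le_norm (η (m + (j + 1))) (v m)
        rwa [(ho.incoming m).norm_vel, (ho.isFacetNormal _).1, one_mul] at this
      have h6 : |shift v η w m * ⟪η (m + (j + 1)), v m⟫_ℝ| ≤ ε := by
        rw [abs_mul]
        calc _ ≤ |shift v η w m| * 1 := mul_le_mul_of_nonneg_left h5 (abs_nonneg _)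
          _ ≤ ε := by rw [mul_one]; exact h2
      rw [real_inner_comm] at h1
      have h7 := (le_abs_self _).trans h1
      have h8 := neg_le_of_abs_le h6
      have h9 : δ = (2 * l + 3) * ε := by rw [hε]; field_simp
      linarith
    exact hw'.norm_sq_add_le hf hr ho' hε0.le hj hjs
  have hsum : ∀ i ≤ q, (i : ℝ) * c ≤ ‖w (i * l)‖ ^ 2 := by
    intro i hi
    induction i with
    | zero => simp
    | succ i ih =>
      have h1 := hwin (i * l) (by nlinarith)
      have h2 := ih (by omega)
      rw [Nat.succ_mul]
      push_cast
      linarith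
  have h1 := hsum q le_rfl
  have h2 : ‖w (q * l)‖ ≤ ρ⁻¹ := by
    refine (norm_perp_le (ho.incoming _).norm_vel _).trans ?_
    have := hxR _ (ho.mem (q * l))
    rw [← le_inv_mul_iff₀ hρ, mul_one] at this
    exact this
  have h3 := pow_le_pow_left₀ (norm_nonneg _) h2 2
  linarith

/-- Uniform expansion of transverse position vectors. -/
theorem exists_expansion (hd : 2 ≤ d) (hgen : InGeneralPosition P) (hobt : IsObtuse P)
    {f : ℝ → ℝ} {lam κ : ℝ} (hf : IsContractingLaw f) (hr : RateBounds f lam κ) :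
    ∃ σ C : ℝ, 1 < σ ∧ 0 < C ∧ ∀ p v η w : ℕ → Space d, IsOrbit f P p v η →
      (∀ k, IsTransverse v η w k) → ∀ n, σ ^ n * ‖w 0‖ ≤ C * ‖w n‖ := by
  classical
  obtain ⟨k, hk0, hk⟩ := hP.exists_generating hd hgen hobt hf hr
  set N := (hP.finite_facetNormals hd).toFinset with hN
  have hmemN : ∀ η, η ∈ N ↔ IsFacetNormal P η := fun η => by simp [hN]
  obtain ⟨ε₀, hε₀, hQ⟩ := exists_uniform_pos N.powerset
    (fun S ε => Submodule.span ℝ (S : Set (Space d)) = ⊤ →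
      ∀ w : Space d, w ≠ 0 → ∃ η ∈ S, ε * ‖w‖ ≤ |⟪w, η⟫_ℝ|)
    (fun S δ δ' h _ hle hS w hw => by
      obtain ⟨η, hη, hg⟩ := h hS w hw
      exact ⟨η, hη, (mul_le_mul_of_nonneg_right hle (norm_nonneg _)).trans hg⟩)
    (fun S _ => by
      by_cases hc : Submodule.span ℝ (S : Set (Space d)) = ⊤
      · obtain ⟨ε, hε, h⟩ := exists_coercive hc
        exact ⟨ε, hε, fun _ => h⟩
      · exact ⟨1, one_pos, fun h => absurd h hc⟩)
  -- Shifts of size at most `ε ‖w 0‖` would give `|⟪w 0, η⟫| ≤ (2 k + 1) ε ‖w 0‖ < ε₀ ‖w 0‖` for all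
  -- normals of the block, against coercivity.
  set ε := ε₀ / (2 * k + 2) with hε
  have hε0 : 0 < ε := by positivity
  set c := (1 - lam ^ 2) * ε ^ 2 with hc
  have hc0 : 0 < c := mul_pos hr.one_sub_sq_pos (by positivity)
  have hstep : ∀ p v η w : ℕ → Space d, IsOrbit f P p v η → (∀ k, IsTransverse v η w k) →
      (1 + c) * ‖w 0‖ ^ 2 ≤ ‖w k‖ ^ 2 := by
    intro p v η w ho hw
    by_cases hw0 : w 0 = 0
    · rw [hw0]; simp
    have hwn : 0 < ‖w 0‖ := norm_pos_iff.2 hw0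
    obtain ⟨j, hj, hjs⟩ : ∃ j < k, ε * ‖w 0‖ < |shift v η w j| := by
      by_contra hcon
      push Not at hcon
      set S := (Finset.range k).image (fun j => η (j + 1)) with hS
      have hSN : S ∈ N.powerset := by
        rw [Finset.mem_powerset]
        intro ζ hζ
        obtain ⟨j, -, rfl⟩ := Finset.mem_image.1 hζ
        exact (hmemN _).2 (ho.isFacetNormal _)
      obtain ⟨ζ, hζ, hge⟩ := hQ S hSN (by
        rw [hS, Finset.coe_image, Finset.coe_range]; exact hk p v η ho) (w 0) hw0
      obtain ⟨j, hj, rfl⟩ := Finset.mem_image.1 hζ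
      rw [Finset.mem_range] at hj
      have h1 := (hw k).abs_inner_le hf hr ho hcon hj
      have h2 : ε₀ = (2 * k + 2) * ε := by rw [hε]; field_simp
      rw [h2] at hge
      have h3 := mul_pos hε0 hwn
      nlinarith
    have := (hw k).norm_sq_add_le hf hr ho (by positivity) hj hjs
    rw [hc]; nlinarith
  set σ : ℝ := (1 + c) ^ ((1 : ℝ) / (2 * k)) with hσ
  have hk1 : (0 : ℝ) < k := by exact_mod_cast hk0
  have hσ1 : 1 < σ := Real.one_lt_rpow (by linarith) (by positivity)
  have hσk : (σ ^ k) ^ 2 = 1 + c := by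
    rw [← pow_mul, ← Real.rpow_natCast, hσ, ← Real.rpow_mul (by linarith)]
    have : (1 : ℝ) / (2 * k) * ((k * 2 : ℕ) : ℝ) = 1 := by push_cast; field_simp
    rw [this, Real.rpow_one]
  have hσk' : ∀ p v η w : ℕ → Space d, IsOrbit f P p v η → (∀ k, IsTransverse v η w k) →
      σ ^ k * ‖w 0‖ ≤ ‖w k‖ := by
    intro p v η w ho hw
    have := hstep p v η w ho hw
    rw [← hσk, ← mul_pow] at this
    exact (sq_le_sq₀ (by positivity) (norm_nonneg _)).1 this
  -- Full blocks of length `k` expand by `σ ^ k`; in the incomplete last block the norm does not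
  -- decrease, and the constant `σ ^ k` covers the missing factor.
  refine ⟨σ, σ ^ k, hσ1, by positivity, fun p v η w ho hw n => ?_⟩
  induction n using Nat.strong_induction_on generalizing p v η w with
  | _ n ih =>
    by_cases hn : n < k
    · have h1 : σ ^ n ≤ σ ^ k := pow_le_pow_right₀ hσ1.le hn.le
      have h2 := (hw n).norm_mono hf hr ho (Nat.zero_le n) le_rfl
      exact mul_le_mul h1 h2 (norm_nonneg _) (by positivity)
    · push Not at hn
      obtain ⟨m, rfl⟩ := Nat.exists_eq_add_of_le hn
      have h1 := ih m (by omega) _ _ _ _ (ho.add k) fun i => (hw (k + i)).add k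
      simp only [add_zero] at h1
      have h2 := hσk' p v η w ho hw
      calc σ ^ (k + m) * ‖w 0‖ = σ ^ m * (σ ^ k * ‖w 0‖) := by ring
        _ ≤ σ ^ m * ‖w k‖ := mul_le_mul_of_nonneg_left h2 (by positivity)
        _ ≤ _ := h1

end IsPolytope

/-! ### Continuity of orthogonal projections -/

section Projection

variable {E : Type*} [NormedAddCommGroup E] [InnerProductSpace ℝ E] [FiniteDimensional ℝ E]

/-- Orthogonal projections are as close as any two projections onto the same subspaces. -/
theorem norm_starProjection_sub_le {V W : Submodule ℝ E} {A B : E →L[ℝ] E}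
    (hA : ∀ x, A x ∈ V) (hAV : ∀ x ∈ V, A x = x) (hB : ∀ x, B x ∈ W) (hBW : ∀ x ∈ W, B x = x) :
    ‖V.starProjection - W.starProjection‖ ≤ 2 * ‖A - B‖ := by
  refine ContinuousLinearMap.opNorm_le_bound _ (by positivity) fun z => ?_
  set u := W.starProjection z with hu
  -- Split `z` into `u ∈ W` and `z - u ⟂ W`. A vector of `V` differs from its image under `B` in `W`
  -- by `A - B`, so `z - u` projects to something small in `V`; likewise `A u ∈ V` is close to `u`.
  have huW : u ∈ W := W.starProjection_apply_mem z
  have horth : ∀ y ∈ W, ⟪y, z - u⟫_ℝ = 0 := fun y hy => by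
    rw [real_inner_comm]; exact W.starProjection_inner_eq_zero z y hy
  have hsq : ‖u‖ ^ 2 + ‖z - u‖ ^ 2 = ‖z‖ ^ 2 := by
    have h1 : z = u + (z - u) := by abel
    conv_rhs => rw [h1]
    rw [norm_add_sq_real, horth u huW]; ring
  have hun : ‖u‖ ≤ ‖z‖ := abs_le_of_sq_le_sq' (by nlinarith [sq_nonneg ‖z - u‖]) (norm_nonneg _) |>.2
  have hzun : ‖z - u‖ ≤ ‖z‖ := abs_le_of_sq_le_sq' (by nlinarith [sq_nonneg ‖u‖]) (norm_nonneg _) |>.2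
  have h1 : ‖V.starProjection (z - u)‖ ≤ ‖A - B‖ * ‖z - u‖ := by
    set y := V.starProjection (z - u) with hy
    have hyV : y ∈ V := V.starProjection_apply_mem _
    have h2 : ⟪y, (z - u) - y⟫_ℝ = 0 := by
      rw [real_inner_comm]; exact V.starProjection_inner_eq_zero (z - u) y hyV
    have h3 : ‖y‖ ^ 2 = ⟪(A - B) y, z - u⟫_ℝ := by
      rw [sub_apply, inner_sub_left, hAV y hyV, horth _ (hB y), sub_zero,
        ← real_inner_self_eq_norm_sq]
      rw [inner_sub_right] at h2; linarith
    have h4 : ⟪(A - B) y, z - u⟫_ℝ ≤ ‖A - B‖ * ‖y‖ * ‖z - u‖ :=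
      (real_inner_le_norm _ _).trans
        (mul_le_mul_of_nonneg_right ((A - B).le_opNorm y) (norm_nonneg _))
    by_cases hy0 : ‖y‖ = 0
    · rw [hy0]; positivity
    · have hpos : 0 < ‖y‖ := lt_of_le_of_ne (norm_nonneg _) (Ne.symm hy0)
      rw [← h3] at h4
      refine le_of_mul_le_mul_left ?_ hpos
      nlinarith
  have h2 : ‖u - V.starProjection u‖ ≤ ‖A - B‖ * ‖u‖ := by
    have hle : ‖u - V.starProjection u‖ ≤ ‖u - A u‖ := by
      rw [V.starProjection_minimal]
      exact ciInf_le ⟨0, by rintro _ ⟨_, rfl⟩; positivity⟩ (⟨A u, hA u⟩ : V)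
    refine hle.trans ?_
    have : u - A u = -((A - B) u) := by rw [sub_apply, hBW u huW]; abel
    rw [this, norm_neg]
    exact (A - B).le_opNorm u
  have h3 : (V.starProjection - W.starProjection) z =
      V.starProjection (z - u) - (u - V.starProjection u) := by
    rw [sub_apply, map_sub, ← hu]; abel
  rw [h3]
  refine (norm_sub_le _ _).trans ?_
  have h4 := mul_le_mul_of_nonneg_left hun (norm_nonneg (A - B))
  have h5 := mul_le_mul_of_nonneg_left hzun (norm_nonneg (A - B))
  linarith

/-- Reduces continuity of a bundle to that of any family of projections onto it, orthogonal or not,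
which can be written explicitly. -/
theorem continuousOn_starProjection {X : Type*} [TopologicalSpace X] {s : Set X}
    {V : X → Submodule ℝ E} {A : X → E →L[ℝ] E} (hA : ContinuousOn A s)
    (hmem : ∀ x ∈ s, ∀ y, A x y ∈ V x) (hfix : ∀ x ∈ s, ∀ y ∈ V x, A x y = y) :
    ContinuousOn (fun x => (V x).starProjection) s := by
  intro x hx
  have h1 : Filter.Tendsto (fun y => 2 * ‖A y - A x‖) (nhdsWithin x s) (nhds 0) := by
    have := (((hA x hx).tendsto.sub_const (A x)).norm).const_mul 2
    simpa using this
  rw [ContinuousWithinAt, tendsto_iff_norm_sub_tendsto_zero]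
  refine squeeze_zero' (Filter.Eventually.of_forall fun _ => norm_nonneg _) ?_ h1
  filter_upwards [self_mem_nhdsWithin] with y hy
  exact norm_starProjection_sub_le (hmem y hy) (hfix y hy) (hmem x hx) (hfix x hx)

end Projection

theorem continuousOn_phaseMk {F X : Type*} [NormedAddCommGroup F] [NormedSpace ℝ F]
    [TopologicalSpace X] {s : Set X} {A B : X → F →L[ℝ] Space d} (hA : ContinuousOn A s)
    (hB : ContinuousOn B s) : ContinuousOn (fun x => phaseMk (A x) (B x)) s := by
  have : ∀ x, phaseMk (A x) (B x) =
      phaseMk (ContinuousLinearMap.id ℝ (Space d)) 0 ∘L A x +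
        phaseMk 0 (ContinuousLinearMap.id ℝ (Space d)) ∘L B x := by
    intro x
    ext1 y
    refine phase_ext ?_ ?_ <;> simp
  simp only [this]
  exact (continuousOn_const.clm_comp hA).add (continuousOn_const.clm_comp hB)

/-! ### The invariant set -/

section MaximalSet

variable {f : ℝ → ℝ} {P : Set (Space d)}

theorem mem_forwardSet_of_mem_maximalSet {x : Phase d} (hx : x ∈ maximalSet f P) :
    x ∈ forwardSet f P := by
  obtain ⟨y, hy, h⟩ := Set.mem_iInter.1 hx 0
  exact h ▸ hy

theorem billiardMap_mem_forwardSet {x : Phase d} (hx : x ∈ forwardSet f P) :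
    billiardMap f P x ∈ forwardSet f P := by
  refine ⟨(hx.2 1).1, fun n => ?_⟩
  have := hx.2 (n + 1)
  rwa [Function.iterate_succ_apply] at this

theorem mapsTo_maximalSet : Set.MapsTo (billiardMap f P) (maximalSet f P) (maximalSet f P) := by
  intro x hx
  refine Set.mem_iInter.2 fun n => ?_
  obtain ⟨y, hy, rfl⟩ := Set.mem_iInter.1 hx n
  exact ⟨billiardMap f P y, billiardMap_mem_forwardSet hy, by
    rw [← Function.iterate_succ_apply, Function.iterate_succ_apply']⟩

theorem iterate_mem_maximalSet {x : Phase d} (hx : x ∈ maximalSet f P) (n : ℕ) :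
    (billiardMap f P)^[n] x ∈ maximalSet f P := mapsTo_maximalSet.iterate n hx

theorem mem_billiardDomain {x : Phase d} (hx : x ∈ maximalSet f P) : x ∈ billiardDomain P :=
  (mem_forwardSet_of_mem_maximalSet hx).2 0

end MaximalSet

/-- The projection onto the tangent space of the facet along the velocity. -/
def alongVel (P : Set (Space d)) (x : Phase d) : Space d →L[ℝ] Space d := oblique (nrm P x) x.snd

/-- The time until the next collision. -/
def nextTime (f : ℝ → ℝ) (P : Set (Space d)) (x : Phase d) : ℝ :=
  hitTime P (nrm P (billiardMap f P x)) x

/-- The derivative of the velocity after the next collision. -/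
def nextVel (f : ℝ → ℝ) (P : Set (Space d)) (x : Phase d) : Space d →L[ℝ] Space d :=
  velDeriv f (nrm P (billiardMap f P x)) x.snd

/-- The inverse of the evolution of transverse positions. -/
def backward (f : ℝ → ℝ) (P : Set (Space d)) (x : Phase d) : Space d →L[ℝ] Space d :=
  perp x.snd ∘L alongVel P (billiardMap f P x)

theorem stepDeriv_fst (f : ℝ → ℝ) (P : Set (Space d)) (x ξ : Phase d) :
    (stepDeriv f P x ξ).fst = oblique (nrm P (billiardMap f P x)) x.snd
      (ξ.fst + nextTime f P x • ξ.snd) := rfl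

theorem stepDeriv_snd (f : ℝ → ℝ) (P : Set (Space d)) (x ξ : Phase d) :
    (stepDeriv f P x ξ).snd = nextVel f P x ξ.snd := rfl

theorem oblique_oblique {η v : Space d} (h : ⟪v, η⟫_ℝ ≠ 0) (ζ y : Space d) :
    oblique η v (oblique ζ v y) = oblique η v y := by
  rw [oblique_apply ζ, map_sub, map_smul, oblique_self h, smul_zero, sub_zero]

theorem oblique_perp {η v : Space d} (h : ⟪v, η⟫_ℝ ≠ 0) (y : Space d) :
    oblique η v (perp v y) = oblique η v y := by
  rw [perp_apply, map_sub, map_smul, oblique_self h, smul_zero, sub_zero]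

theorem perp_oblique {v : Space d} (hv : ‖v‖ = 1) (η y : Space d) :
    perp v (oblique η v y) = perp v y := by
  have : perp v v = 0 := by
    rw [perp_apply, real_inner_self_eq_norm_sq, hv]; simp
  rw [oblique_apply, map_sub, map_smul, this, smul_zero, sub_zero]

/-! ### Coefficients of the graph transform and its fixed point -/

namespace IsPolytope

variable {P : Set (Space d)} (hP : IsPolytope P)
include hP

theorem isOrbit (hd : 2 ≤ d) {f : ℝ → ℝ} {x : Phase d} (hx : x ∈ forwardSet f P) :
    IsOrbit f P (fun n => ((billiardMap f P)^[n] x).fst) (fun n => ((billiardMap f P)^[n] x).snd)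
      (fun n => nrm P ((billiardMap f P)^[n] x)) where
  isFacetNormal n := (hP.exists_isReflection (hx.2 n).1).isFacetNormal
  mem n := hP.fst_mem (hx.2 n).1
  inner_eq n := by
    have h := hP.exists_isReflection (hx.2 n).1
    exact ((hP.mem_intrinsicInterior_face_iff hd h.isFacetNormal).1 h.mem).1
  incoming n := by
    simp only [Function.iterate_succ_apply']
    exact (hP.isHit_nrm hd f (hx.2 n)).incoming
  vel n := by
    simp only [Function.iterate_succ_apply']
    exact hP.billiardMap_snd hd f (hx.2 n)
  pos n := by
    simp only [Function.iterate_succ_apply']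
    exact ⟨_, hP.billiardMap_fst hd f (hx.2 n)⟩

theorem eventually_nrm_eq (hd : 2 ≤ d) {x : Phase d} (hx : x ∈ reflections P) :
    ∀ᶠ y in nhdsWithin x (reflections P), nrm P y = nrm P x := by
  have hr := hP.exists_isReflection hx
  have hint := (hP.mem_intrinsicInterior_face_iff hd hr.isFacetNormal).1 hr.mem
  have hfin : ({ζ | IsFacetNormal P ζ} \ {nrm P x}).Finite := (hP.finite_facetNormals hd).sdiff
  have hev : ∀ᶠ y : Phase d in nhds x, ∀ ζ ∈ {ζ | IsFacetNormal P ζ} \ {nrm P x},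
      offset P ζ < ⟪ζ, y.fst⟫_ℝ := by
    rw [Filter.eventually_all_finite hfin]
    intro ζ hζ
    have hcont : Continuous fun y : Phase d => ⟪ζ, y.fst⟫_ℝ := by fun_prop
    exact (hcont.tendsto x).eventually_const_lt (hint.2 ζ hζ.1 hζ.2)
  filter_upwards [self_mem_nhdsWithin, nhdsWithin_le_nhds hev] with y hy h
  have hry := hP.exists_isReflection hy
  by_contra hne
  have h1 := h _ ⟨hry.isFacetNormal, hne⟩
  have h2 := ((hP.mem_intrinsicInterior_face_iff hd hry.isFacetNormal).1 hry.mem).1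
  linarith

theorem continuousOn_alongVel (hd : 2 ≤ d) : ContinuousOn (alongVel P) (reflections P) := by
  intro x hx
  have hr := hP.exists_isReflection hx
  have hin : Continuous fun y : Phase d => ⟪y.snd, nrm P x⟫_ℝ := by fun_prop
  have hsm : Continuous fun y : Phase d => (innerSL ℝ (nrm P x)).smulRight y.snd := by
    have h2 : Continuous fun y : Phase d => y.snd := by fun_prop
    exact (ContinuousLinearMap.smulRightL ℝ (Space d) (Space d) (innerSL ℝ (nrm P x))).continuous.comp
      h2
  have hc : ContinuousWithinAt (fun y : Phase d => oblique (nrm P x) y.snd) (reflections P) x := by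
    unfold oblique
    exact continuousWithinAt_const.sub
      ((hin.continuousWithinAt.inv₀ hr.inner_pos.ne').smul hsm.continuousWithinAt)
  refine hc.congr_of_eventuallyEq ?_ rfl
  filter_upwards [hP.eventually_nrm_eq hd hx] with y hy
  rw [alongVel, hy]

variable {f : ℝ → ℝ} {lam κ : ℝ}

theorem eventually_nrm_billiardMap (hd : 2 ≤ d) {x : Phase d} (hx : x ∈ billiardDomain P) :
    ∀ᶠ y in nhdsWithin x (reflections P),
      nrm P (billiardMap f P y) = nrm P (billiardMap f P x) ∧
        Incoming (nrm P (billiardMap f P x)) y.snd := by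
  have h := hP.isHit_nrm hd f hx
  filter_upwards [self_mem_nhdsWithin, hP.eventually_isHit hd h] with y hy hyh
  exact ⟨hP.nrm_billiardMap hd f hy hyh, hyh.incoming⟩

theorem continuousWithinAt_nextTime (hd : 2 ≤ d) {x : Phase d} (hx : x ∈ billiardDomain P) :
    ContinuousWithinAt (nextTime f P) (reflections P) x := by
  have h := hP.isHit_nrm hd f hx
  refine (continuousAt_hitTime (P := P) h.incoming).continuousWithinAt.congr_of_eventuallyEq ?_ rfl
  filter_upwards [hP.eventually_nrm_billiardMap hd (f := f) hx] with y hy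
  rw [nextTime, hy.1]

theorem continuousWithinAt_nextVel (hd : 2 ≤ d) (hf : IsContractingLaw f) {x : Phase d}
    (hx : x ∈ billiardDomain P) : ContinuousWithinAt (nextVel f P) (reflections P) x := by
  have h := hP.isHit_nrm hd f hx
  have hev := hP.eventually_nrm_billiardMap hd (f := f) hx
  have hs : Filter.Tendsto (fun y : Phase d => y.snd) (nhdsWithin x (reflections P))
      (nhdsWithin x.snd {v | Incoming (nrm P (billiardMap f P x)) v}) := by
    have hc : Continuous fun y : Phase d => y.snd := by fun_prop
    exact tendsto_nhdsWithin_iff.2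
      ⟨(hc.tendsto x).mono_left nhdsWithin_le_nhds, hev.mono fun y hy => hy.2⟩
  have hc := (continuousOn_velDeriv hf (nrm P (billiardMap f P x)) x.snd h.incoming).tendsto.comp hs
  refine ContinuousWithinAt.congr_of_eventuallyEq
    (f := fun y : Phase d => velDeriv f (nrm P (billiardMap f P x)) y.snd) hc ?_ rfl
  filter_upwards [hev] with y hy
  rw [nextVel, hy.1]

theorem continuousWithinAt_backward (hd : 2 ≤ d) (hf : IsContractingLaw f)
    (hr : RateBounds f lam κ) {x : Phase d} (hx : x ∈ billiardDomain P) :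
    ContinuousWithinAt (backward f P) (reflections P) x := by
  have h1 := hP.tendsto_billiardMap hd hf hr hx
  have h2 := (hP.continuousOn_alongVel hd _
    (hP.billiardMap_mem_reflections hd hf hr hx)).tendsto.comp h1
  have hs : Continuous fun y : Phase d => y.snd := by fun_prop
  have h3 : ContinuousWithinAt (fun y : Phase d => perp y.snd) (reflections P) x :=
    (continuous_perp.comp hs).continuousWithinAt
  exact ContinuousWithinAt.clm_comp h3 h2

theorem norm_nextVel_le (hd : 2 ≤ d) (hr : RateBounds f lam κ) {x : Phase d}
    (hx : x ∈ billiardDomain P) : ‖nextVel f P x‖ ≤ lam :=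
  (hP.isHit_nrm hd f hx).incoming.norm_velDeriv_le hr

/-- `backward` undoes one step of the transverse evolution, which never shortens vectors. -/
theorem norm_backward_le (hd : 2 ≤ d) (hf : IsContractingLaw f) (hr : RateBounds f lam κ)
    {x : Phase d} (hx : x ∈ billiardDomain P) : ‖backward f P x‖ ≤ 1 := by
  refine ContinuousLinearMap.opNorm_le_bound _ zero_le_one fun u => ?_
  have hi := (hP.isHit_nrm hd f hx).incoming
  have href := hP.isReflection_billiardMap hd hf hr hx.1 (hP.isHit_nrm hd f hx)
  set η := nrm P (billiardMap f P x)
  set v' := (billiardMap f P x).snd with hv'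
  have hv'' : v' = outVel f η x.snd := hP.billiardMap_snd hd f hx
  have h1 := (hi.norm_step_sq hf (inner_perp hi.norm_vel (oblique η v' u))).1
  rw [oblique_perp hi.inner_neg.ne, oblique_of_inner_eq_zero (inner_oblique href.inner_pos.ne' u),
    ← hv'', perp_oblique href.norm_vel] at h1
  have hrat := hr.abs_ratio_le hi.incidence_mem
  have hsq : ratio f (incidence η x.snd) ^ 2 ≤ 1 := by
    rw [sq_le_one_iff_abs_le_one]; exact hrat.trans hr.lam_lt_one.le
  have h2 : ‖perp x.snd (oblique η v' u)‖ ^ 2 ≤ ‖perp v' u‖ ^ 2 := by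
    rw [h1]
    have := mul_nonneg (sub_nonneg.2 hsq)
      (sq_nonneg (⟪perp x.snd (oblique η v' u), η⟫_ℝ / ⟪x.snd, η⟫_ℝ))
    linarith
  rw [one_mul]
  exact ((sq_le_sq₀ (norm_nonneg _) (norm_nonneg _)).1 h2).trans (norm_perp_le href.norm_vel u)

theorem exists_nextTime_le (hd : 2 ≤ d) : ∃ R : ℝ, ∀ x ∈ billiardDomain P, |nextTime f P x| ≤ R := by
  refine ⟨Metric.diam P, fun x hx => ?_⟩
  have h := hP.billiardMap_fst hd f hx
  have hit := hP.isHit_nrm hd f hx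
  have h1 : (billiardMap f P x).fst ∈ P := by
    rw [h]; exact (intrinsicInterior_subset hit.mem).1
  have h2 := Metric.dist_le_diam_of_mem hP.isCompact.isBounded h1 (hP.fst_mem hx.1)
  rw [h, dist_eq_norm, add_sub_cancel_left, norm_smul, hit.incoming.norm_vel, mul_one] at h2
  exact h2

/-- A point of `D` has a preimage, so its velocity has just left a collision and makes an angle `f
θ` with the normal. A mere forward orbit could start arbitrarily close to grazing. -/
theorem le_inner_of_mem_maximalSet (hd : 2 ≤ d) (hr : RateBounds f lam κ) {x : Phase d}
    (hx : x ∈ maximalSet f P) : κ ≤ ⟪x.snd, nrm P x⟫_ℝ := by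
  obtain ⟨y, hy, hyx⟩ := Set.mem_iInter.1 hx 1
  have hyd : y ∈ billiardDomain P := hy.2 0
  have hi := (hP.isHit_nrm hd f hyd).incoming
  have h1 := hP.billiardMap_snd hd f hyd
  change billiardMap f P y = x at hyx
  rw [hyx] at h1 hi
  rw [h1, hi.inner_outVel_normal]
  exact hr.le_cos _ hi.incidence_mem

theorem norm_alongVel_le (hd : 2 ≤ d) (hr : RateBounds f lam κ) {x : Phase d}
    (hx : x ∈ maximalSet f P) (u : Space d) : ‖alongVel P x u‖ ≤ (1 + κ⁻¹) * ‖u‖ := by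
  have href := hP.exists_isReflection (mem_billiardDomain hx).1
  have hκ := hP.le_inner_of_mem_maximalSet hd hr hx
  have hpos := hr.κ_pos
  rw [alongVel, oblique_apply]
  refine (norm_sub_le _ _).trans ?_
  rw [norm_smul, href.norm_vel, mul_one, Real.norm_eq_abs, abs_div, abs_of_pos href.inner_pos]
  have h1 : |⟪u, nrm P x⟫_ℝ| ≤ ‖u‖ := by
    have := abs_real_inner_le_norm u (nrm P x)
    rwa [href.isFacetNormal.1, mul_one] at this
  have h2 : |⟪u, nrm P x⟫_ℝ| / ⟪x.snd, nrm P x⟫_ℝ ≤ ‖u‖ / κ :=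
    div_le_div₀ (norm_nonneg _) h1 hpos hκ
  rw [div_eq_mul_inv ‖u‖] at h2
  linarith

/-- The slope of the stable bundle over the velocities. -/
theorem exists_slope (hd : 2 ≤ d) (hf : IsContractingLaw f) (hr : RateBounds f lam κ) :
    ∃ g : Phase d → (Space d →L[ℝ] Space d), ContinuousOn g (maximalSet f P) ∧
      (∃ K : ℝ, ∀ x ∈ maximalSet f P, ‖g x‖ ≤ K) ∧
      ∀ x ∈ maximalSet f P, g x = -(nextTime f P x • perp x.snd) +
        backward f P x ∘L (g (billiardMap f P x) ∘L nextVel f P x) := by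
  classical
  set Λ := maximalSet f P with hΛ
  have hsub : Λ ⊆ reflections P := fun x hx => (mem_billiardDomain hx).1
  obtain ⟨R, hR⟩ := hP.exists_nextTime_le (f := f) hd
  have hτc : Continuous fun x : Λ => nextTime f P x :=
    continuousOn_iff_continuous_domRestrict.1 fun x hx =>
      (hP.continuousWithinAt_nextTime hd (mem_billiardDomain hx)).mono hsub
  have hBc : Continuous fun x : Λ => nextVel f P x :=
    continuousOn_iff_continuous_domRestrict.1 fun x hx =>
      (hP.continuousWithinAt_nextVel hd hf (mem_billiardDomain hx)).mono hsub
  have hUc : Continuous fun x : Λ => backward f P x :=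
    continuousOn_iff_continuous_domRestrict.1 fun x hx =>
      (hP.continuousWithinAt_backward hd hf hr (mem_billiardDomain hx)).mono hsub
  have hvc : Continuous fun x : Λ => perp (x : Phase d).snd := by
    have h2 : Continuous fun x : Λ => (x : Phase d).snd := by fun_prop
    exact continuous_perp.comp h2
  set Φ : Λ → Λ := fun x => ⟨billiardMap f P x, mapsTo_maximalSet x.2⟩ with hΦ
  have hΦc : Continuous Φ := by
    suffices h : Continuous fun x : Λ => billiardMap f P x from h.subtype_mk _
    have hc : ContinuousOn (billiardMap f P) Λ := fun x hx => by
      have h : ContinuousWithinAt (billiardMap f P) (reflections P) x := (tendsto_nhdsWithin_iff.1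
        (hP.tendsto_billiardMap hd hf hr (mem_billiardDomain hx))).1
      exact h.mono hsub
    exact continuousOn_iff_continuous_domRestrict.1 hc
  have hperp1 : ∀ x : Λ, ‖perp (x : Phase d).snd‖ ≤ 1 := fun x =>
    ContinuousLinearMap.opNorm_le_bound _ zero_le_one fun u => by
      rw [one_mul]
      exact norm_perp_le (hP.exists_isReflection (hsub x.2)).norm_vel u
  have hU1 : ∀ x : Λ, ‖backward f P x‖ ≤ 1 := fun x =>
    hP.norm_backward_le hd hf hr (mem_billiardDomain x.2)
  have hB1 : ∀ x : Λ, ‖nextVel f P x‖ ≤ lam := fun x =>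
    hP.norm_nextVel_le hd hr (mem_billiardDomain x.2)
  have hUB : ∀ (x : Λ) (A : Space d →L[ℝ] Space d),
      ‖backward f P x ∘L (A ∘L nextVel f P x)‖ ≤ lam * ‖A‖ := fun x A => by
    refine (ContinuousLinearMap.opNorm_comp_le _ _).trans ?_
    have h1 := (ContinuousLinearMap.opNorm_comp_le A (nextVel f P x)).trans
      (mul_le_mul_of_nonneg_left (hB1 x) (norm_nonneg A))
    have h2 := mul_le_mul (hU1 x) h1 (norm_nonneg _) zero_le_one
    linarith
  -- The graph transform, pulling slopes back from `Φ x` to `x`. It contracts by `lam`, since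
  -- `backward` has norm at most 1 and `nextVel` at most `lam`; its fixed point is automatically
  -- bounded and continuous.
  set T : BoundedContinuousFunction Λ (Space d →L[ℝ] Space d) →
      BoundedContinuousFunction Λ (Space d →L[ℝ] Space d) := fun g =>
    BoundedContinuousFunction.ofNormedAddCommGroup
      (fun x => -(nextTime f P x • perp (x : Phase d).snd) +
        backward f P x ∘L (g (Φ x) ∘L nextVel f P x))
      ((hτc.smul hvc).neg.add (hUc.clm_comp ((g.continuous.comp hΦc).clm_comp hBc)))
      (R + lam * ‖g‖) (fun x => by
        refine (norm_add_le _ _).trans (add_le_add ?_ ?_)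
        · rw [norm_neg, norm_smul, Real.norm_eq_abs]
          have h1 := hR x (mem_billiardDomain x.2)
          have h2 := mul_le_mul h1 (hperp1 x) (norm_nonneg _) ((abs_nonneg _).trans h1)
          linarith
        · exact (hUB x _).trans
            (mul_le_mul_of_nonneg_left (g.norm_coe_le_norm _) hr.lam_pos.le)) with hT
  have hTc : ContractingWith (⟨lam, hr.lam_pos.le⟩ : NNReal) T := by
    refine ⟨by exact_mod_cast hr.lam_lt_one, LipschitzWith.of_dist_le_mul fun g h => ?_⟩
    change dist (T g) (T h) ≤ lam * dist g h
    rw [BoundedContinuousFunction.dist_le (mul_nonneg hr.lam_pos.le dist_nonneg)]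
    intro x
    have h1 : T g x - T h x = backward f P x ∘L ((g (Φ x) - h (Φ x)) ∘L nextVel f P x) := by
      change (-(nextTime f P x • perp (x : Phase d).snd) +
        backward f P x ∘L (g (Φ x) ∘L nextVel f P x)) -
        (-(nextTime f P x • perp (x : Phase d).snd) +
        backward f P x ∘L (h (Φ x) ∘L nextVel f P x)) = _
      rw [add_sub_add_left_eq_sub, ContinuousLinearMap.sub_comp, ContinuousLinearMap.comp_sub]
    rw [dist_eq_norm, h1]
    refine (hUB x _).trans (mul_le_mul_of_nonneg_left ?_ hr.lam_pos.le)
    rw [← dist_eq_norm]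
    exact BoundedContinuousFunction.dist_coe_le_dist _
  set G := hTc.fixedPoint T with hG
  have hfix : T G = G := hTc.fixedPoint_isFixedPt
  refine ⟨fun x => if h : x ∈ Λ then G ⟨x, h⟩ else 0, ?_, ⟨‖G‖, fun x hx => ?_⟩, fun x hx => ?_⟩
  · rw [continuousOn_iff_continuous_domRestrict]
    have : Λ.domRestrict (fun x => if h : x ∈ Λ then G ⟨x, h⟩ else 0) = G := by
      ext1 x
      exact dif_pos x.2
    rw [this]
    exact G.continuous
  · simp only [hx, dif_pos]
    exact G.norm_coe_le_norm _
  · have hx' : billiardMap f P x ∈ Λ := mapsTo_maximalSet hx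
    simp only [hx, hx', dif_pos]
    conv_lhs => rw [← hfix]
    rfl

end IsPolytope

/-! ### The invariant bundles -/

theorem iterDeriv_one (f : ℝ → ℝ) (P : Set (Space d)) (x ξ : Phase d) :
    iterDeriv f P 1 x ξ = stepDeriv f P x ξ := rfl

/-- The tangent vectors without velocity component. -/
def unstable (P : Set (Space d)) (x : Phase d) : Submodule ℝ (Phase d) :=
  ((ℝ ∙ nrm P x)ᗮ).map (phaseMk (ContinuousLinearMap.id ℝ (Space d)) 0).toLinearMap

theorem mem_unstable {P : Set (Space d)} {x ξ : Phase d} :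
    ξ ∈ unstable P x ↔ ⟪nrm P x, ξ.fst⟫_ℝ = 0 ∧ ξ.snd = 0 := by
  rw [unstable, Submodule.mem_map]
  constructor
  · rintro ⟨y, hy, rfl⟩
    exact ⟨Submodule.mem_orthogonal_singleton_iff_inner_right.1 hy, rfl⟩
  · rintro ⟨h1, h2⟩
    exact ⟨ξ.fst, Submodule.mem_orthogonal_singleton_iff_inner_right.2 h1, phase_ext rfl h2.symm⟩

/-- The graph over the velocities with slope `g x`. -/
def stable (P : Set (Space d)) (g : Phase d → Space d →L[ℝ] Space d) (x : Phase d) :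
    Submodule ℝ (Phase d) :=
  ((ℝ ∙ x.snd)ᗮ).map
    (phaseMk (alongVel P x ∘L g x) (ContinuousLinearMap.id ℝ (Space d))).toLinearMap

theorem mem_stable {P : Set (Space d)} {g : Phase d → Space d →L[ℝ] Space d} {x ξ : Phase d} :
    ξ ∈ stable P g x ↔ ⟪x.snd, ξ.snd⟫_ℝ = 0 ∧ ξ.fst = alongVel P x (g x ξ.snd) := by
  rw [stable, Submodule.mem_map]
  constructor
  · rintro ⟨y, hy, rfl⟩
    exact ⟨Submodule.mem_orthogonal_singleton_iff_inner_right.1 hy, rfl⟩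
  · rintro ⟨h1, h2⟩
    exact ⟨ξ.snd, Submodule.mem_orthogonal_singleton_iff_inner_right.2 h1, phase_ext h2.symm rfl⟩

theorem finrank_stable (P : Set (Space d)) (g : Phase d → Space d →L[ℝ] Space d) {x : Phase d}
    (hx : x.snd ≠ 0) : Module.finrank ℝ (stable P g x) + 1 = d := by
  have hinj : Function.Injective
      (phaseMk (alongVel P x ∘L g x) (ContinuousLinearMap.id ℝ (Space d))).toLinearMap :=
    fun y z h => congrArg WithLp.snd h
  rw [stable, ← (Submodule.equivMapOfInjective _ hinj ((ℝ ∙ x.snd)ᗮ)).finrank_eq]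
  exact finrank_orthogonal_singleton hx

namespace IsPolytope

variable {P : Set (Space d)} (hP : IsPolytope P)
include hP

variable {f : ℝ → ℝ} {lam κ : ℝ} {g : Phase d → Space d →L[ℝ] Space d}

theorem inner_alongVel {x : Phase d} (hx : x ∈ reflections P) (u : Space d) :
    ⟪nrm P x, alongVel P x u⟫_ℝ = 0 := by
  rw [real_inner_comm]
  exact inner_oblique (hP.exists_isReflection hx).inner_pos.ne' u

theorem unstable_le (x : Phase d) : unstable P x ≤ tangentSpaceAt P x := by
  have := hP
  intro ξ hξ
  rw [mem_unstable] at hξ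
  rw [mem_tangentSpaceAt, hξ.2, inner_zero_right]
  exact ⟨hξ.1, rfl⟩

theorem stable_le {x : Phase d} (hx : x ∈ reflections P) :
    stable P g x ≤ tangentSpaceAt P x := by
  intro ξ hξ
  rw [mem_stable] at hξ
  rw [mem_tangentSpaceAt, hξ.2]
  exact ⟨hP.inner_alongVel hx _, hξ.1⟩

theorem stable_sup_unstable {x : Phase d} (hx : x ∈ reflections P) :
    stable P g x ⊔ unstable P x = tangentSpaceAt P x := by
  refine le_antisymm (sup_le (hP.stable_le hx) (hP.unstable_le x)) fun ξ hξ => ?_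
  rw [mem_tangentSpaceAt] at hξ
  rw [Submodule.mem_sup]
  refine ⟨phaseMk (alongVel P x ∘L g x) (ContinuousLinearMap.id ℝ (Space d)) ξ.snd,
    mem_stable.2 ⟨hξ.2, rfl⟩,
    phaseMk (ContinuousLinearMap.id ℝ (Space d)) 0 (ξ.fst - alongVel P x (g x ξ.snd)),
    mem_unstable.2 ⟨?_, rfl⟩, phase_ext ?_ ?_⟩
  · change ⟪nrm P x, ξ.fst - alongVel P x (g x ξ.snd)⟫_ℝ = 0
    rw [inner_sub_right, hξ.1, hP.inner_alongVel hx, sub_zero]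
  · exact add_sub_cancel _ _
  · exact add_zero _

omit hP in
theorem disjoint_stable_unstable (x : Phase d) : Disjoint (stable P g x) (unstable P x) := by
  rw [Submodule.disjoint_def]
  intro ξ h1 h2
  rw [mem_stable] at h1
  rw [mem_unstable] at h2
  refine phase_ext ?_ h2.2
  rw [h1.2, h2.2, map_zero, map_zero]
  rfl

theorem continuousOn_stable (hd : 2 ≤ d) {Λ : Set (Phase d)} (hΛ : Λ ⊆ reflections P)
    (hg : ContinuousOn g Λ) : ContinuousOn (fun x => (stable P g x).starProjection) Λ := by
  have hperp : ContinuousOn (fun x : Phase d => perp x.snd ∘L WithLp.sndL 2 ℝ (Space d) (Space d))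
      Λ := by
    have h : Continuous fun x : Phase d => x.snd := by fun_prop
    exact (continuous_perp.comp h).continuousOn.clm_comp continuousOn_const
  refine continuousOn_starProjection (A := fun x =>
    phaseMk ((alongVel P x ∘L g x) ∘L (perp x.snd ∘L WithLp.sndL 2 ℝ (Space d) (Space d)))
      (perp x.snd ∘L WithLp.sndL 2 ℝ (Space d) (Space d)))
    (continuousOn_phaseMk ((((hP.continuousOn_alongVel hd).mono hΛ).clm_comp hg).clm_comp hperp)
      hperp) (fun x hx ξ => ?_) (fun x hx ξ hξ => ?_)
  · exact mem_stable.2 ⟨inner_perp (hP.exists_isReflection (hΛ hx)).norm_vel _, rfl⟩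
  · rw [mem_stable] at hξ
    have h : perp x.snd ξ.snd = ξ.snd := perp_of_inner_eq_zero hξ.1
    refine phase_ext ?_ h
    rw [hξ.2]
    change alongVel P x (g x (perp x.snd ξ.snd)) = _
    rw [h]

theorem continuousOn_unstable (hd : 2 ≤ d) {Λ : Set (Phase d)} (hΛ : Λ ⊆ reflections P) :
    ContinuousOn (fun x => (unstable P x).starProjection) Λ := by
  intro x hx
  refine (continuousWithinAt_const (b := (unstable P x).starProjection)).congr_of_eventuallyEq
    ?_ rfl
  filter_upwards [nhdsWithin_mono x hΛ (hP.eventually_nrm_eq hd (hΛ hx))] with y hy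
  have : unstable P y = unstable P x := by
    have hy' : nrm P y = nrm P x := hy
    rw [unstable, unstable, hy']
  rw [this]

/-- The slope equation is this invariance solved for `g x`: free flight adds `nextTime • ξ.snd`,
which cancels the first term, and projection along the velocity undoes `backward`. -/
theorem stepDeriv_mem_stable (hd : 2 ≤ d) (hf : IsContractingLaw f) (hr : RateBounds f lam κ)
    {x ξ : Phase d} (hx : x ∈ billiardDomain P)
    (hgx : g x = -(nextTime f P x • perp x.snd) +
      backward f P x ∘L (g (billiardMap f P x) ∘L nextVel f P x)) (hξ : ξ ∈ stable P g x) :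
    stepDeriv f P x ξ ∈ stable P g (billiardMap f P x) := by
  have hi := (hP.isHit_nrm hd f hx).incoming
  have href := hP.isReflection_billiardMap hd hf hr hx.1 (hP.isHit_nrm hd f hx)
  rw [mem_stable] at hξ ⊢
  rw [stepDeriv_fst, stepDeriv_snd]
  constructor
  · rw [hP.billiardMap_snd hd f hx]
    exact hi.inner_outVel_velDeriv hf hξ.1
  · have h1 : g x ξ.snd = -(nextTime f P x • ξ.snd) + perp x.snd (alongVel P (billiardMap f P x)
        (g (billiardMap f P x) (nextVel f P x ξ.snd))) := by
      have h := DFunLike.congr_fun hgx ξ.snd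
      have h2 : perp x.snd ξ.snd = ξ.snd := perp_of_inner_eq_zero hξ.1
      rw [h]
      change -(nextTime f P x • perp x.snd ξ.snd) + _ = _
      rw [h2]
      rfl
    rw [hξ.2, map_add, alongVel, oblique_oblique hi.inner_neg.ne, ← map_add, h1,
      neg_add_eq_sub, sub_add_cancel, oblique_perp hi.inner_neg.ne]
    exact oblique_of_inner_eq_zero (inner_oblique href.inner_pos.ne' _)

/-- Without velocity component the step projects one facet's tangent space onto the next along
`x.snd`; projecting back along the same vector inverts it. -/
theorem map_stepDeriv_unstable (hd : 2 ≤ d) (hf : IsContractingLaw f)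
    {x : Phase d} (hx : x ∈ billiardDomain P) :
    (unstable P x).map (stepDeriv f P x).toLinearMap = unstable P (billiardMap f P x) := by
  have hi := (hP.isHit_nrm hd f hx).incoming
  refine le_antisymm ?_ fun ξ hξ => ?_
  · rintro _ ⟨ξ, hξ, rfl⟩
    have h1 := hP.stepDeriv_mem hd hf hx (hP.unstable_le x hξ)
    rw [SetLike.mem_coe, mem_unstable] at hξ
    rw [mem_tangentSpaceAt] at h1
    refine mem_unstable.2 ⟨h1.1, ?_⟩
    change nextVel f P x ξ.snd = 0
    rw [hξ.2, map_zero]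
  · rw [mem_unstable] at hξ
    refine ⟨phaseMk (ContinuousLinearMap.id ℝ (Space d)) 0 (alongVel P x ξ.fst),
      mem_unstable.2 ⟨hP.inner_alongVel hx.1 _, rfl⟩, phase_ext ?_ ?_⟩
    · change oblique _ _ (alongVel P x ξ.fst + nextTime f P x • (0 : Space d)) = ξ.fst
      rw [smul_zero, add_zero, alongVel, oblique_oblique hi.inner_neg.ne]
      exact oblique_of_inner_eq_zero (by rw [real_inner_comm]; exact hξ.1)
    · rw [hξ.2]
      exact map_zero (nextVel f P x)

/-- The derivatives of the iterates contract the velocity components. -/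
theorem norm_iterDeriv_snd_le (hd : 2 ≤ d) (hr : RateBounds f lam κ) {x : Phase d}
    (hx : x ∈ forwardSet f P) (ξ : Phase d) (n : ℕ) :
    ‖(iterDeriv f P n x ξ).snd‖ ≤ lam ^ n * ‖ξ.snd‖ := by
  induction n with
  | zero => rw [pow_zero, one_mul]; exact le_rfl
  | succ n ih =>
    change ‖nextVel f P ((billiardMap f P)^[n] x) (iterDeriv f P n x ξ).snd‖ ≤ _
    have h1 := (nextVel f P ((billiardMap f P)^[n] x)).le_of_opNorm_le
      (hP.norm_nextVel_le hd hr (hx.2 n)) (iterDeriv f P n x ξ).snd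
    rw [pow_succ']
    nlinarith [mul_le_mul_of_nonneg_left ih hr.lam_pos.le]

theorem iterDeriv_mem_stable (hd : 2 ≤ d) (hf : IsContractingLaw f) (hr : RateBounds f lam κ)
    (hg : ∀ x ∈ maximalSet f P, g x = -(nextTime f P x • perp x.snd) +
      backward f P x ∘L (g (billiardMap f P x) ∘L nextVel f P x)) {x ξ : Phase d}
    (hx : x ∈ maximalSet f P) (hξ : ξ ∈ stable P g x) (n : ℕ) :
    iterDeriv f P n x ξ ∈ stable P g ((billiardMap f P)^[n] x) := by
  induction n with
  | zero => exact hξ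
  | succ n ih =>
    rw [Function.iterate_succ_apply']
    have h := iterate_mem_maximalSet hx n
    exact hP.stepDeriv_mem_stable hd hf hr (mem_billiardDomain h) (hg _ h) ih

theorem iterDeriv_mem_unstable (hd : 2 ≤ d) (hf : IsContractingLaw f) {x ξ : Phase d}
    (hx : x ∈ forwardSet f P) (hξ : ξ ∈ unstable P x) (n : ℕ) :
    iterDeriv f P n x ξ ∈ unstable P ((billiardMap f P)^[n] x) := by
  induction n with
  | zero => exact hξ
  | succ n ih =>
    rw [Function.iterate_succ_apply', ← hP.map_stepDeriv_unstable hd hf (hx.2 n)]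
    exact Submodule.mem_map_of_mem ih

/-- A stable vector is controlled by its velocity component, so contraction of velocities gives
contraction of the whole bundle. -/
theorem norm_le_of_mem_stable (hd : 2 ≤ d) (hr : RateBounds f lam κ) {K : ℝ} {x ξ : Phase d}
    (hx : x ∈ maximalSet f P) (hK : ‖g x‖ ≤ K) (hξ : ξ ∈ stable P g x) :
    ‖ξ‖ ≤ ((1 + κ⁻¹) * K + 1) * ‖ξ.snd‖ := by
  rw [mem_stable] at hξ
  have hpos : 0 ≤ 1 + κ⁻¹ := by have := hr.κ_pos; positivity
  have h1 : ‖ξ.fst‖ ≤ (1 + κ⁻¹) * (K * ‖ξ.snd‖) := by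
    rw [hξ.2]
    exact (hP.norm_alongVel_le hd hr hx _).trans
      (mul_le_mul_of_nonneg_left ((g x).le_of_opNorm_le hK _) hpos)
  have h2 : ‖ξ‖ ≤ ‖ξ.fst‖ + ‖ξ.snd‖ := by
    rw [WithLp.prod_norm_eq_of_L2]
    refine Real.sqrt_le_iff.2 ⟨by positivity, ?_⟩
    nlinarith [mul_nonneg (norm_nonneg ξ.fst) (norm_nonneg ξ.snd)]
  linarith

/-- The oblique projection forgets components along the velocity, so the transverse parts evolve by
themselves. -/
theorem isTransverse_iterDeriv (hd : 2 ≤ d) (hf : IsContractingLaw f) {x ξ : Phase d}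
    (hx : x ∈ forwardSet f P) (hξ : ξ ∈ unstable P x) (k : ℕ) :
    IsTransverse (fun n => ((billiardMap f P)^[n] x).snd)
      (fun n => nrm P ((billiardMap f P)^[n] x))
      (fun n => perp ((billiardMap f P)^[n] x).snd (iterDeriv f P n x ξ).fst) k where
  inner_eq n _ := inner_perp (hP.exists_isReflection (hx.2 n).1).norm_vel _
  step n _ := by
    have h0 := (mem_unstable.1 (hP.iterDeriv_mem_unstable hd hf hx hξ n)).2
    have hi := (hP.isHit_nrm hd f (hx.2 n)).incoming
    have h1 : (iterDeriv f P (n + 1) x ξ).fst =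
        oblique (nrm P (billiardMap f P ((billiardMap f P)^[n] x))) ((billiardMap f P)^[n] x).snd
          (iterDeriv f P n x ξ).fst := by
      change (stepDeriv f P ((billiardMap f P)^[n] x) (iterDeriv f P n x ξ)).fst = _
      rw [stepDeriv_fst, h0, smul_zero, add_zero]
    simp only [Function.iterate_succ_apply'] at h1 ⊢
    rw [h1, oblique_perp hi.inner_neg.ne]

/-- Projecting the transverse part along the velocity recovers the vector, with bounded distortion
because velocities on `D` are uniformly transverse to the facets. -/
theorem norm_le_of_mem_unstable (hd : 2 ≤ d) (hr : RateBounds f lam κ) {x ξ : Phase d}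
    (hx : x ∈ maximalSet f P) (hξ : ξ ∈ unstable P x) :
    ‖ξ‖ ≤ (1 + κ⁻¹) * ‖perp x.snd ξ.fst‖ := by
  rw [mem_unstable] at hξ
  have hrx := hP.exists_isReflection (mem_billiardDomain hx).1
  have h1 : ‖ξ‖ = ‖ξ.fst‖ := by
    rw [WithLp.prod_norm_eq_of_L2, hξ.2, norm_zero]
    simp
  have h2 : alongVel P x (perp x.snd ξ.fst) = ξ.fst := by
    rw [alongVel, oblique_perp hrx.inner_pos.ne']
    exact oblique_of_inner_eq_zero (by rw [real_inner_comm]; exact hξ.1)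
  rw [h1]
  conv_lhs => rw [← h2]
  exact hP.norm_alongVel_le hd hr hx _

theorem differentiableWithinAt_iterate (hd : 2 ≤ d) (hf : IsContractingLaw f)
    (hr : RateBounds f lam κ) {x : Phase d} (hx : x ∈ forwardSet f P) (n : ℕ) :
    DifferentiableWithinAt ℝ ((billiardMap f P)^[n]) (reflections P) x :=
  ⟨_, (hP.hasFDerivWithinAt_iterate hd hf hr hx n).1⟩

theorem map_tangentMap_one (hd : 2 ≤ d) (hf : IsContractingLaw f) (hr : RateBounds f lam κ)
    {x : Phase d} (hx : x ∈ forwardSet f P) {V : Submodule ℝ (Phase d)}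
    (hV : V ≤ tangentSpaceAt P x) : V.map (tangentMap f P 1 x).toLinearMap =
      V.map (stepDeriv f P x).toLinearMap := by
  ext ζ
  simp only [Submodule.mem_map]
  refine exists_congr fun ξ => and_congr_right fun hξ => ?_
  have := hP.tangentMap_apply hd hf hr hx (hV hξ) 1
  rw [iterDeriv_one] at this
  exact Eq.congr_left this

omit hP in
theorem map_eq_of_injOn {E : Type*} [AddCommGroup E] [Module ℝ E] [FiniteDimensional ℝ E]
    {T : E →ₗ[ℝ] E} {V W : Submodule ℝ E} (hle : V.map T ≤ W) (hinj : Set.InjOn T V)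
    (hrank : Module.finrank ℝ V = Module.finrank ℝ W) : V.map T = W := by
  refine Submodule.eq_of_le_of_finrank_eq hle ?_
  rw [← hrank, ← LinearMap.range_domRestrict]
  exact LinearMap.finrank_range_of_inj fun y z h => Subtype.ext (hinj y.2 z.2 h)

theorem isUniformlyHyperbolic (hd : 2 ≤ d) (hgen : InGeneralPosition P) (hobt : IsObtuse P)
    (hf : IsContractingLaw f) : IsUniformlyHyperbolic f P := by
  obtain ⟨lam, κ, hr⟩ := hf.exists_rateBounds
  obtain ⟨g, hgc, ⟨K, hK⟩, hg⟩ := hP.exists_slope hd hf hr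
  obtain ⟨σ, C, hσ, hC, hexp⟩ := hP.exists_expansion hd hgen hobt hf hr
  have hfwd : ∀ {x}, x ∈ maximalSet f P → x ∈ forwardSet f P := mem_forwardSet_of_mem_maximalSet
  have hsub : maximalSet f P ⊆ reflections P := fun x hx => (hfwd hx).1
  have hstab : ∀ x ∈ maximalSet f P,
      (stable P g x).map (tangentMap f P 1 x).toLinearMap ≤ stable P g (billiardMap f P x) := by
    intro x hx
    rw [hP.map_tangentMap_one hd hf hr (hfwd hx) (hP.stable_le (hsub hx)),
      Submodule.map_le_iff_le_comap]
    exact fun ξ hξ => hP.stepDeriv_mem_stable hd hf hr (mem_billiardDomain hx) (hg x hx) hξ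
  have hvel : ∀ x ∈ maximalSet f P, x.snd ≠ 0 := fun x hx h0 => by
    have h := (hP.exists_isReflection (hsub hx)).norm_vel
    rw [h0, norm_zero] at h
    exact zero_ne_one h
  have hκ := hr.κ_pos
  have hsnd : ∀ ξ : Phase d, ‖ξ.snd‖ ≤ ‖ξ‖ := fun ξ => WithLp.norm_snd_le _ ξ
  have hfst : ∀ ξ : Phase d, ‖ξ.fst‖ ≤ ‖ξ‖ := fun ξ => WithLp.norm_fst_le _ ξ
  set A : ℝ := (1 + κ⁻¹) * K + 1
  set B : ℝ := (1 + κ⁻¹) * C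
  have hB : 0 < B := by positivity
  refine ⟨mapsTo_maximalSet, fun n x hx => hP.differentiableWithinAt_iterate hd hf hr (hfwd hx) n,
    stable P g, unstable P,
    fun x hx => ⟨hP.stable_sup_unstable (hsub hx), disjoint_stable_unstable x⟩,
    hP.continuousOn_stable hd hsub hgc, hP.continuousOn_unstable hd hsub, hstab,
    fun x hx hinj => map_eq_of_injOn (hstab x hx) (hinj.mono (hP.stable_le (hsub hx))) ?_,
    fun x hx => ?_, lam, σ, max A B, hr.lam_pos, hr.lam_lt_one, hσ, lt_max_of_lt_right hB,
    fun n _ x hx ξ hξ => ?_, fun n _ x hx ξ hξ => ?_⟩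
  · have h1 := finrank_stable P g (hvel x hx)
    have h2 := finrank_stable P g (hvel _ (mapsTo_maximalSet hx))
    omega
  · rw [hP.map_tangentMap_one hd hf hr (hfwd hx) (hP.unstable_le x)]
    exact hP.map_stepDeriv_unstable hd hf (mem_billiardDomain hx)
  · rw [hP.tangentMap_apply hd hf hr (hfwd hx) (hP.stable_le (hsub hx) hξ)]
    have hxn := iterate_mem_maximalSet hx n
    have hA : 0 ≤ A := by
      have := (norm_nonneg _).trans (hK x hx)
      positivity
    have h0 := hP.norm_le_of_mem_stable hd hr hxn (hK _ hxn)
      (hP.iterDeriv_mem_stable hd hf hr hg hx hξ n)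
    have hpow := pow_nonneg hr.lam_pos.le n
    calc ‖iterDeriv f P n x ξ‖ ≤ A * ‖(iterDeriv f P n x ξ).snd‖ := h0
      _ ≤ A * (lam ^ n * ‖ξ.snd‖) :=
        mul_le_mul_of_nonneg_left (hP.norm_iterDeriv_snd_le hd hr (hfwd hx) ξ n) hA
      _ ≤ A * (lam ^ n * ‖ξ‖) :=
        mul_le_mul_of_nonneg_left (mul_le_mul_of_nonneg_left (hsnd ξ) hpow) hA
      _ = A * lam ^ n * ‖ξ‖ := by ring
      _ ≤ max A B * lam ^ n * ‖ξ‖ := by gcongr; exact le_max_left _ _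
  · rw [hP.tangentMap_apply hd hf hr (hfwd hx) (hP.unstable_le x hξ)]
    have hxn := iterate_mem_maximalSet hx n
    have h0 := hexp _ _ _ _ (hP.isOrbit hd (hfwd hx))
      (hP.isTransverse_iterDeriv hd hf (hfwd hx) hξ) n
    have h1 := hP.norm_le_of_mem_unstable hd hr hx hξ
    have hσn : 0 < σ ^ n := pow_pos (zero_lt_one.trans hσ) n
    have h2 : ‖perp ((billiardMap f P)^[n] x).snd (iterDeriv f P n x ξ).fst‖ ≤
        ‖iterDeriv f P n x ξ‖ :=
      (norm_perp_le (hP.exists_isReflection (hsub hxn)).norm_vel _).trans (hfst _)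
    have h3 : ‖perp x.snd ξ.fst‖ ≤ (σ ^ n)⁻¹ * (C * ‖iterDeriv f P n x ξ‖) := by
      rw [le_inv_mul_iff₀ hσn]
      exact h0.trans (mul_le_mul_of_nonneg_left h2 hC.le)
    calc ‖ξ‖ ≤ (1 + κ⁻¹) * ‖perp x.snd ξ.fst‖ := h1
      _ ≤ (1 + κ⁻¹) * ((σ ^ n)⁻¹ * (C * ‖iterDeriv f P n x ξ‖)) :=
        mul_le_mul_of_nonneg_left h3 (by positivity)
      _ = B * (σ ^ n)⁻¹ * ‖iterDeriv f P n x ξ‖ := by ring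
      _ ≤ max A B * (σ ^ n)⁻¹ * ‖iterDeriv f P n x ξ‖ := by gcongr; exact le_max_right _ _

end IsPolytope

end PolytopeBilliard

end

theorem corollary2p13 (d : ℕ) (hd : 2 ≤ d) (P : Set (PolytopeBilliard.Space d))
    (hP : PolytopeBilliard.IsPolytope P) (hgen : PolytopeBilliard.InGeneralPosition P)
    (hobt : PolytopeBilliard.IsObtuse P)
    (f : ℝ → ℝ) (hf : PolytopeBilliard.IsContractingLaw f) :
    PolytopeBilliard.IsUniformlyHyperbolic f P := by
  exact hP.isUniformlyHyperbolic hd hgen hobt hf
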